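/- Let $k$ be a field. A standard graded $k$-algebra is a commutative graded $k$-algebra $R=\bigoplus_{n\ge 0}R_n$ with $R_0=k\neq 0$, generated as a $k$-algebra by the finite-dimensional space $R_1$; write $R_{\ge 1}=\bigoplus_{n\ge 1}R_n$ and let $\varepsilon_R\colon R\to R_0=k$ be the canonical augmentation. $R$ is Koszul if $k$, viewed as an $R$-module via $\varepsilon_R$, has a linear graded free resolution. $R$ is a complete intersection if $R\cong k[x_1,\dots,x_n]/(f_1,\dots,f_c)$ as graded algebras for some regular sequence of homogeneous polynomials $f_1,\dots,f_c$. For a finitely generated graded $R$-module $M$ let $P^R_M(s,z)=\sum_{i,j}\dim_k\operatorname{Tor}^R_i(k,M)_j\,s^jz^i$. A surjective morphism $\varphi\colon Q\to R$ of standard graded $k$-algebras with $\operatorname{Ker}\varphi\subseteq (Q_{\ge 1})^2$ is Golod if $$P^R_k(s,z)=\frac{P^Q_k(s,z)}{1-z\,(P^Q_R(s,z)-1)}.$$ $R$ has the Backelin-Roos property if there is a surjective Golod morphism $Q\to R$ with $Q$ a standard graded complete intersection. **Theorem.** Let $S$ and $T$ be standard graded Koszul $k$-algebras with the Backelin-Roos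 property. Then the fibre product $$S\times_kT=\{(s,t)\in S\times T\mid \varepsilon_S(s)=\varepsilon_T(t)\}$$ is a standard graded Koszul $k$-algebra with the Backelin-Roos property. Moreover, for any surjective Golod morphisms $\varphi\colon S_1\to S$ and $\psi\colon T_1\to T$ with $S_1$ and $T_1$ standard graded complete intersections, $S_1\otimes_kT_1$ is a standard graded complete intersection and the composite $$S_1\otimes_kT_1\xrightarrow{\ \varphi\otimes\psi\ }S\otimes_kT\longrightarrow S\times_kT,\qquad\text{the second map being } s\otimes t\mapsto(s\,\varepsilon_T(t),\ \varepsilon_S(s)\,t),$$ is a surjective Golod morphism. -/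

import Mathlib

open scoped TensorProduct DirectSum Polynomial

universe u v w

namespace BackelinRoos

/-! ### Standard graded algebras and their augmentation -/

section Basic

variable {k : Type u} [Field k] {A : Type v} [CommRing A] [Algebra k A]

/-- An `ℕ`-graded commutative algebra `A = ⨁ Aₙ` over the field `k` is standard graded if it is
nonzero, `A₀ = k`, and it is generated as a `k`-algebra by the finite-dimensional space `A₁`. -/
class IsStandardGraded (𝒜 : ℕ → Submodule k A) [GradedAlgebra 𝒜] : Prop where
  nontrivial : Nontrivial A
  zero_eq : 𝒜 0 = 1
  finite_one : Module.Finite k (𝒜 1)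
  adjoin_one : Algebra.adjoin k (𝒜 1 : Set A) = ⊤

variable (𝒜 : ℕ → Submodule k A) [GradedAlgebra 𝒜] [IsStandardGraded 𝒜]

theorem bijective_ofId_zero : Function.Bijective (Algebra.ofId k (𝒜 0)) := by
  have : Nontrivial A := IsStandardGraded.nontrivial (𝒜 := 𝒜)
  refine ⟨fun a b h => ?_, fun x => ?_⟩
  · apply (algebraMap k A).injective
    exact congrArg (fun z : 𝒜 0 => (z : A)) h
  · have hx : (x : A) ∈ (1 : Submodule k A) := IsStandardGraded.zero_eq (𝒜 := 𝒜) ▸ x.2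
    obtain ⟨c, hc⟩ := Submodule.mem_one.mp hx
    exact ⟨c, Subtype.ext hc⟩

/-- The projection of a graded algebra onto its degree-zero part. -/
def projZero : A →ₐ[k] 𝒜 0 :=
  { GradedRing.projZeroRingHom' 𝒜 with
    commutes' := fun c => GradedRing.projZeroRingHom'_apply_coe 𝒜 (algebraMap k (𝒜 0) c) }

/-- The canonical augmentation `A → A₀ = k` of a standard graded `k`-algebra. -/
noncomputable def augmentation : A →ₐ[k] k :=
  ((AlgEquiv.ofBijective (Algebra.ofId k (𝒜 0)) (bijective_ofId_zero 𝒜)).symm :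
    𝒜 0 →ₐ[k] k).comp (projZero 𝒜)

theorem algebraMap_augmentation (a : A) :
    algebraMap k A (augmentation 𝒜 a) = GradedRing.proj 𝒜 0 a := by
  have h := (AlgEquiv.ofBijective (Algebra.ofId k (𝒜 0))
    (bijective_ofId_zero 𝒜)).apply_symm_apply (projZero 𝒜 a)
  exact congrArg (fun z : 𝒜 0 => (z : A)) h

theorem augmentation_of_mem {n : ℕ} (hn : n ≠ 0) {a : A} (ha : a ∈ 𝒜 n) :
    augmentation 𝒜 a = 0 := by
  have : Nontrivial A := IsStandardGraded.nontrivial (𝒜 := 𝒜)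
  apply (algebraMap k A).injective
  rw [algebraMap_augmentation, map_zero, GradedRing.proj_apply,
    DirectSum.decompose_of_mem_ne 𝒜 ha hn]

theorem augmentation_proj_zero (a : A) :
    augmentation 𝒜 (GradedRing.proj 𝒜 0 a) = augmentation 𝒜 a := by
  rw [← algebraMap_augmentation, AlgHom.commutes]; rfl

end Basic

/-! ### Minimal graded free resolutions, Poincaré series, Koszul algebras -/

section Resolutions

variable {k : Type u} [Field k] {A : Type v} [CommRing A] [Algebra k A]

/-- A graded free resolution
`⋯ → F₂ → F₁ → F₀ → M → 0` of a graded `A`-module `M = ⨁ Mₙ` by finitely generated graded free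
`A`-modules `Fᵢ = ⨁ᵣ A(-deg i r)`, all maps being homogeneous of degree zero. -/
structure GradedFreeResolution (𝒜 : ℕ → Submodule k A)
    {M : Type w} [AddCommGroup M] [Module k M] [Module A M] (ℳ : ℕ → Submodule k M) where
  /-- the rank of `Fᵢ` -/
  rank : ℕ → ℕ
  /-- the degree of the `r`-th basis element of `Fᵢ` -/
  deg : (i : ℕ) → Fin (rank i) → ℕ
  /-- the differential `Fᵢ₊₁ → Fᵢ` -/
  d : (i : ℕ) → (Fin (rank (i + 1)) → A) →ₗ[A] (Fin (rank i) → A)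
  /-- the augmentation `F₀ → M` -/
  aug : (Fin (rank 0) → A) →ₗ[A] M
  d_homogeneous : ∀ (i : ℕ) (c : Fin (rank (i + 1))) (r : Fin (rank i)),
    (deg i r ≤ deg (i + 1) c ∧ d i (Pi.single c 1) r ∈ 𝒜 (deg (i + 1) c - deg i r)) ∨
      d i (Pi.single c 1) r = 0
  aug_homogeneous : ∀ r : Fin (rank 0), aug (Pi.single r 1) ∈ ℳ (deg 0 r)
  aug_surjective : Function.Surjective aug
  exact_zero : Function.Exact (d 0) aug
  exact_succ : ∀ i : ℕ, Function.Exact (d (i + 1)) (d i)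

namespace GradedFreeResolution

variable {𝒜 : ℕ → Submodule k A} {M : Type w} [AddCommGroup M] [Module k M] [Module A M]
  {ℳ : ℕ → Submodule k M}

/-- A resolution is minimal if `d(Fᵢ₊₁) ⊆ A₊ Fᵢ`, i.e. all matrix entries lie in `A₊`. -/
def IsMinimal [GradedAlgebra 𝒜] (F : GradedFreeResolution 𝒜 ℳ) : Prop :=
  ∀ (i : ℕ) (c : Fin (F.rank (i + 1))) (r : Fin (F.rank i)),
    F.d i (Pi.single c 1) r ∈ HomogeneousIdeal.irrelevant 𝒜

/-- A resolution is linear if `Fᵢ` is generated in degree `i` for all `i`. -/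
def IsLinear (F : GradedFreeResolution 𝒜 ℳ) : Prop :=
  ∀ (i : ℕ) (r : Fin (F.rank i)), F.deg i r = i

/-- The generating series `∑ᵢ (∑ⱼ βᵢⱼ sʲ) zⁱ ∈ ℤ[s]⟦z⟧`, where `βᵢⱼ` is the number of basis elements
of degree `j` of `Fᵢ`. For a minimal resolution `βᵢⱼ = dimₖ Torᵢ(k, M)ⱼ`, and this is the
(bigraded) Poincaré series of `M`. -/
noncomputable def series (F : GradedFreeResolution 𝒜 ℳ) : PowerSeries ℤ[X] :=
  PowerSeries.mk fun i => ∑ r : Fin (F.rank i), Polynomial.X ^ F.deg i r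

end GradedFreeResolution

/-- The field `k` as a graded vector space concentrated in degree zero. -/
def fieldGrading (k : Type u) [Field k] : ℕ → Submodule k k := fun n => if n = 0 then ⊤ else ⊥

/-- Graded free resolutions over `A` of `k`, regarded as an `A`-module via the augmentation. -/
abbrev ResidueFieldResolution (𝒜 : ℕ → Submodule k A) [GradedAlgebra 𝒜] [IsStandardGraded 𝒜] :=
  letI : Module A k := Module.compHom k (augmentation 𝒜).toRingHom
  GradedFreeResolution 𝒜 (fieldGrading k)

/-- A standard graded `k`-algebra `A` is Koszul if the `A`-module `k` has a linear free
resolution. -/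
def IsKoszul (𝒜 : ℕ → Submodule k A) [GradedAlgebra 𝒜] [IsStandardGraded 𝒜] : Prop :=
  ∃ F : ResidueFieldResolution 𝒜,
    letI : Module A k := Module.compHom k (augmentation 𝒜).toRingHom
    F.IsLinear

end Resolutions

/-! ### Golod morphisms, complete intersections, the Backelin-Roos property -/

section Golod

variable {k : Type u} [Field k]
  {Q : Type v} [CommRing Q] [Algebra k Q] {R : Type w} [CommRing R] [Algebra k R]

/-- Graded free resolutions over `Q` of `R`, regarded as a `Q`-module via `φ : Q → R`. -/
abbrev AlgebraResolution (𝒬 : ℕ → Submodule k Q) (ℛ : ℕ → Submodule k R) (φ : Q →ₐ[k] R) :=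
  letI : Module Q R := Module.compHom R φ.toRingHom
  GradedFreeResolution 𝒬 ℛ

/-- The equality `P^R_k(s,z) = P^Q_k(s,z) / (1 - z (P^Q_R(s,z) - 1))` of Poincaré series.
Minimal graded free resolutions exist and are unique up to isomorphism, so the series do not
depend on the chosen resolutions; the denominator is invertible, having constant term `1`. -/
def GolodEquality (𝒬 : ℕ → Submodule k Q) [GradedAlgebra 𝒬] [IsStandardGraded 𝒬]
    (ℛ : ℕ → Submodule k R) [GradedAlgebra ℛ] [IsStandardGraded ℛ] (φ : Q →ₐ[k] R) : Prop :=
  letI : Module R k := Module.compHom k (augmentation ℛ).toRingHom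
  letI : Module Q k := Module.compHom k (augmentation 𝒬).toRingHom
  letI : Module Q R := Module.compHom R φ.toRingHom
  ∃ (F : ResidueFieldResolution ℛ) (G : ResidueFieldResolution 𝒬) (H : AlgebraResolution 𝒬 ℛ φ),
    F.IsMinimal ∧ G.IsMinimal ∧ H.IsMinimal ∧
      F.series * (1 - PowerSeries.X * (H.series - 1)) = G.series

/-- A surjective morphism `φ : Q → R` of standard graded `k`-algebras with `Ker φ ⊆ (Q₊)²` is Golod
if equality holds in Serre's coefficientwise bound for the Poincaré series `P^R_k(s,z)`. -/
structure IsGolod (𝒬 : ℕ → Submodule k Q) [GradedAlgebra 𝒬] [IsStandardGraded 𝒬]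
    (ℛ : ℕ → Submodule k R) [GradedAlgebra ℛ] [IsStandardGraded ℛ] (φ : Q →ₐ[k] R) : Prop where
  graded : ∀ (n : ℕ) (q : Q), q ∈ 𝒬 n → φ q ∈ ℛ n
  surjective : Function.Surjective φ
  ker_le : RingHom.ker φ ≤ (HomogeneousIdeal.irrelevant 𝒬).toIdeal ^ 2
  golod_equality : GolodEquality 𝒬 ℛ φ

/-- A standard graded `k`-algebra `Q` is a complete intersection if it is isomorphic, as a graded
algebra, to `k[x₁, …, xₙ]/(f₁, …, f_c)` where `f₁, …, f_c` is a regular sequence of homogeneous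
polynomials. -/
def IsCompleteIntersection (𝒬 : ℕ → Submodule k Q) : Prop :=
  ∃ (n : ℕ) (f : List (MvPolynomial (Fin n) k)) (π : MvPolynomial (Fin n) k →ₐ[k] Q),
    (∀ p ∈ f, ∃ d : ℕ, p.IsHomogeneous d) ∧
    RingTheory.Sequence.IsRegular (MvPolynomial (Fin n) k) f ∧
    (∀ i, π (MvPolynomial.X i) ∈ 𝒬 1) ∧
    Function.Surjective π ∧
    RingHom.ker π = Ideal.ofList f

/-- A standard graded `k`-algebra `R` has the Backelin-Roos property if there is a surjective Golod
morphism `Q → R` from a standard graded complete intersection `Q`. -/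
def HasBackelinRoos (ℛ : ℕ → Submodule k R) [GradedAlgebra ℛ] [IsStandardGraded ℛ] : Prop :=
  ∃ (Q : Type w) (_ : CommRing Q) (_ : Algebra k Q) (𝒬 : ℕ → Submodule k Q)
    (_ : GradedAlgebra 𝒬) (_ : IsStandardGraded 𝒬) (φ : Q →ₐ[k] R),
    IsCompleteIntersection 𝒬 ∧ IsGolod 𝒬 ℛ φ

end Golod

/-! ### A criterion for internal direct sums -/

theorem isInternal_of_projections {k M N : Type*} [Field k] [AddCommGroup M] [Module k M]
    [AddCommGroup N] [Module k N] (ℳ : ℕ → Submodule k M) (f : M →ₗ[k] N)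
    (hf : Function.Injective f) (p : ℕ → M →ₗ[k] N)
    (hp : ∀ n, ∀ x ∈ ℳ n, p n x = f x) (hp' : ∀ m n, m ≠ n → ∀ x ∈ ℳ n, p m x = 0)
    (htop : ∀ x, x ∈ ⨆ n, ℳ n) : DirectSum.IsInternal ℳ := by
  have key : ∀ (n : ℕ) (x : ⨁ i, ℳ i), p n (DirectSum.coeLinearMap ℳ x) = f (x n) := by
    intro n x
    induction x using DirectSum.induction_on with
    | zero => simp
    | of i y =>
      rw [← DirectSum.lof_eq_of k, DirectSum.coeLinearMap_lof, DirectSum.lof_eq_of]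
      by_cases h : n = i
      · subst h; rw [DirectSum.of_eq_same, hp _ _ y.2]
      · rw [DirectSum.of_eq_of_ne _ _ _ h, hp' _ _ h _ y.2]; simp
    | add a b ha hb => simp [ha, hb]
  refine ⟨fun x y hxy => ?_, fun x => ?_⟩
  · have hxy' : DirectSum.coeLinearMap ℳ x = DirectSum.coeLinearMap ℳ y := hxy
    refine DFinsupp.ext fun n => Subtype.ext (hf ?_)
    exact (key n x).symm.trans ((congrArg (p n) hxy').trans (key n y))
  · have := htop x
    rw [Submodule.iSup_eq_range_dfinsupp_lsum] at this
    exact this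

/-! ### Tensor products -/

section Tensor

variable {k : Type u} [Field k] {A : Type v} [CommRing A] [Algebra k A]
  {B : Type w} [CommRing B] [Algebra k B]

/-- The total grading on `A ⊗ₖ B`: degree `n` is `⨁_{i+j=n} Aᵢ ⊗ₖ Bⱼ`. -/
def tensorGrading (𝒜 : ℕ → Submodule k A) (ℬ : ℕ → Submodule k B) :
    ℕ → Submodule k (A ⊗[k] B) :=
  fun n => ⨆ p ∈ Finset.HasAntidiagonal.antidiagonal n, Submodule.map₂ (TensorProduct.mk k A B) (𝒜 p.1) (ℬ p.2)

variable (𝒜 : ℕ → Submodule k A) (ℬ : ℕ → Submodule k B)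

theorem tmul_mem_tensorGrading {i j : ℕ} {a : A} {b : B} (ha : a ∈ 𝒜 i) (hb : b ∈ ℬ j) :
    a ⊗ₜ[k] b ∈ tensorGrading 𝒜 ℬ (i + j) :=
  Submodule.mem_iSup_of_mem (i, j) <| Submodule.mem_iSup_of_mem (by simp) <|
    Submodule.apply_mem_map₂ _ ha hb

theorem tensorGrading_le {n : ℕ} {P : Submodule k (A ⊗[k] B)}
    (h : ∀ i j, i + j = n → ∀ a ∈ 𝒜 i, ∀ b ∈ ℬ j, a ⊗ₜ[k] b ∈ P) :
    tensorGrading 𝒜 ℬ n ≤ P := by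
  refine iSup₂_le fun p hp => Submodule.map₂_le.mpr fun a ha b hb => ?_
  exact h p.1 p.2 (by simpa using hp) a ha b hb

variable [GradedAlgebra 𝒜] [GradedAlgebra ℬ]

theorem mem_iSup_tensorGrading (x : A ⊗[k] B) : x ∈ ⨆ n, tensorGrading 𝒜 ℬ n := by
  classical
  induction x using TensorProduct.induction_on with
  | zero => exact Submodule.zero_mem _
  | add x y hx hy => exact Submodule.add_mem _ hx hy
  | tmul a b =>
    rw [← DirectSum.sum_support_decompose 𝒜 a, ← DirectSum.sum_support_decompose ℬ b,
      TensorProduct.sum_tmul]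
    refine Submodule.sum_mem _ fun i _ => ?_
    rw [TensorProduct.tmul_sum]
    refine Submodule.sum_mem _ fun j _ => ?_
    exact Submodule.mem_iSup_of_mem (i + j) (tmul_mem_tensorGrading 𝒜 ℬ (SetLike.coe_mem _)
      (SetLike.coe_mem _))

theorem isInternal_tensorGrading : DirectSum.IsInternal (tensorGrading 𝒜 ℬ) := by
  classical
  let q : ℕ → (A ⊗[k] B) →ₗ[k] (A ⊗[k] B) := fun n => ∑ p ∈ Finset.HasAntidiagonal.antidiagonal n,
    TensorProduct.map (GradedAlgebra.proj 𝒜 p.1) (GradedAlgebra.proj ℬ p.2)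
  have hq : ∀ n i j, ∀ a ∈ 𝒜 i, ∀ b ∈ ℬ j,
      q n (a ⊗ₜ b) = if i + j = n then a ⊗ₜ[k] b else 0 := by
    intro n i j a ha b hb
    have h1 : ∀ p : ℕ × ℕ, TensorProduct.map (GradedAlgebra.proj 𝒜 p.1) (GradedAlgebra.proj ℬ p.2)
        (a ⊗ₜ b) = if p = (i, j) then a ⊗ₜ[k] b else 0 := by
      rintro ⟨p1, p2⟩
      rw [TensorProduct.map_tmul, GradedAlgebra.proj_apply, GradedAlgebra.proj_apply]
      by_cases h1 : i = p1
      · by_cases h2 : j = p2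
        · subst h1 h2
          rw [DirectSum.decompose_of_mem_same _ ha, DirectSum.decompose_of_mem_same _ hb]; simp
        · rw [DirectSum.decompose_of_mem_ne _ hb h2, TensorProduct.tmul_zero, if_neg]
          rintro h; exact h2 (Prod.ext_iff.mp h).2.symm
      · rw [DirectSum.decompose_of_mem_ne _ ha h1, TensorProduct.zero_tmul, if_neg]
        rintro h; exact h1 (Prod.ext_iff.mp h).1.symm
    simp only [q, LinearMap.sum_apply, h1, Finset.sum_ite_eq', Finset.HasAntidiagonal.mem_antidiagonal]
  refine isInternal_of_projections _ LinearMap.id Function.injective_id q ?_ ?_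
    (mem_iSup_tensorGrading 𝒜 ℬ)
  · intro n x hx
    have : tensorGrading 𝒜 ℬ n ≤ LinearMap.eqLocus (q n) LinearMap.id := by
      refine tensorGrading_le _ _ fun i j hij a ha b hb => ?_
      rw [LinearMap.mem_eqLocus, hq n i j a ha b hb, if_pos hij]; rfl
    exact this hx
  · intro m n hmn x hx
    have : tensorGrading 𝒜 ℬ n ≤ LinearMap.ker (q m) := by
      refine tensorGrading_le _ _ fun i j hij a ha b hb => ?_
      rw [LinearMap.mem_ker, hq m i j a ha b hb, if_neg]
      omega
    exact this hx

instance tensorGradedMonoid : SetLike.GradedMonoid (tensorGrading 𝒜 ℬ) where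
  one_mem := tmul_mem_tensorGrading 𝒜 ℬ (i := 0) (j := 0) SetLike.GradedOne.one_mem
    SetLike.GradedOne.one_mem
  mul_mem := by
    intro m n x y hx hy
    have h1 : ∀ i j, i + j = m → ∀ a ∈ 𝒜 i, ∀ b ∈ ℬ j,
        (a ⊗ₜ[k] b) * y ∈ tensorGrading 𝒜 ℬ (m + n) := by
      intro i j hij a ha b hb
      have : tensorGrading 𝒜 ℬ n ≤
          (tensorGrading 𝒜 ℬ (m + n)).comap (LinearMap.mulLeft k (a ⊗ₜ[k] b)) := by
        refine tensorGrading_le _ _ fun i' j' hij' a' ha' b' hb' => ?_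
        rw [Submodule.mem_comap, LinearMap.mulLeft_apply, Algebra.TensorProduct.tmul_mul_tmul]
        have h := tmul_mem_tensorGrading 𝒜 ℬ (SetLike.GradedMul.mul_mem ha ha')
          (SetLike.GradedMul.mul_mem hb hb')
        have e : i + i' + (j + j') = m + n := by omega
        rwa [e] at h
      exact this hy
    have : tensorGrading 𝒜 ℬ m ≤
        (tensorGrading 𝒜 ℬ (m + n)).comap (LinearMap.mulRight k y) :=
      tensorGrading_le _ _ h1
    exact this hx

noncomputable instance tensorGradedAlgebra : GradedAlgebra (tensorGrading 𝒜 ℬ) :=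
  { tensorGradedMonoid 𝒜 ℬ, (isInternal_tensorGrading 𝒜 ℬ).chooseDecomposition with }

instance tensorIsStandardGraded [IsStandardGraded 𝒜] [IsStandardGraded ℬ] :
    IsStandardGraded (tensorGrading 𝒜 ℬ) where
  nontrivial := (Algebra.TensorProduct.lift (augmentation 𝒜) (augmentation ℬ)
    fun _ _ => Commute.all _ _).toRingHom.domain_nontrivial
  zero_eq := by
    refine le_antisymm (tensorGrading_le _ _ fun i j hij a ha b hb => ?_) ?_
    · obtain ⟨rfl, rfl⟩ : i = 0 ∧ j = 0 := by omega
      rw [IsStandardGraded.zero_eq (𝒜 := 𝒜)] at ha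
      rw [IsStandardGraded.zero_eq (𝒜 := ℬ)] at hb
      obtain ⟨c, rfl⟩ := Submodule.mem_one.mp ha
      obtain ⟨c', rfl⟩ := Submodule.mem_one.mp hb
      refine Submodule.mem_one.mpr ⟨c * c', ?_⟩
      rw [Algebra.algebraMap_eq_smul_one, Algebra.algebraMap_eq_smul_one,
        Algebra.algebraMap_eq_smul_one, TensorProduct.smul_tmul_smul]; rfl
    · rw [Submodule.one_le]
      exact SetLike.GradedOne.one_mem
  finite_one := by
    have h0 : Module.Finite k (𝒜 0) := by
      rw [IsStandardGraded.zero_eq (𝒜 := 𝒜), Submodule.one_eq_span]; infer_instance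
    have h0' : Module.Finite k (ℬ 0) := by
      rw [IsStandardGraded.zero_eq (𝒜 := ℬ), Submodule.one_eq_span]; infer_instance
    have h1 := IsStandardGraded.finite_one (𝒜 := 𝒜)
    have h1' := IsStandardGraded.finite_one (𝒜 := ℬ)
    rw [Module.Finite.iff_fg] at *
    unfold tensorGrading
    refine Submodule.fg_biSup _ _ fun p hp => ?_
    have hp' : p = (0, 1) ∨ p = (1, 0) := by
      rw [Finset.HasAntidiagonal.mem_antidiagonal] at hp
      rcases p with ⟨a, b⟩
      simp only [Prod.mk.injEq] at *
      omega
    rcases hp' with rfl | rfl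
    · exact h0.map₂ _ h1'
    · exact h1.map₂ _ h0'
  adjoin_one := by
    set C := Algebra.adjoin k (tensorGrading 𝒜 ℬ 1 : Set (A ⊗[k] B)) with hC
    have hA : ∀ a : A, a ⊗ₜ[k] (1 : B) ∈ C := by
      have : Algebra.adjoin k (𝒜 1 : Set A) ≤
          C.comap (Algebra.TensorProduct.includeLeft : A →ₐ[k] A ⊗[k] B) := by
        refine Algebra.adjoin_le fun a ha => Algebra.subset_adjoin ?_
        exact tmul_mem_tensorGrading 𝒜 ℬ (i := 1) (j := 0) ha SetLike.GradedOne.one_mem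
      rw [IsStandardGraded.adjoin_one] at this
      exact fun a => this (x := a) trivial
    have hB : ∀ b : B, (1 : A) ⊗ₜ[k] b ∈ C := by
      have : Algebra.adjoin k (ℬ 1 : Set B) ≤
          C.comap (Algebra.TensorProduct.includeRight : B →ₐ[k] A ⊗[k] B) := by
        refine Algebra.adjoin_le fun b hb => Algebra.subset_adjoin ?_
        exact tmul_mem_tensorGrading 𝒜 ℬ (i := 0) (j := 1) SetLike.GradedOne.one_mem hb
      rw [IsStandardGraded.adjoin_one] at this
      exact fun b => this (x := b) trivial
    rw [eq_top_iff]
    rintro x -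
    induction x using TensorProduct.induction_on with
    | zero => exact C.zero_mem
    | add x y hx hy => exact C.add_mem hx hy
    | tmul a b =>
      have := C.mul_mem (hA a) (hB b)
      rwa [Algebra.TensorProduct.tmul_mul_tmul, mul_one, one_mul] at this

end Tensor

/-! ### Fibre products -/

section FibreProduct

variable {k : Type u} [Field k] {S : Type v} [CommRing S] [Algebra k S]
  {T : Type w} [CommRing T] [Algebra k T]
  (𝒮 : ℕ → Submodule k S) [GradedAlgebra 𝒮] [IsStandardGraded 𝒮]
  (𝒯 : ℕ → Submodule k T) [GradedAlgebra 𝒯] [IsStandardGraded 𝒯]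

/-- The fibre product `S ×ₖ T = {(s, t) ∈ S × T ∣ ε_S(s) = ε_T(t)}`. -/
noncomputable def fibreProduct : Subalgebra k (S × T) :=
  AlgHom.equalizer ((augmentation 𝒮).comp (AlgHom.fst k S T))
    ((augmentation 𝒯).comp (AlgHom.snd k S T))

theorem mem_fibreProduct (x : S × T) :
    x ∈ fibreProduct 𝒮 𝒯 ↔ augmentation 𝒮 x.1 = augmentation 𝒯 x.2 := Iff.rfl

/-- The grading of the fibre product: `(s, t)` has degree `n` if `s` and `t` have degree `n`. -/
noncomputable def fibreGrading : ℕ → Submodule k (fibreProduct 𝒮 𝒯) :=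
  fun n => ((𝒮 n).prod (𝒯 n)).comap (fibreProduct 𝒮 𝒯).val.toLinearMap

theorem mem_fibreGrading {n : ℕ} {x : fibreProduct 𝒮 𝒯} :
    x ∈ fibreGrading 𝒮 𝒯 n ↔ x.1.1 ∈ 𝒮 n ∧ x.1.2 ∈ 𝒯 n := Iff.rfl

/-- The canonical morphism `S ⊗ₖ T → S ×ₖ T`, `s ⊗ t ↦ (s ε_T(t), ε_S(s) t)`. -/
noncomputable def tensorToFibre : S ⊗[k] T →ₐ[k] fibreProduct 𝒮 𝒯 :=
  (AlgHom.prod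
    (Algebra.TensorProduct.lift (AlgHom.id k S) ((Algebra.ofId k S).comp (augmentation 𝒯))
      fun _ _ => Commute.all _ _)
    (Algebra.TensorProduct.lift ((Algebra.ofId k T).comp (augmentation 𝒮)) (AlgHom.id k T)
      fun _ _ => Commute.all _ _)).codRestrict (fibreProduct 𝒮 𝒯) (by
    intro x
    rw [mem_fibreProduct]
    induction x using TensorProduct.induction_on with
    | zero => simp
    | add x y hx hy => simp_all
    | tmul s t => simp [Algebra.ofId_apply])

theorem tensorToFibre_tmul (s : S) (t : T) :
    (tensorToFibre 𝒮 𝒯 (s ⊗ₜ t) : S × T) =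
      (s * algebraMap k S (augmentation 𝒯 t), algebraMap k T (augmentation 𝒮 s) * t) := rfl

theorem tensorToFibre_surjective : Function.Surjective (tensorToFibre 𝒮 𝒯) := by
  rintro ⟨⟨s, t⟩, hx⟩
  have hx' : augmentation 𝒮 s = augmentation 𝒯 t := hx
  refine ⟨s ⊗ₜ 1 + 1 ⊗ₜ t - algebraMap k _ (augmentation 𝒮 s), ?_⟩
  apply Subtype.ext
  rw [map_sub, map_add, AlgHom.commutes]
  simp only [AddSubgroupClass.coe_sub, Subalgebra.coe_add, tensorToFibre_tmul,
    Subalgebra.coe_algebraMap]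
  ext
  · simp [hx']
  · simp

theorem tensorToFibre_graded (n : ℕ) (x : S ⊗[k] T) (hx : x ∈ tensorGrading 𝒮 𝒯 n) :
    tensorToFibre 𝒮 𝒯 x ∈ fibreGrading 𝒮 𝒯 n := by
  have : tensorGrading 𝒮 𝒯 n ≤
      (fibreGrading 𝒮 𝒯 n).comap (tensorToFibre 𝒮 𝒯).toLinearMap := by
    refine tensorGrading_le _ _ fun i j hij s hs t ht => ?_
    rw [Submodule.mem_comap, mem_fibreGrading, AlgHom.toLinearMap_apply, tensorToFibre_tmul]
    constructor
    · by_cases hj : j = 0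
      · subst hj hij
        rw [mul_comm, ← Algebra.smul_def]; exact Submodule.smul_mem _ _ hs
      · rw [augmentation_of_mem 𝒯 hj ht]; simp
    · by_cases hi : i = 0
      · subst hi hij
        rw [← Algebra.smul_def, zero_add]; exact Submodule.smul_mem _ _ ht
      · rw [augmentation_of_mem 𝒮 hi hs]; simp
  exact this hx

theorem isInternal_fibreGrading : DirectSum.IsInternal (fibreGrading 𝒮 𝒯) := by
  let q : ℕ → fibreProduct 𝒮 𝒯 →ₗ[k] S × T := fun n =>
    (LinearMap.prodMap (GradedAlgebra.proj 𝒮 n) (GradedAlgebra.proj 𝒯 n)).comp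
      (fibreProduct 𝒮 𝒯).val.toLinearMap
  refine isInternal_of_projections _ (fibreProduct 𝒮 𝒯).val.toLinearMap
    Subtype.val_injective q ?_ ?_ ?_
  · rintro n x ⟨h1, h2⟩
    exact Prod.ext (DirectSum.decompose_of_mem_same 𝒮 h1) (DirectSum.decompose_of_mem_same 𝒯 h2)
  · rintro m n hmn x ⟨h1, h2⟩
    exact Prod.ext (DirectSum.decompose_of_mem_ne 𝒮 h1 hmn.symm)
      (DirectSum.decompose_of_mem_ne 𝒯 h2 hmn.symm)
  · intro x
    obtain ⟨y, rfl⟩ := tensorToFibre_surjective 𝒮 𝒯 x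
    have : (⨆ n, tensorGrading 𝒮 𝒯 n) ≤
        (⨆ n, fibreGrading 𝒮 𝒯 n).comap (tensorToFibre 𝒮 𝒯).toLinearMap :=
      iSup_le fun n z hz => Submodule.mem_iSup_of_mem n (tensorToFibre_graded 𝒮 𝒯 n z hz)
    exact this (mem_iSup_tensorGrading 𝒮 𝒯 y)

instance fibreGradedMonoid : SetLike.GradedMonoid (fibreGrading 𝒮 𝒯) where
  one_mem := ⟨SetLike.GradedOne.one_mem, SetLike.GradedOne.one_mem⟩
  mul_mem := fun _ _ _ _ hx hy =>
    ⟨SetLike.GradedMul.mul_mem hx.1 hy.1, SetLike.GradedMul.mul_mem hx.2 hy.2⟩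

noncomputable instance fibreGradedAlgebra : GradedAlgebra (fibreGrading 𝒮 𝒯) :=
  { fibreGradedMonoid 𝒮 𝒯, (isInternal_fibreGrading 𝒮 𝒯).chooseDecomposition with }

instance fibreIsStandardGraded : IsStandardGraded (fibreGrading 𝒮 𝒯) where
  nontrivial := ((augmentation 𝒮).comp ((AlgHom.fst k S T).comp
    (fibreProduct 𝒮 𝒯).val)).toRingHom.domain_nontrivial
  zero_eq := by
    refine le_antisymm (fun x hx => ?_) (Submodule.one_le.mpr SetLike.GradedOne.one_mem)
    obtain ⟨h1, h2⟩ := (mem_fibreGrading 𝒮 𝒯).mp hx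
    have h3 : augmentation 𝒮 x.1.1 = augmentation 𝒯 x.1.2 := x.2
    rw [IsStandardGraded.zero_eq (𝒜 := 𝒮)] at h1
    rw [IsStandardGraded.zero_eq (𝒜 := 𝒯)] at h2
    obtain ⟨c, hc⟩ := Submodule.mem_one.mp h1
    obtain ⟨c', hc'⟩ := Submodule.mem_one.mp h2
    rw [← hc, ← hc', AlgHom.commutes, AlgHom.commutes] at h3
    refine Submodule.mem_one.mpr ⟨c, Subtype.ext (Prod.ext hc ?_)⟩
    have h4 : c = c' := h3
    subst h4
    exact hc'
  finite_one := by
    have := IsStandardGraded.finite_one (𝒜 := 𝒮)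
    have := IsStandardGraded.finite_one (𝒜 := 𝒯)
    let f : fibreGrading 𝒮 𝒯 1 →ₗ[k] 𝒮 1 × 𝒯 1 :=
      { toFun := fun x => (⟨x.1.1.1, x.2.1⟩, ⟨x.1.1.2, x.2.2⟩)
        map_add' := fun _ _ => rfl
        map_smul' := fun _ _ => rfl }
    refine Module.Finite.of_injective f fun x y h => ?_
    have h' := Prod.ext_iff.mp h
    exact Subtype.ext (Subtype.ext (Prod.ext (congrArg Subtype.val h'.1)
      (congrArg Subtype.val h'.2)))
  adjoin_one := by
    have h : (Algebra.adjoin k (tensorGrading 𝒮 𝒯 1 : Set (S ⊗[k] T))).map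
        (tensorToFibre 𝒮 𝒯) ≤ Algebra.adjoin k (fibreGrading 𝒮 𝒯 1 : Set _) := by
      rw [AlgHom.map_adjoin]
      refine Algebra.adjoin_mono ?_
      rintro _ ⟨x, hx, rfl⟩
      exact tensorToFibre_graded 𝒮 𝒯 1 x hx
    rw [IsStandardGraded.adjoin_one] at h
    rw [eq_top_iff]
    rintro x -
    obtain ⟨y, rfl⟩ := tensorToFibre_surjective 𝒮 𝒯 x
    exact h ⟨y, trivial, rfl⟩

end FibreProduct

end BackelinRoos

/-! The proof works with modules that are generated in a single degree and have a linear resolution.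
For these the bigraded Poincaré series is the one-variable series of ranks after the substitution `z
↦ sz` (`diagonal`), so all Betti number questions become identities in `ℤ⟦X⟧`. The predicate `IsLin`
records linearity up to step `n` together with the series. It passes to extensions
(`GradedExact.isLin_middle`, the horseshoe lemma), to quotients by a submodule generated one degree
higher (`GradedExact.isLin_right`, a mapping cone), along changes of rings (`IsLin.restrictScalars`,
where series multiply), and to tensor products over `k` (`IsLin.tensor`).

For a Koszul target `R`, a Golod morphism `Q → R` has a rigid shape. All series in the Golod
equality are nonnegative and the series of `k` over `R` is supported on the diagonal, so `Q` is
Koszul, the kernel is generated in degree two with a linear resolution of some series `h`, and `P (1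
- X²h) = G`, where `P` and `G` are the series of `k` over `R` and `Q` (`IsGolod.exists_series`).
Conversely these data give the Golod equality (`golodEquality_of_isLin`).

Over the fibre product, `S` is the quotient by `T₊` and `T` is the quotient by `S₊`. A simultaneous
induction resolves `S₊` and `T₊`, proves that the fibre product is Koszul, and gives the
Dress–Krämer formula `1/E = 1/P + 1/P' - 1` for its series `E` (`IsLinResidue.fibre`).

For Golod morphisms `A → S` and `B → T` with kernels `I` and `J`, the kernel `L` of `A ⊗ B → S ×ₖ T`
sits in an exact sequence `0 → A₊ ⊗ B₊ → L → I × J → 0`. Over `A ⊗ B` its outer terms have known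
linear resolutions, so `L` has one as well (`isLin_fibreIdeal`), and the required Golod identity
follows algebraically from the Dress–Krämer formula and the two given identities (`IsGolod.fibre`).
Finally, `A ⊗ B` is a complete intersection because, by flatness over a field, the two defining
regular sequences concatenate (`IsCompleteIntersection.tensor`). -/

namespace BackelinRoos

/-! ### Modules with a linear resolution -/

section Linear

universe w₁ w₂ w₃

open PowerSeries

variable {k : Type u} [Field k] {A : Type v} [CommRing A] [Algebra k A] (𝒜 : ℕ → Submodule k A)

/-- The grading of the free module `Aʳ` with all basis elements in degree zero. -/
def freeGrading (r : ℕ) : ℕ → Submodule k (Fin r → A) :=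
  fun j => Submodule.pi Set.univ fun _ => 𝒜 j

variable {𝒜} in
theorem mem_freeGrading {r j : ℕ} {v : Fin r → A} :
    v ∈ freeGrading 𝒜 r j ↔ ∀ i, v i ∈ 𝒜 j := by
  simp [freeGrading]

/-- The grading of a submodule of `Aʳ`, shifted so that degree one becomes degree zero. -/
def syzygyGrading {r : ℕ} (K : Submodule A (Fin r → A)) : ℕ → Submodule k K :=
  fun j => (freeGrading 𝒜 r (j + 1)).comap (K.subtype.restrictScalars k)

variable {𝒜} in
theorem mem_syzygyGrading {r j : ℕ} {K : Submodule A (Fin r → A)} {v : K} :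
    v ∈ syzygyGrading 𝒜 K j ↔ ∀ i, v.1 i ∈ 𝒜 (j + 1) :=
  mem_freeGrading

section Cover

variable {M : Type w} [AddCommGroup M] [Module k M] [Module A M] (ℳ : ℕ → Submodule k M)

/-- A homogeneous map `Aʳ → M` that is surjective in each degree and injective in degree zero. -/
structure IsCover {r : ℕ} (p : (Fin r → A) →ₗ[A] M) : Prop where
  map_mem : ∀ j, ∀ v ∈ freeGrading 𝒜 r j, p v ∈ ℳ j
  exists_lift : ∀ j, ∀ m ∈ ℳ j, ∃ v ∈ freeGrading 𝒜 r j, p v = m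
  eq_zero : ∀ v ∈ freeGrading 𝒜 r 0, p v = 0 → v = 0

/-- The recursion behind `IsLin`, for submodules of free modules. -/
def IsLinSyzygy : ℕ → ℤ⟦X⟧ → (r : ℕ) → Submodule A (Fin r → A) → Prop
  | 0, _, _, _ => True
  | n + 1, b, _, K => ∃ (s : ℕ) (c : ℤ⟦X⟧) (p : (Fin s → A) →ₗ[A] K),
      b = (s : ℤ⟦X⟧) + X * c ∧ IsCover 𝒜 (syzygyGrading 𝒜 K) p ∧
        IsLinSyzygy n c s (LinearMap.ker p)

/-- The graded module `M` is generated in degree zero and has a graded free resolution which is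
linear in its first `n` steps and whose ranks are the first `n` coefficients of `b`. -/
def IsLin : ℕ → ℤ⟦X⟧ → Prop
  | 0, _ => True
  | n + 1, b => ∃ (s : ℕ) (c : ℤ⟦X⟧) (p : (Fin s → A) →ₗ[A] M),
      b = (s : ℤ⟦X⟧) + X * c ∧ IsCover 𝒜 ℳ p ∧ IsLinSyzygy 𝒜 n c s (LinearMap.ker p)

end Cover

/-- The recursion runs on submodules of `Aʳ`, which stay in the universe of `A`; a module from any
other universe occurs only at the top level. Since step zero imposes nothing, `IsLin` at step `n`
constrains only the first `n` coefficients of `b`. -/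
theorem isLinSyzygy_iff {n : ℕ} {b : ℤ⟦X⟧} {r : ℕ} {K : Submodule A (Fin r → A)} :
    IsLinSyzygy 𝒜 n b r K ↔ IsLin 𝒜 (syzygyGrading 𝒜 K) n b := by
  cases n <;> rfl

variable {𝒜}

section Basic

variable {M : Type w} [AddCommGroup M] [Module k M] [Module A M] {ℳ : ℕ → Submodule k M}

theorem isLin_succ_iff {n : ℕ} {b : ℤ⟦X⟧} :
    IsLin 𝒜 ℳ (n + 1) b ↔ ∃ (s : ℕ) (c : ℤ⟦X⟧) (p : (Fin s → A) →ₗ[A] M),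
      b = (s : ℤ⟦X⟧) + X * c ∧ IsCover 𝒜 ℳ p ∧
        IsLin 𝒜 (syzygyGrading 𝒜 (LinearMap.ker p)) n c := by
  simp only [← isLinSyzygy_iff]; rfl

theorem IsLin.of_succ {n : ℕ} {b : ℤ⟦X⟧} (h : IsLin 𝒜 ℳ (n + 1) b) : IsLin 𝒜 ℳ n b := by
  have key : ∀ (n : ℕ) (b : ℤ⟦X⟧) (r : ℕ) (K : Submodule A (Fin r → A)),
      IsLinSyzygy 𝒜 (n + 1) b r K → IsLinSyzygy 𝒜 n b r K := by
    intro n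
    induction n with
    | zero => intros; trivial
    | succ n ih =>
      rintro b r K ⟨s, c, p, hb, hp, h⟩
      exact ⟨s, c, p, hb, hp, ih _ _ _ h⟩
  cases n with
  | zero => trivial
  | succ n =>
    obtain ⟨s, c, p, hb, hp, h⟩ := h
    exact ⟨s, c, p, hb, hp, key _ _ _ _ h⟩

/-- Homogeneous elements of degrees `i` and `j` multiply to an element of degree `i + j`. -/
def SMulMem (𝒜 : ℕ → Submodule k A) (ℳ : ℕ → Submodule k M) : Prop :=
  ∀ i j, ∀ a ∈ 𝒜 i, ∀ m ∈ ℳ j, a • m ∈ ℳ (i + j)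

theorem SMulMem.linearCombination_mem (h : SMulMem 𝒜 ℳ) {s j : ℕ} {m : Fin s → M}
    (hm : ∀ i, m i ∈ ℳ 0) {v : Fin s → A} (hv : v ∈ freeGrading 𝒜 s j) :
    Fintype.linearCombination A m v ∈ ℳ j := by
  rw [Fintype.linearCombination_apply]
  exact Submodule.sum_mem _ fun i _ => h j 0 _ (mem_freeGrading.mp hv i) _ (hm i)

theorem SMulMem.map_mem (h : SMulMem 𝒜 ℳ) {s j : ℕ} {p : (Fin s → A) →ₗ[A] M}
    (hp : ∀ i, p (Pi.single i 1) ∈ ℳ 0) {v : Fin s → A} (hv : v ∈ freeGrading 𝒜 s j) :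
    p v ∈ ℳ j := by
  have : p = Fintype.linearCombination A fun i => p (Pi.single i 1) := by
    refine LinearMap.pi_ext' fun i => LinearMap.ext_ring ?_
    simp [Fintype.linearCombination_apply_single]
  rw [this]
  exact h.linearCombination_mem hp hv

end Basic

theorem smulMem_syzygyGrading [SetLike.GradedMonoid 𝒜] {r : ℕ} (K : Submodule A (Fin r → A)) :
    SMulMem 𝒜 (syzygyGrading 𝒜 K) := by
  intro i j a ha m hm
  rw [mem_syzygyGrading] at *
  intro t
  rw [add_assoc]
  exact SetLike.GradedMul.mul_mem ha (hm t)

/-! ### Short exact sequences -/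

section Exact

/-- A short exact sequence `0 → M' → M → M'' → 0` of graded modules, where `M' → M` is homogeneous
of degree `s` and `M'` lives in degrees at least `s` when regarded as a submodule of `M`. -/
structure GradedExact {M' : Type w₁} [AddCommGroup M'] [Module k M'] [Module A M']
    {M : Type w₂} [AddCommGroup M] [Module k M] [Module A M]
    {M'' : Type w₃} [AddCommGroup M''] [Module k M''] [Module A M'']
    (s : ℕ) (ℳ' : ℕ → Submodule k M') (ℳ : ℕ → Submodule k M) (ℳ'' : ℕ → Submodule k M'')
    (f : M' →ₗ[A] M) (g : M →ₗ[A] M'') : Prop where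
  injective : Function.Injective f
  exact : Function.Exact f g
  mem_iff : ∀ j m, f m ∈ ℳ (j + s) ↔ m ∈ ℳ' j
  eq_zero : ∀ j < s, ∀ m ∈ ℳ j, g m = 0 → m = 0
  map_mem : ∀ j, ∀ m ∈ ℳ j, g m ∈ ℳ'' j
  exists_lift : ∀ j, ∀ m ∈ ℳ'' j, ∃ x ∈ ℳ j, g x = m

/-- Modules with linear resolutions up to step `n` are closed under extensions. -/
def ClosedUnderExtensions (𝒜 : ℕ → Submodule k A) (n : ℕ) : Prop :=
  ∀ ⦃M' : Type w₁⦄ [AddCommGroup M'] [Module k M'] [Module A M'] (ℳ' : ℕ → Submodule k M')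
    ⦃M : Type w₂⦄ [AddCommGroup M] [Module k M] [Module A M] (ℳ : ℕ → Submodule k M)
    ⦃M'' : Type w₃⦄ [AddCommGroup M''] [Module k M''] [Module A M''] (ℳ'' : ℕ → Submodule k M'')
    (f : M' →ₗ[A] M) (g : M →ₗ[A] M''), SMulMem 𝒜 ℳ → GradedExact 0 ℳ' ℳ ℳ'' f g →
    ∀ b' b'', IsLin 𝒜 ℳ' n b' → IsLin 𝒜 ℳ'' n b'' → IsLin 𝒜 ℳ n (b' + b'')

/-- One step of the horseshoe lemma. The generators of `M''` are lifted to degree zero of `M`;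
together with those of `M'` they give a cover of `M`, and the kernels of the three covers again form
a short exact sequence, to which the previous step applies. -/
theorem closedUnderExtensions_succ [SetLike.GradedMonoid 𝒜] {n : ℕ}
    (ih : ClosedUnderExtensions.{u, v, v, v, v} 𝒜 n) :
    ClosedUnderExtensions.{u, v, w₁, w₂, w₃} 𝒜 (n + 1) := by
  intro M' _ _ _ ℳ' M _ _ _ ℳ M'' _ _ _ ℳ'' f g hM h b' b'' h' h''
  obtain ⟨r, c', p', rfl, hp', h'⟩ := isLin_succ_iff.mp h'
  obtain ⟨s, c'', p'', rfl, hp'', h''⟩ := isLin_succ_iff.mp h''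
  have hsingle : ∀ i : Fin s, (Pi.single i 1 : Fin s → A) ∈ freeGrading 𝒜 s 0 := by
    intro i
    rw [mem_freeGrading]
    intro t
    by_cases hti : t = i
    · subst hti; rw [Pi.single_eq_same]; exact SetLike.GradedOne.one_mem
    · rw [Pi.single_eq_of_ne hti]; exact Submodule.zero_mem _
  choose m hm hgm using fun i => h.exists_lift 0 _ (hp''.map_mem 0 _ (hsingle i))
  let L : (Fin s → A) →ₗ[A] M := Fintype.linearCombination A m
  have hL : ∀ j, ∀ v ∈ freeGrading 𝒜 s j, L v ∈ ℳ j := fun j v hv =>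
    hM.linearCombination_mem hm hv
  have hgL : ∀ v, g (L v) = p'' v := by
    intro v
    have : g ∘ₗ L = p'' := by
      refine LinearMap.pi_ext' fun i => LinearMap.ext_ring ?_
      simp [L, Fintype.linearCombination_apply_single, hgm]
    exact LinearMap.congr_fun this v
  let lft : (Fin (r + s) → A) →ₗ[A] (Fin r → A) := LinearMap.funLeft A A (Fin.castAdd s)
  let rgt : (Fin (r + s) → A) →ₗ[A] (Fin s → A) := LinearMap.funLeft A A (Fin.natAdd r)
  let P : (Fin (r + s) → A) →ₗ[A] M := f ∘ₗ p' ∘ₗ lft + L ∘ₗ rgt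
  have hP : ∀ v, P v = f (p' (lft v)) + L (rgt v) := fun v => rfl
  have hlft : ∀ x y, lft (Fin.append x y) = x := fun x y => by
    ext i; simp [lft, LinearMap.funLeft_apply]
  have hrgt : ∀ x y, rgt (Fin.append x y) = y := fun x y => by
    ext i; simp [rgt, LinearMap.funLeft_apply]
  have hmem : ∀ j v, v ∈ freeGrading 𝒜 (r + s) j ↔
      lft v ∈ freeGrading 𝒜 r j ∧ rgt v ∈ freeGrading 𝒜 s j := by
    intro j v
    simp only [mem_freeGrading]
    exact ⟨fun H => ⟨fun i => H _, fun i => H _⟩, fun H => Fin.addCases H.1 H.2⟩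
  have hext : ∀ v, lft v = 0 → rgt v = 0 → v = 0 := fun v h1 h2 =>
    funext fun i => Fin.addCases (fun i => congrFun h1 i) (fun i => congrFun h2 i) i
  have hgP : ∀ v, g (P v) = p'' (rgt v) := fun v => by
    rw [hP, map_add, h.exact.apply_apply_eq_zero, zero_add, hgL]
  -- This one lifting statement gives both the surjectivity of `P` in each degree and, for `x = 0`,
  -- the surjectivity of `ker P → ker p''`.
  have hlift : ∀ j (w : Fin s → A), w ∈ freeGrading 𝒜 s j → ∀ x ∈ ℳ j, g x = p'' w →
      ∃ v ∈ freeGrading 𝒜 (r + s) j, rgt v = w ∧ P v = x := by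
    intro j w hw x hx hgx
    have h1 : g (x - L w) = 0 := by rw [map_sub, hgL, hgx, sub_self]
    obtain ⟨m', hm'⟩ := (h.exact _).mp h1
    have h2 : m' ∈ ℳ' j := (h.mem_iff j m').mp (hm' ▸ Submodule.sub_mem _ hx (hL j w hw))
    obtain ⟨v', hv', rfl⟩ := hp'.exists_lift j m' h2
    refine ⟨Fin.append v' w, (hmem _ _).mpr ⟨by rwa [hlft], by rwa [hrgt]⟩, hrgt _ _, ?_⟩
    rw [hP, hlft, hrgt, hm', sub_add_cancel]
  have hcover : IsCover 𝒜 ℳ P := by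
    refine ⟨fun j v hv => ?_, fun j x hx => ?_, fun v hv hPv => ?_⟩
    · obtain ⟨h1, h2⟩ := (hmem j v).mp hv
      exact Submodule.add_mem _ ((h.mem_iff j _).mpr (hp'.map_mem j _ h1)) (hL j _ h2)
    · obtain ⟨w, hw, hw'⟩ := hp''.exists_lift j _ (h.map_mem j x hx)
      obtain ⟨v, hv, -, hv'⟩ := hlift j w hw x hx hw'.symm
      exact ⟨v, hv, hv'⟩
    · obtain ⟨h1, h2⟩ := (hmem 0 v).mp hv
      have h3 : rgt v = 0 := hp''.eq_zero _ h2 (by rw [← hgP, hPv, map_zero])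
      refine hext v (hp'.eq_zero _ h1 (h.injective ?_)) h3
      rw [hP, h3, map_zero, add_zero] at hPv
      rw [hPv, map_zero]
  refine isLin_succ_iff.mpr ⟨r + s, c' + c'', P, by push_cast; ring, hcover, ?_⟩
  let F : LinearMap.ker p' →ₗ[A] LinearMap.ker P :=
    { toFun := fun v => ⟨Fin.append v.1 0, by
        rw [LinearMap.mem_ker, hP, hlft, hrgt, LinearMap.mem_ker.mp v.2, map_zero, map_zero,
          add_zero]⟩
      map_add' := fun x y => by
        refine Subtype.ext (funext fun i => ?_)
        refine Fin.addCases (fun i => ?_) (fun i => ?_) i <;> simp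
      map_smul' := fun a x => by
        refine Subtype.ext (funext fun i => ?_)
        refine Fin.addCases (fun i => ?_) (fun i => ?_) i <;> simp }
  let G : LinearMap.ker P →ₗ[A] LinearMap.ker p'' :=
    (rgt ∘ₗ (LinearMap.ker P).subtype).codRestrict _ fun v => by
      rw [LinearMap.mem_ker, LinearMap.comp_apply, ← hgP, Submodule.subtype_apply,
        LinearMap.mem_ker.mp v.2, map_zero]
  refine ih _ _ _ F G (smulMem_syzygyGrading _) ⟨fun x y hxy => ?_, fun v => ?_, fun j v => ?_,
    fun j hj => absurd hj (Nat.not_lt_zero j), fun j v hv => ?_, fun j v hv => ?_⟩ _ _ h' h''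
  · refine Subtype.ext ?_
    rw [← hlft x.1 0, ← hlft y.1 0]
    exact congrArg (fun z => lft z.1) hxy
  · constructor
    · intro hv
      have h1 : rgt v.1 = 0 := congrArg Subtype.val hv
      have h2 : P v.1 = 0 := v.2
      rw [hP, h1, map_zero, add_zero] at h2
      refine ⟨⟨lft v.1, h.injective (by rw [h2, map_zero])⟩, Subtype.ext ?_⟩
      rw [← sub_eq_zero]
      refine hext _ ?_ ?_
      · rw [map_sub, sub_eq_zero]; exact hlft _ _
      · rw [map_sub, h1, sub_zero]; exact hrgt _ _
    · rintro ⟨x, rfl⟩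
      exact Subtype.ext (hrgt _ _)
  · change Fin.append v.1 0 ∈ freeGrading 𝒜 (r + s) (j + 1) ↔ v.1 ∈ freeGrading 𝒜 r (j + 1)
    rw [hmem, hlft, hrgt]
    exact and_iff_left (Submodule.zero_mem _)
  · exact ((hmem _ _).mp hv).2
  · obtain ⟨x, hx, hx', hx''⟩ := hlift (j + 1) v.1 hv 0 (Submodule.zero_mem _)
      (by rw [map_zero]; exact v.2.symm)
    exact ⟨⟨x, hx''⟩, hx, Subtype.ext hx'⟩

/-- The induction is carried out for modules in the universe of `A`, where all syzygies live; one
further step then reaches arbitrary universes. -/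
theorem closedUnderExtensions [SetLike.GradedMonoid 𝒜] (n : ℕ) :
    ClosedUnderExtensions.{u, v, w₁, w₂, w₃} 𝒜 n := by
  have key : ∀ n, ClosedUnderExtensions.{u, v, v, v, v} 𝒜 n := by
    intro n
    induction n with
    | zero => intro; intros; trivial
    | succ n ih => exact closedUnderExtensions_succ ih
  cases n with
  | zero => intro; intros; trivial
  | succ n => exact closedUnderExtensions_succ (key n)

variable {M' : Type w₁} [AddCommGroup M'] [Module k M'] [Module A M']
  {M : Type w₂} [AddCommGroup M] [Module k M] [Module A M]
  {M'' : Type w₃} [AddCommGroup M''] [Module k M''] [Module A M'']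
  {ℳ' : ℕ → Submodule k M'} {ℳ : ℕ → Submodule k M} {ℳ'' : ℕ → Submodule k M''}

theorem GradedExact.isLin_middle [SetLike.GradedMonoid 𝒜] {f : M' →ₗ[A] M} {g : M →ₗ[A] M''}
    (h : GradedExact 0 ℳ' ℳ ℳ'' f g) (hM : SMulMem 𝒜 ℳ) {n : ℕ} {b' b'' : ℤ⟦X⟧}
    (h' : IsLin 𝒜 ℳ' n b') (h'' : IsLin 𝒜 ℳ'' n b'') : IsLin 𝒜 ℳ n (b' + b'') :=
  closedUnderExtensions n ℳ' ℳ ℳ'' f g hM h b' b'' h' h''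

/-- A mapping cone: a cover `p` of `M` composed with `g` covers `M''`, and the kernel of `g ∘ p` is
an extension of `M'` by `ker p`. Only `n` steps are needed for `M'` to gain `n + 1` steps for `M''`,
which is what drives the later inductions. -/
theorem GradedExact.isLin_right [SetLike.GradedMonoid 𝒜] {f : M' →ₗ[A] M} {g : M →ₗ[A] M''}
    (h : GradedExact 1 ℳ' ℳ ℳ'' f g) {n : ℕ} {b b' : ℤ⟦X⟧}
    (hM : IsLin 𝒜 ℳ (n + 1) b) (hM' : IsLin 𝒜 ℳ' n b') : IsLin 𝒜 ℳ'' (n + 1) (b + X * b') := by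
  obtain ⟨r, c, p, rfl, hp, hc⟩ := isLin_succ_iff.mp hM
  refine isLin_succ_iff.mpr ⟨r, c + b', g ∘ₗ p, by ring, ⟨fun j v hv => ?_, fun j m hm => ?_,
    fun v hv hv' => ?_⟩, ?_⟩
  · exact h.map_mem j _ (hp.map_mem j v hv)
  · obtain ⟨x, hx, rfl⟩ := h.exists_lift j m hm
    obtain ⟨v, hv, rfl⟩ := hp.exists_lift j x hx
    exact ⟨v, hv, rfl⟩
  -- The shift by one is used here: the image of `M'` has no part of degree zero, so `g` is
  -- injective there.
  · exact hp.eq_zero v hv (h.eq_zero 0 zero_lt_one _ (hp.map_mem 0 v hv) hv')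
  · let e := LinearEquiv.ofInjective f h.injective
    let q : LinearMap.ker (g ∘ₗ p) →ₗ[A] LinearMap.range f :=
      (p ∘ₗ (LinearMap.ker (g ∘ₗ p)).subtype).codRestrict _ fun v => (h.exact _).mp v.2
    let G : LinearMap.ker (g ∘ₗ p) →ₗ[A] M' := e.symm.toLinearMap ∘ₗ q
    have hfG : ∀ v, f (G v) = p v.1 := fun v => by
      have : e (e.symm (q v)) = q v := e.apply_symm_apply _
      exact congrArg Subtype.val this
    have hle : LinearMap.ker p ≤ LinearMap.ker (g ∘ₗ p) := LinearMap.ker_le_ker_comp p g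
    refine GradedExact.isLin_middle (f := Submodule.inclusion hle) (g := G)
      ⟨Submodule.inclusion_injective hle, fun v => ?_, fun j v => Iff.rfl,
      fun j hj => absurd hj (Nat.not_lt_zero j), fun j v hv => ?_, fun j x hx => ?_⟩
      (smulMem_syzygyGrading _) hc hM'
    · constructor
      · intro hv
        refine ⟨⟨v.1, ?_⟩, rfl⟩
        rw [LinearMap.mem_ker, ← hfG, hv, map_zero]
      · rintro ⟨x, rfl⟩
        apply h.injective
        rw [hfG, map_zero]
        exact x.2
    · rw [← h.mem_iff, hfG]
      exact hp.map_mem _ _ hv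
    · obtain ⟨v, hv, hv'⟩ := hp.exists_lift _ _ ((h.mem_iff j x).mpr hx)
      refine ⟨⟨v, ?_⟩, hv, h.injective ?_⟩
      · rw [LinearMap.mem_ker, LinearMap.comp_apply, hv', h.exact.apply_apply_eq_zero]
      · rw [hfG]
        exact hv'

theorem IsLin.of_equiv (e : M ≃ₗ[A] M'') (he : ∀ j m, e m ∈ ℳ'' j ↔ m ∈ ℳ j) {n : ℕ} {b : ℤ⟦X⟧}
    (h : IsLin 𝒜 ℳ n b) : IsLin 𝒜 ℳ'' n b := by
  cases n with
  | zero => trivial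
  | succ n =>
    obtain ⟨r, c, p, rfl, hp, hc⟩ := h
    refine ⟨r, c, e.toLinearMap ∘ₗ p, rfl, ⟨fun j v hv => (he j _).mpr (hp.map_mem j v hv),
      fun j m hm => ?_, fun v hv hv' => hp.eq_zero v hv (e.injective ?_)⟩, ?_⟩
    · obtain ⟨v, hv, hv'⟩ := hp.exists_lift j (e.symm m) ((he j _).mp (by simpa using hm))
      exact ⟨v, hv, by simp [hv']⟩
    · rw [map_zero]; exact hv'
    · rwa [LinearEquiv.ker_comp]

theorem isLin_of_subsingleton [Subsingleton M] (n : ℕ) : IsLin 𝒜 ℳ n 0 := by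
  have key : ∀ (n : ℕ) (K : Submodule A (Fin 0 → A)), IsLinSyzygy 𝒜 n 0 0 K := by
    intro n
    induction n with
    | zero => intros; trivial
    | succ n ih =>
      intro K
      refine ⟨0, 0, 0, by simp, ⟨fun j v hv => Submodule.zero_mem _, fun j m hm => ?_,
        fun v hv hv' => Subsingleton.elim _ _⟩, ih _⟩
      exact ⟨0, Submodule.zero_mem _, Subsingleton.elim _ _⟩
  cases n with
  | zero => trivial
  | succ n =>
    refine ⟨0, 0, 0, by simp, ⟨fun j v hv => Submodule.zero_mem _, fun j m hm => ?_,
      fun v hv hv' => Subsingleton.elim _ _⟩, key _ _⟩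
    exact ⟨0, Submodule.zero_mem _, Subsingleton.elim _ _⟩

theorem isLin_free [SetLike.GradedMonoid 𝒜] (r n : ℕ) : IsLin 𝒜 (freeGrading 𝒜 r) n (r : ℤ⟦X⟧) := by
  cases n with
  | zero => trivial
  | succ n =>
    refine isLin_succ_iff.mpr ⟨r, 0, LinearMap.id, by simp, ⟨fun j v hv => hv,
      fun j m hm => ⟨m, hm, rfl⟩, fun v hv hv' => hv'⟩, ?_⟩
    have : Subsingleton (LinearMap.ker (LinearMap.id : (Fin r → A) →ₗ[A] (Fin r → A))) := by
      rw [LinearMap.ker_id]; infer_instance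
    exact isLin_of_subsingleton n

theorem isLin_self [SetLike.GradedMonoid 𝒜] (n : ℕ) : IsLin 𝒜 𝒜 n 1 := by
  have h := isLin_free (𝒜 := 𝒜) 1 n
  rw [Nat.cast_one] at h
  refine h.of_equiv (LinearEquiv.funUnique (Fin 1) A A) fun j m => ?_
  rw [mem_freeGrading, LinearEquiv.funUnique_apply]
  exact ⟨fun hm i => by rwa [Subsingleton.elim i 0], fun hm => hm 0⟩

/-- The grading of `Mˢ`. -/
def piGrading (ℳ : ℕ → Submodule k M) (s : ℕ) : ℕ → Submodule k (Fin s → M) :=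
  fun j => Submodule.pi Set.univ fun _ => ℳ j

theorem mem_piGrading {s j : ℕ} {v : Fin s → M} : v ∈ piGrading ℳ s j ↔ ∀ i, v i ∈ ℳ j := by
  simp [piGrading]

theorem IsLin.pi [SetLike.GradedMonoid 𝒜] (hM : SMulMem 𝒜 ℳ) {n : ℕ} {b : ℤ⟦X⟧} (h : IsLin 𝒜 ℳ n b) (s : ℕ) :
    IsLin 𝒜 (piGrading ℳ s) n (s * b) := by
  induction s with
  | zero => rw [Nat.cast_zero, zero_mul]; exact isLin_of_subsingleton n
  | succ s ih =>
    have hs : SMulMem 𝒜 (piGrading ℳ (s + 1)) := fun i j a ha m hm =>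
      mem_piGrading.mpr fun t => hM i j a ha _ (mem_piGrading.mp hm t)
    have : ((s + 1 : ℕ) : ℤ⟦X⟧) * b = b + s * b := by push_cast; ring
    rw [this]
    refine GradedExact.isLin_middle (f := LinearMap.single A (fun _ : Fin (s + 1) => M) 0)
      (g := LinearMap.funLeft A M Fin.succ) ⟨?_, ?_, ?_, ?_, ?_, ?_⟩ hs h ih
    · exact Pi.single_injective (M := fun _ : Fin (s + 1) => M) 0
    · intro v
      constructor
      · intro hv
        refine ⟨v 0, funext fun i => ?_⟩
        refine Fin.cases ?_ (fun i => ?_) i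
        · simp
        · simpa using (congrFun hv i).symm
      · rintro ⟨x, rfl⟩
        ext i
        simp [LinearMap.funLeft_apply]
    · intro j m
      rw [mem_piGrading]
      constructor
      · intro H; simpa using H 0
      · intro H i
        refine Fin.cases ?_ (fun i => ?_) i
        · simpa using H
        · simp
    · exact fun j hj => absurd hj (Nat.not_lt_zero j)
    · exact fun j m hm => mem_piGrading.mpr fun i => mem_piGrading.mp hm _
    · intro j m hm
      refine ⟨Fin.cons 0 m, mem_piGrading.mpr fun i => ?_, ?_⟩
      · refine Fin.cases ?_ (fun i => ?_) i
        · exact Submodule.zero_mem _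
        · exact mem_piGrading.mp hm i
      · ext i; simp [LinearMap.funLeft_apply]

end Exact

end Linear

end BackelinRoos

/-! ### Gradings described by projections -/

namespace BackelinRoos

section Projections

universe w₁ w₂

variable {k : Type u} [Field k]
  {M : Type w₁} [AddCommGroup M] [Module k M] {N : Type w₂} [AddCommGroup N] [Module k N]

/-- `M` is the direct sum of the subspaces `ℳ j`, in terms of projections. -/
structure HasProjections (ℳ : ℕ → Submodule k M) : Prop where
  span : ∀ m, m ∈ ⨆ j, ℳ j
  exists_proj : ∃ q : ℕ → M →ₗ[k] M, ∀ i j, ∀ m ∈ ℳ i, q j m = if i = j then m else 0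

namespace HasProjections

variable {ℳ : ℕ → Submodule k M} {𝒩 : ℕ → Submodule k N}

/-- The projection to the component of degree `j`. -/
noncomputable def proj (h : HasProjections ℳ) (j : ℕ) : M →ₗ[k] M := h.exists_proj.choose j

theorem proj_apply (h : HasProjections ℳ) {i : ℕ} (j : ℕ) {m : M} (hm : m ∈ ℳ i) :
    h.proj j m = if i = j then m else 0 := h.exists_proj.choose_spec i j m hm

theorem proj_same (h : HasProjections ℳ) {j : ℕ} {m : M} (hm : m ∈ ℳ j) : h.proj j m = m := by
  rw [h.proj_apply j hm, if_pos rfl]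

theorem induction (h : HasProjections ℳ) {P : Submodule k M} (hP : ∀ j, ℳ j ≤ P) (m : M) :
    m ∈ P := iSup_le hP (h.span m)

theorem proj_mem (h : HasProjections ℳ) (j : ℕ) (m : M) : h.proj j m ∈ ℳ j := by
  refine h.induction (P := (ℳ j).comap (h.proj j)) (fun i x hx => ?_) m
  rw [Submodule.mem_comap, h.proj_apply j hx]
  split_ifs with hij
  · exact hij ▸ hx
  · exact Submodule.zero_mem _

theorem proj_map (hM : HasProjections ℳ) (hN : HasProjections 𝒩) (f : M →ₗ[k] N) {s : ℕ}
    (hf : ∀ j, ∀ m ∈ ℳ j, f m ∈ 𝒩 (j + s)) (j : ℕ) (m : M) :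
    hN.proj (j + s) (f m) = f (hM.proj j m) := by
  refine hM.induction (P := LinearMap.eqLocus (hN.proj (j + s) ∘ₗ f) (f ∘ₗ hM.proj j))
    (fun i x hx => ?_) m
  rw [LinearMap.mem_eqLocus, LinearMap.comp_apply, LinearMap.comp_apply, hM.proj_apply j hx,
    hN.proj_apply _ (hf i x hx)]
  by_cases hij : i = j
  · simp [hij]
  · simp [hij]

theorem proj_map_of_lt (hM : HasProjections ℳ) (hN : HasProjections 𝒩) (f : M →ₗ[k] N) {s : ℕ}
    (hf : ∀ j, ∀ m ∈ ℳ j, f m ∈ 𝒩 (j + s)) {j : ℕ} (hj : j < s) (m : M) :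
    hN.proj j (f m) = 0 := by
  refine hM.induction (P := LinearMap.ker (hN.proj j ∘ₗ f)) (fun i x hx => ?_) m
  rw [LinearMap.mem_ker, LinearMap.comp_apply, hN.proj_apply _ (hf i x hx), if_neg (by omega)]

theorem exists_sum_proj (h : HasProjections ℳ) (m : M) :
    ∃ n, ∀ n', n ≤ n' → ∑ j ∈ Finset.range n', h.proj j m = m := by
  refine Submodule.iSup_induction ℳ (motive := fun m => ∃ n, ∀ n', n ≤ n' →
    ∑ j ∈ Finset.range n', h.proj j m = m) (h.span m) (fun i x hx => ?_) ⟨0, by simp⟩ ?_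
  · refine ⟨i + 1, fun n' hn' => ?_⟩
    simp only [h.proj_apply _ hx]
    rw [Finset.sum_ite_eq, if_pos (Finset.mem_range.mpr hn')]
  · rintro x y ⟨n₁, h₁⟩ ⟨n₂, h₂⟩
    refine ⟨max n₁ n₂, fun n' hn' => ?_⟩
    simp only [map_add, Finset.sum_add_distrib]
    rw [h₁ _ (le_of_max_le_left hn'), h₂ _ (le_of_max_le_right hn')]

end HasProjections

theorem hasProjections_of_gradedAlgebra {A : Type v} [CommRing A] [Algebra k A]
    (𝒜 : ℕ → Submodule k A) [GradedAlgebra 𝒜] : HasProjections 𝒜 := by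
  refine ⟨fun m => ?_, fun j => GradedAlgebra.proj 𝒜 j, fun i j m hm => ?_⟩
  · rw [(DirectSum.Decomposition.isInternal 𝒜).submodule_iSup_eq_top]; trivial
  · rw [GradedAlgebra.proj_apply]
    split_ifs with h
    · subst h; exact DirectSum.decompose_of_mem_same 𝒜 hm
    · exact DirectSum.decompose_of_mem_ne 𝒜 hm h

theorem hasProjections_freeGrading {A : Type v} [CommRing A] [Algebra k A]
    {𝒜 : ℕ → Submodule k A} (h : HasProjections 𝒜) (r : ℕ) :
    HasProjections (freeGrading 𝒜 r) := by
  refine ⟨fun m => ?_, fun j => LinearMap.pi fun i => h.proj j ∘ₗ LinearMap.proj i,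
    fun i j m hm => ?_⟩
  · rw [← Finset.univ_sum_single m]
    refine Submodule.sum_mem _ fun i _ => ?_
    refine h.induction (P := (⨆ j, freeGrading 𝒜 r j).comap (LinearMap.single k (fun _ => A) i))
      (fun j x hx => ?_) (m i)
    refine Submodule.mem_iSup_of_mem j (mem_freeGrading.mpr fun t => ?_)
    by_cases hti : t = i
    · subst hti; simpa using hx
    · simp [hti]
  · ext t
    have := h.proj_apply j (mem_freeGrading.mp hm t)
    simp only [LinearMap.pi_apply, LinearMap.comp_apply, LinearMap.proj_apply, this]
    split_ifs <;> rfl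

end Projections

section Kernel

universe w₁ w₂

variable {k : Type u} [Field k] {M : Type v} [AddCommGroup M] [Module k M]
  {N : Type w₁} [AddCommGroup N] [Module k N] {K : Type w₂} [AddCommGroup K] [Module k K]
  {ℳ : ℕ → Submodule k M} {𝒩 : ℕ → Submodule k N}

/-- The projections of `M` commute with the homogeneous map `f`, hence preserve its kernel. By `h0`
the kernel has no components below degree `s`, so nothing is lost when degree `s` is renamed degree
zero. -/
theorem HasProjections.of_exact (hM : HasProjections ℳ) (hN : HasProjections 𝒩) {s : ℕ}
    {ι : K →ₗ[k] M} {f : M →ₗ[k] N} (hι : Function.Injective ι) (hex : Function.Exact ι f)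
    (hf : ∀ j, ∀ m ∈ ℳ j, f m ∈ 𝒩 j) (h0 : ∀ j < s, ∀ m ∈ ℳ j, f m = 0 → m = 0)
    {𝒦 : ℕ → Submodule k K} (h𝒦 : ∀ j x, x ∈ 𝒦 j ↔ ι x ∈ ℳ (j + s)) : HasProjections 𝒦 := by
  have hcomm : ∀ j m, hN.proj j (f m) = f (hM.proj j m) := fun j m =>
    hM.proj_map hN f (s := 0) hf j m
  have hmem : ∀ j x, f (hM.proj j (ι x)) = 0 := fun j x => by
    rw [← hcomm, hex.apply_apply_eq_zero, map_zero]
  let e := LinearEquiv.ofInjective ι hι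
  let q : ℕ → K →ₗ[k] K := fun j => e.symm.toLinearMap ∘ₗ
    (hM.proj (j + s) ∘ₗ ι).codRestrict (LinearMap.range ι) fun x => (hex _).mp (hmem _ x)
  have hq : ∀ j x, ι (q j x) = hM.proj (j + s) (ι x) := fun j x =>
    congrArg Subtype.val (e.apply_symm_apply _)
  refine ⟨fun x => ?_, q, fun i j x hx => hι ?_⟩
  · obtain ⟨n, hn⟩ := hM.exists_sum_proj (ι x)
    have : x = ∑ j ∈ Finset.range n, q j x := by
      apply hι
      rw [map_sum, ← hn (s + n) (Nat.le_add_left n s), Finset.sum_range_add,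
        Finset.sum_eq_zero, zero_add]
      · refine Finset.sum_congr rfl fun j _ => ?_
        rw [hq, add_comm]
      · intro j hj
        exact h0 j (Finset.mem_range.mp hj) _ (hM.proj_mem _ _)
          (hmem _ _)
    rw [this]
    refine Submodule.sum_mem _ fun j _ => Submodule.mem_iSup_of_mem j ?_
    rw [h𝒦, hq]
    exact hM.proj_mem _ _
  · rw [hq, hM.proj_apply (j + s) ((h𝒦 _ _).mp hx)]
    by_cases hij : i = j
    · simp [hij]
    · simp [hij]

end Kernel

/-! ### Uniqueness of covers and passage between `IsLin` and actual resolutions -/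

section Linear

universe w₁

open PowerSeries

variable {k : Type u} [Field k] {A : Type v} [CommRing A] [Algebra k A] {𝒜 : ℕ → Submodule k A}
  {M : Type w₁} [AddCommGroup M] [Module k M] [Module A M] {ℳ : ℕ → Submodule k M}

theorem hasProjections_syzygyGrading [IsScalarTower k A M] (hA : HasProjections 𝒜)
    (hM : HasProjections ℳ)
    {r : ℕ} {p : (Fin r → A) →ₗ[A] M} (hp : IsCover 𝒜 ℳ p) :
    HasProjections (syzygyGrading 𝒜 (LinearMap.ker p)) := by
  refine (hasProjections_freeGrading hA r).of_exact hM (s := 1)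
    (ι := (LinearMap.ker p).subtype.restrictScalars k) (f := p.restrictScalars k)
    Subtype.val_injective (fun v => ⟨fun hv => ⟨⟨v, hv⟩, rfl⟩, ?_⟩) hp.map_mem
    (fun j hj v hv hv' => ?_) fun _ _ => Iff.rfl
  · rintro ⟨x, rfl⟩; exact x.2
  · obtain rfl : j = 0 := by omega
    exact hp.eq_zero v hv hv'

theorem IsCover.surjective {r : ℕ} {p : (Fin r → A) →ₗ[A] M} [IsScalarTower k A M]
    (hp : IsCover 𝒜 ℳ p)
    (hM : HasProjections ℳ) : Function.Surjective p := fun m =>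
  hM.induction (P := LinearMap.range (p.restrictScalars k))
    (fun j m hm => let ⟨v, _, hv⟩ := hp.exists_lift j m hm; ⟨v, hv⟩) m

theorem single_mem_freeGrading [SetLike.GradedOne 𝒜] {s : ℕ} (i : Fin s) :
    (Pi.single i 1 : Fin s → A) ∈ freeGrading 𝒜 s 0 := by
  rw [mem_freeGrading]
  intro t
  by_cases hti : t = i
  · subst hti; rw [Pi.single_eq_same]; exact SetLike.GradedOne.one_mem
  · rw [Pi.single_eq_of_ne hti]; exact Submodule.zero_mem _

theorem smulMem_freeGrading [SetLike.GradedMul 𝒜] (r : ℕ) : SMulMem 𝒜 (freeGrading 𝒜 r) :=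
  fun _ _ _ ha _ hm => mem_freeGrading.mpr fun t =>
    SetLike.GradedMul.mul_mem ha (mem_freeGrading.mp hm t)

/-- The first step of a linear resolution may be computed from any cover. -/
theorem IsLin.of_isCover [Nontrivial A] [SetLike.GradedMonoid 𝒜] {n : ℕ} {b : ℤ⟦X⟧}
    (h : IsLin 𝒜 ℳ (n + 1) b) {r : ℕ}
    {p : (Fin r → A) →ₗ[A] M} (hp : IsCover 𝒜 ℳ p) :
    ∃ c : ℤ⟦X⟧, b = (r : ℤ⟦X⟧) + X * c ∧ IsLin 𝒜 (syzygyGrading 𝒜 (LinearMap.ker p)) n c := by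
  obtain ⟨r', c, p', hb, hp', hc⟩ := isLin_succ_iff.mp h
  -- Basis elements have degree zero, so either cover lifts through the other by a homogeneous map.
  have key : ∀ {s t : ℕ} {p : (Fin s → A) →ₗ[A] M} {q : (Fin t → A) →ₗ[A] M},
      IsCover 𝒜 ℳ p → IsCover 𝒜 ℳ q → ∃ φ : (Fin s → A) →ₗ[A] (Fin t → A),
        (∀ v, q (φ v) = p v) ∧ ∀ j, ∀ v ∈ freeGrading 𝒜 s j, φ v ∈ freeGrading 𝒜 t j := by
    intro s t p q hp hq
    choose m hm hm' using fun i : Fin s =>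
      hq.exists_lift 0 _ (hp.map_mem 0 _ (single_mem_freeGrading i))
    refine ⟨Fintype.linearCombination A m, fun v => ?_, fun j v hv =>
      (smulMem_freeGrading t).linearCombination_mem hm hv⟩
    have : q ∘ₗ Fintype.linearCombination A m = p := by
      refine LinearMap.pi_ext' fun i => LinearMap.ext_ring ?_
      simp [Fintype.linearCombination_apply_single, hm']
    exact LinearMap.congr_fun this v
  obtain ⟨φ, hφ, hφ'⟩ := key hp' hp
  obtain ⟨ψ, hψ, hψ'⟩ := key hp hp'
  -- The two lifts are mutually inverse: on a basis element the composite differs from the identity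
  -- by an element of the kernel in degree zero, which vanishes.
  have inv : ∀ {s t : ℕ} {p : (Fin s → A) →ₗ[A] M} {q : (Fin t → A) →ₗ[A] M}
      (φ : (Fin s → A) →ₗ[A] (Fin t → A)) (ψ : (Fin t → A) →ₗ[A] (Fin s → A)),
      IsCover 𝒜 ℳ p → (∀ v, q (φ v) = p v) → (∀ v, p (ψ v) = q v) →
      (∀ j, ∀ v ∈ freeGrading 𝒜 s j, φ v ∈ freeGrading 𝒜 t j) →
      (∀ j, ∀ v ∈ freeGrading 𝒜 t j, ψ v ∈ freeGrading 𝒜 s j) →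
      ψ ∘ₗ φ = LinearMap.id := by
    intro s t p q φ ψ hp h1 h2 h3 h4
    refine LinearMap.pi_ext' fun i => LinearMap.ext_ring ?_
    have hi := single_mem_freeGrading (𝒜 := 𝒜) i
    have := hp.eq_zero (ψ (φ (Pi.single i 1)) - Pi.single i 1)
      (Submodule.sub_mem _ (h4 _ _ (h3 _ _ hi)) hi) (by rw [map_sub, h2, h1, sub_self])
    simpa [sub_eq_zero] using this
  let e : (Fin r' → A) ≃ₗ[A] (Fin r → A) := LinearEquiv.ofLinearMap φ ψ
    (inv ψ φ hp hψ hφ hψ' hφ') (inv φ ψ hp' hφ hψ hφ' hψ')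
  have hr : r' = r := by simpa using card_eq_of_linearEquiv A e
  have hmap : (LinearMap.ker p').map (e : (Fin r' → A) →ₗ[A] (Fin r → A)) = LinearMap.ker p := by
    ext v
    rw [Submodule.mem_map]
    constructor
    · rintro ⟨x, hx, rfl⟩
      exact (hφ x).trans hx
    · intro hv
      exact ⟨ψ v, (hψ v).trans hv, e.apply_symm_apply v⟩
  refine ⟨c, hr ▸ hb, hc.of_equiv (e.ofSubmodules _ _ hmap) fun j v => ⟨fun hv => ?_, fun hv => ?_⟩⟩
  · have : ψ (φ v.1) ∈ freeGrading 𝒜 r' (j + 1) := hψ' _ _ hv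
    rwa [← LinearMap.comp_apply, inv φ ψ hp' hφ hψ hφ' hψ'] at this
  · exact hφ' _ _ hv

variable (𝒜 ℳ) in
/-- A linear graded free resolution of a graded module generated in degree zero. -/
structure LinearResolution where
  /-- the ranks -/
  rank : ℕ → ℕ
  /-- the differentials -/
  d : (i : ℕ) → (Fin (rank (i + 1)) → A) →ₗ[A] (Fin (rank i) → A)
  /-- the augmentation -/
  aug : (Fin (rank 0) → A) →ₗ[A] M
  d_mem : ∀ i c, d i (Pi.single c 1) ∈ freeGrading 𝒜 (rank i) 1
  aug_mem : ∀ r, aug (Pi.single r 1) ∈ ℳ 0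
  aug_surjective : Function.Surjective aug
  exact_zero : Function.Exact (d 0) aug
  exact_succ : ∀ i, Function.Exact (d (i + 1)) (d i)

/-- The generating function of the ranks. -/
def LinearResolution.series (F : LinearResolution 𝒜 ℳ) : ℤ⟦X⟧ := PowerSeries.mk fun i => F.rank i

theorem series_eq_add (f : ℕ → ℤ) :
    PowerSeries.mk f = PowerSeries.C (f 0) + X * PowerSeries.mk fun i => f (i + 1) := by
  ext (_ | n)
  · simp
  · rw [map_add, coeff_succ_X_mul, coeff_C, if_neg n.succ_ne_zero, zero_add, coeff_mk, coeff_mk]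

/-- A syzygy module with a linear resolution. -/
structure LinearSyzygy (𝒜 : ℕ → Submodule k A) where
  /-- the rank of the ambient free module -/
  rank : ℕ
  /-- the module -/
  K : Submodule A (Fin rank → A)
  /-- the ranks of its resolution -/
  series : ℤ⟦X⟧
  isLin : ∀ n, IsLin 𝒜 (syzygyGrading 𝒜 K) n series
  hasProjections : HasProjections (syzygyGrading 𝒜 K)

/-- For different `n` the hypothesis may use different covers. The cover from `n = 1` is fixed,
`IsLin.of_isCover` transfers every other step to it, and cancelling `X` shows that the remaining
series does not depend on `n`. -/
theorem exists_linearSyzygy [Nontrivial A] [SetLike.GradedMonoid 𝒜] [IsScalarTower k A M]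
    (hA : HasProjections 𝒜) (hM : HasProjections ℳ) {b : ℤ⟦X⟧} (h : ∀ n, IsLin 𝒜 ℳ n b) :
    ∃ (t : LinearSyzygy 𝒜) (p : (Fin t.rank → A) →ₗ[A] M), IsCover 𝒜 ℳ p ∧
      Function.Surjective p ∧ LinearMap.ker p = t.K ∧ b = (t.rank : ℤ⟦X⟧) + X * t.series := by
  obtain ⟨r, c, p, hb, hp, -⟩ := isLin_succ_iff.mp (h 1)
  refine ⟨⟨r, LinearMap.ker p, c, fun n => ?_, hasProjections_syzygyGrading hA hM hp⟩, p, hp,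
    hp.surjective hM, rfl, hb⟩
  obtain ⟨c', hb', hc'⟩ := (h (n + 1)).of_isCover hp
  have : c' = c := by
    have : X * c' = X * c := add_left_cancel (hb'.symm.trans hb)
    exact mul_left_cancel₀ X_ne_zero this
  exact this ▸ hc'

/-- Linearity up to every finite step is turned into one infinite resolution: a first syzygy is
again linear to all orders, so the choice of a cover can be iterated. -/
theorem exists_linearResolution [Nontrivial A] [SetLike.GradedMonoid 𝒜] [IsScalarTower k A M]
    (hA : HasProjections 𝒜) (hM : HasProjections ℳ) {b : ℤ⟦X⟧} (h : ∀ n, IsLin 𝒜 ℳ n b) :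
    ∃ F : LinearResolution 𝒜 ℳ, F.series = b := by
  obtain ⟨t₀, p₀, hp₀, hs₀, hk₀, hb₀⟩ := exists_linearSyzygy hA hM h
  choose nxt p hp hs hk hb using fun t : LinearSyzygy 𝒜 =>
    exists_linearSyzygy hA t.hasProjections t.isLin
  let seq : ℕ → LinearSyzygy 𝒜 := fun i => Nat.rec t₀ (fun _ t => nxt t) i
  have hrange : ∀ i, Set.range ((seq i).K.subtype ∘ₗ p (seq i)) = (seq i).K := by
    intro i
    ext v
    constructor
    · rintro ⟨w, rfl⟩; exact Subtype.property _
    · intro hv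
      obtain ⟨w, hw⟩ := hs (seq i) ⟨v, hv⟩
      exact ⟨w, congrArg Subtype.val hw⟩
  refine ⟨⟨fun i => (seq i).rank, fun i => (seq i).K.subtype ∘ₗ p (seq i), p₀, fun i c => ?_,
    fun r => hp₀.map_mem 0 _ (single_mem_freeGrading r), hs₀, fun v => ?_, fun i v => ?_⟩, ?_⟩
  · exact (hp (seq i)).map_mem 0 _ (single_mem_freeGrading c)
  · rw [hrange]
    change _ ↔ v ∈ t₀.K
    rw [← hk₀, LinearMap.mem_ker]
  · refine Iff.trans ?_ (iff_of_eq (congrArg (v ∈ ·) (hrange (i + 1)).symm))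
    change _ ↔ v ∈ (nxt (seq i)).K
    rw [← hk, LinearMap.mem_ker, LinearMap.comp_apply, Submodule.subtype_apply,
      ZeroMemClass.coe_eq_zero]
  -- `(seq i).series` belongs to the kernel inside the free module of rank `(seq i).rank`, so its
  -- constant term is already the next rank.
  · have hcoeff : ∀ j i, coeff j (seq i).series = ((seq (i + 1 + j)).rank : ℤ) := by
      intro j
      induction j with
      | zero => intro i; rw [hb (seq i)]; simp [seq]
      | succ j ih =>
        intro i
        have h1 : ((nxt (seq i)).rank : ℤ⟦X⟧) = C ((nxt (seq i)).rank : ℤ) := by simp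
        rw [hb (seq i), h1, map_add, coeff_succ_X_mul, coeff_C, if_neg j.succ_ne_zero, zero_add]
        rw [show i + 1 + (j + 1) = (i + 1) + 1 + j by omega]
        exact ih (i + 1)
    have h1 : (t₀.rank : ℤ⟦X⟧) = C (t₀.rank : ℤ) := by simp
    ext j
    rw [hb₀, h1, LinearResolution.series, coeff_mk]
    cases j with
    | zero => simp [seq]
    | succ j =>
      rw [map_add, coeff_succ_X_mul, coeff_C, if_neg j.succ_ne_zero]
      have := hcoeff j 0
      rw [show 0 + 1 + j = j + 1 by omega] at this
      exact (this.symm.trans (zero_add _).symm)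

/-! ### Minimal resolutions over standard graded algebras -/

section Standard

variable [GradedAlgebra 𝒜] [IsStandardGraded 𝒜]

theorem eq_zero_of_augmentation_eq_zero {a : A} (ha : a ∈ 𝒜 0) (h : augmentation 𝒜 a = 0) :
    a = 0 := by
  have h1 := algebraMap_augmentation 𝒜 a
  rwa [h, map_zero, GradedRing.proj_apply, DirectSum.decompose_of_mem_same 𝒜 ha, eq_comm] at h1

theorem mem_irrelevant_iff {a : A} :
    a ∈ HomogeneousIdeal.irrelevant 𝒜 ↔ augmentation 𝒜 a = 0 := by
  have : Nontrivial A := IsStandardGraded.nontrivial (𝒜 := 𝒜)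
  rw [HomogeneousIdeal.mem_irrelevant_iff, ← algebraMap_augmentation,
    map_eq_zero_iff _ (algebraMap k A).injective]

theorem augmentation_apply_eq_zero {s t : ℕ} (d : (Fin s → A) →ₗ[A] (Fin t → A))
    (h : ∀ c i, augmentation 𝒜 (d (Pi.single c 1) i) = 0) (v : Fin s → A) (i : Fin t) :
    augmentation 𝒜 (d v i) = 0 := by
  rw [LinearMap.pi_apply_eq_sum_univ d v, Finset.sum_apply, map_sum]
  refine Finset.sum_eq_zero fun c _ => ?_
  have : (fun j => if c = j then (1 : A) else 0) = Pi.single c 1 := by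
    ext j; simp [Pi.single_apply, eq_comm]
  rw [this, Pi.smul_apply, smul_eq_mul, map_mul, h, mul_zero]

/-- Minimality gives injectivity in degree zero: a kernel with entries in `A₊` contains no nonzero
vector of scalars. Lifts are made homogeneous by projecting. -/
theorem isCover_of_surjective [IsScalarTower k A M] (hsm : SMulMem 𝒜 ℳ) (hM : HasProjections ℳ)
    {s : ℕ} {p : (Fin s → A) →ₗ[A] M} (hp : ∀ i, p (Pi.single i 1) ∈ ℳ 0)
    (hsurj : Function.Surjective p) (hker : ∀ v, p v = 0 → ∀ i, augmentation 𝒜 (v i) = 0) :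
    IsCover 𝒜 ℳ p := by
  have hF := hasProjections_freeGrading (hasProjections_of_gradedAlgebra 𝒜) s
  refine ⟨fun j v hv => hsm.map_mem hp hv, fun j m hm => ?_, fun v hv hv' => funext fun i =>
    eq_zero_of_augmentation_eq_zero (mem_freeGrading.mp hv i) (hker v hv' i)⟩
  obtain ⟨v, rfl⟩ := hsurj m
  refine ⟨hF.proj j v, hF.proj_mem j v, ?_⟩
  have := hF.proj_map hM (p.restrictScalars k) (s := 0) (fun j v hv => hsm.map_mem hp hv) j v
  rw [add_zero] at this
  exact this.symm.trans (hM.proj_same hm)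

namespace LinearResolution

theorem augmentation_d (F : LinearResolution 𝒜 ℳ) (i : ℕ) (v : Fin (F.rank (i + 1)) → A)
    (r : Fin (F.rank i)) : augmentation 𝒜 (F.d i v r) = 0 :=
  augmentation_apply_eq_zero _ (fun c r =>
    augmentation_of_mem 𝒜 one_ne_zero (mem_freeGrading.mp (F.d_mem i c) r)) v r

/-- The resolution of the first syzygy module. -/
def tail (F : LinearResolution 𝒜 ℳ) :
    LinearResolution 𝒜 (syzygyGrading 𝒜 (LinearMap.ker F.aug)) where
  rank i := F.rank (i + 1)
  d i := F.d (i + 1)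
  aug := (F.d 0).codRestrict _ fun v => F.exact_zero.apply_apply_eq_zero v
  d_mem i := F.d_mem (i + 1)
  aug_mem r := F.d_mem 0 r
  aug_surjective v := by
    obtain ⟨w, hw⟩ := (F.exact_zero v.1).mp v.2
    exact ⟨w, Subtype.ext hw⟩
  exact_zero v := by
    rw [← F.exact_succ 0 v, Subtype.ext_iff]; rfl
  exact_succ i := F.exact_succ (i + 1)

theorem isCover [IsScalarTower k A M] (F : LinearResolution 𝒜 ℳ) (hsm : SMulMem 𝒜 ℳ)
    (hM : HasProjections ℳ) : IsCover 𝒜 ℳ F.aug := by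
  refine isCover_of_surjective hsm hM F.aug_mem F.aug_surjective fun v hv i => ?_
  obtain ⟨w, rfl⟩ := (F.exact_zero v).mp hv
  exact F.augmentation_d 0 w i

theorem isLin_of_tail [IsScalarTower k A M] (F : LinearResolution 𝒜 ℳ) (hsm : SMulMem 𝒜 ℳ)
    (hM : HasProjections ℳ) {n : ℕ}
    (h : IsLin 𝒜 (syzygyGrading 𝒜 (LinearMap.ker F.aug)) n F.tail.series) :
    IsLin 𝒜 ℳ (n + 1) F.series := by
  refine isLin_succ_iff.mpr ⟨_, _, F.aug, ?_, F.isCover hsm hM, h⟩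
  rw [LinearResolution.series, series_eq_add]
  simp [LinearResolution.series, tail]

theorem isLin [IsScalarTower k A M] (F : LinearResolution 𝒜 ℳ) (hsm : SMulMem 𝒜 ℳ)
    (hM : HasProjections ℳ) (n : ℕ) : IsLin 𝒜 ℳ n F.series := by
  have hA := hasProjections_of_gradedAlgebra 𝒜
  have key : ∀ (n r : ℕ) (K : Submodule A (Fin r → A)) (F : LinearResolution 𝒜 (syzygyGrading 𝒜 K)),
      HasProjections (syzygyGrading 𝒜 K) → IsLin 𝒜 (syzygyGrading 𝒜 K) n F.series := by
    intro n
    induction n with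
    | zero => intros; trivial
    | succ n ih =>
      intro r K F hK
      have hs := smulMem_syzygyGrading (𝒜 := 𝒜) K
      exact F.isLin_of_tail hs hK
        (ih _ _ F.tail (hasProjections_syzygyGrading hA hK (F.isCover hs hK)))
  cases n with
  | zero => trivial
  | succ n =>
    exact F.isLin_of_tail hsm hM
      (key _ _ _ F.tail (hasProjections_syzygyGrading hA hM (F.isCover hsm hM)))

end LinearResolution

/-- The degrees of minimal generators of a module generated in degree zero are zero. -/
theorem degree_eq_zero {t s : ℕ} {p : (Fin t → A) →ₗ[A] M}
    (hp : ∀ j, ∀ m ∈ ℳ j, ∃ v ∈ freeGrading 𝒜 t j, p v = m)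
    {q : (Fin s → A) →ₗ[A] M} {δ : Fin s → ℕ} (hδ : ∀ i, q (Pi.single i 1) ∈ ℳ (δ i))
    (hsurj : Function.Surjective q) (hker : ∀ v, q v = 0 → ∀ i, augmentation 𝒜 (v i) = 0)
    (i : Fin s) : δ i = 0 := by
  by_contra hi
  obtain ⟨v, hv, hv'⟩ := hp _ _ (hδ i)
  choose w hw using fun c : Fin t => hsurj (p (Pi.single c 1))
  have h1 : q (Fintype.linearCombination A w v) = p v := by
    have : q ∘ₗ Fintype.linearCombination A w = p := by
      refine LinearMap.pi_ext' fun i => LinearMap.ext_ring ?_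
      simp [Fintype.linearCombination_apply_single, hw]
    exact LinearMap.congr_fun this v
  -- The `i`-th generator is rewritten through the degree-zero generators `p (Pi.single c 1)`. If `δ
  -- i` were positive, the coefficients `v` would lie in `A₊`, and the resulting relation would have
  -- an `i`-th coordinate of augmentation one.
  have h2 := hker (Pi.single i 1 - Fintype.linearCombination A w v)
    (by rw [map_sub, h1, hv', sub_self]) i
  rw [Pi.sub_apply, Pi.single_eq_same, map_sub, map_one, Fintype.linearCombination_apply,
    Finset.sum_apply, map_sum, Finset.sum_eq_zero, sub_zero] at h2
  · exact one_ne_zero h2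
  · intro c _
    rw [Pi.smul_apply, smul_eq_mul, map_mul,
      augmentation_of_mem 𝒜 hi (mem_freeGrading.mp hv c), zero_mul]

/-- One step of the comparison between a minimal and a linear resolution: a minimal set of
generators is forced into degree zero and so forms a cover, whose kernel inherits linearity to all
orders. -/
theorem isLin_ker_of_minimal [IsScalarTower k A M] (hsm : SMulMem 𝒜 ℳ) (hM : HasProjections ℳ)
    {b : ℤ⟦X⟧} (h : ∀ n, IsLin 𝒜 ℳ n b) {s : ℕ} {q : (Fin s → A) →ₗ[A] M} {δ : Fin s → ℕ}
    (hδ : ∀ i, q (Pi.single i 1) ∈ ℳ (δ i)) (hsurj : Function.Surjective q)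
    (hker : ∀ v, q v = 0 → ∀ i, augmentation 𝒜 (v i) = 0) :
    (∀ i, δ i = 0) ∧ HasProjections (syzygyGrading 𝒜 (LinearMap.ker q)) ∧
      ∃ c, ∀ n, IsLin 𝒜 (syzygyGrading 𝒜 (LinearMap.ker q)) n c := by
  have : Nontrivial A := IsStandardGraded.nontrivial (𝒜 := 𝒜)
  obtain ⟨t, c, p, hb, hp, -⟩ := isLin_succ_iff.mp (h 1)
  have h0 := degree_eq_zero hp.exists_lift hδ hsurj hker
  have hq : IsCover 𝒜 ℳ q :=
    isCover_of_surjective hsm hM (fun i => by rw [← h0 i]; exact hδ i) hsurj hker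
  refine ⟨h0, hasProjections_syzygyGrading (hasProjections_of_gradedAlgebra 𝒜) hM hq, ?_⟩
  choose c hc hc' using fun n => (h (n + 1)).of_isCover hq
  refine ⟨c 0, fun n => ?_⟩
  have : X * c n = X * c 0 := add_left_cancel ((hc n).symm.trans (hc 0))
  rw [← mul_left_cancel₀ X_ne_zero this]
  exact hc' n

namespace GradedFreeResolution

theorem augmentation_d {F : GradedFreeResolution 𝒜 ℳ} (hF : F.IsMinimal) (i : ℕ)
    (v : Fin (F.rank (i + 1)) → A) (r : Fin (F.rank i)) : augmentation 𝒜 (F.d i v r) = 0 :=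
  augmentation_apply_eq_zero _ (fun c r => mem_irrelevant_iff.mp (hF i c r)) v r

/-- Minimal resolutions of modules with a linear resolution are linear. -/
theorem isLinear_of_isMinimal [IsScalarTower k A M] (hsm : SMulMem 𝒜 ℳ) (hM : HasProjections ℳ)
    {b : ℤ⟦X⟧} (h : ∀ n, IsLin 𝒜 ℳ n b) {F : GradedFreeResolution 𝒜 ℳ} (hF : F.IsMinimal) :
    F.IsLinear := by
  have key : ∀ i, (∀ r, F.deg i r = i) ∧
      HasProjections (syzygyGrading 𝒜 (LinearMap.range (F.d i))) ∧
      ∃ c, ∀ n, IsLin 𝒜 (syzygyGrading 𝒜 (LinearMap.range (F.d i))) n c := by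
    intro i
    induction i with
    | zero =>
      have := isLin_ker_of_minimal hsm hM h F.aug_homogeneous F.aug_surjective fun v hv => by
        obtain ⟨w, rfl⟩ := (F.exact_zero v).mp hv
        exact augmentation_d hF 0 w
      rwa [F.exact_zero.linearMap_ker_eq] at this
    | succ i ih =>
      obtain ⟨hdeg, hproj, c, hc⟩ := ih
      -- The first part says that the truncated subtraction is genuine, that is, `i + 1 ≤ deg`.
      -- Minimality gives this twice over: no column of the differential vanishes, and no nonzero
      -- entry is a scalar.
      have hdeg' : ∀ r, F.deg (i + 1) r - (i + 1) + (i + 1) = F.deg (i + 1) r ∧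
          ∀ t, F.d i (Pi.single r 1) t ∈ 𝒜 (F.deg (i + 1) r - (i + 1) + 1) := by
        intro r
        have hne : F.d i (Pi.single r 1) ≠ 0 := by
          intro h0
          obtain ⟨w, hw⟩ := (F.exact_succ i _).mp h0
          have := augmentation_d hF (i + 1) w r
          rw [hw, Pi.single_eq_same, map_one] at this
          exact one_ne_zero this
        obtain ⟨t, ht⟩ := Function.ne_iff.mp hne
        have hlt : i < F.deg (i + 1) r := by
          rcases F.d_homogeneous i r t with ⟨h1, h2⟩ | h1
          · rw [hdeg] at h1 h2
            rcases h1.eq_or_lt with h3 | h3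
            · rw [← h3, Nat.sub_self] at h2
              exact absurd (eq_zero_of_augmentation_eq_zero h2 (augmentation_d hF i _ t)) ht
            · exact h3
          · exact absurd h1 ht
        refine ⟨by omega, fun t => ?_⟩
        rcases F.d_homogeneous i r t with ⟨h1, h2⟩ | h1
        · rw [hdeg] at h2
          rwa [show F.deg (i + 1) r - (i + 1) + 1 = F.deg (i + 1) r - i by omega]
        · rw [h1]; exact Submodule.zero_mem _
      have := isLin_ker_of_minimal (smulMem_syzygyGrading _) hproj hc
        (q := (F.d i).rangeRestrict) (δ := fun r => F.deg (i + 1) r - (i + 1))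
        (fun r => mem_syzygyGrading.mpr (hdeg' r).2) (LinearMap.surjective_rangeRestrict _)
        fun v hv => by
          obtain ⟨w, rfl⟩ := (F.exact_succ i v).mp (congrArg Subtype.val hv)
          exact augmentation_d hF (i + 1) w
      rw [LinearMap.ker_rangeRestrict, (F.exact_succ i).linearMap_ker_eq] at this
      refine ⟨fun r => ?_, this.2⟩
      have h1 := this.1 r
      have h2 := (hdeg' r).1
      omega
  exact fun i => (key i).1

end GradedFreeResolution

end Standard

end Linear

end BackelinRoos

namespace BackelinRoos

open PowerSeries

/-! ### Restriction of scalars -/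

section Restrict

universe w₁

variable {k : Type u} [Field k] {A : Type v} [CommRing A] [Algebra k A] {𝒜 : ℕ → Submodule k A}
  {C : Type w} [CommRing C] [Algebra k C] {𝒞 : ℕ → Submodule k C} [SetLike.GradedMonoid 𝒞]
  [Algebra C A]

/-- Restricted to `C`, the sequence `0 → ker p → Aʳ → N → 0` has a middle term of series `rβ` and,
by induction, a kernel of series `βc`. The mapping cone then gives `rβ + Xβc = β(r + Xc)`, so series
multiply under change of rings. -/
theorem isLin_restrictScalars_succ (hCA : SMulMem 𝒞 𝒜) {n : ℕ} {β : ℤ⟦X⟧}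
    (hβ : IsLin 𝒞 𝒜 (n + 1) β)
    (ih : ∀ (r : ℕ) (K : Submodule A (Fin r → A)) (c : ℤ⟦X⟧), IsLin 𝒜 (syzygyGrading 𝒜 K) n c →
      IsLin 𝒞 (syzygyGrading 𝒜 K) n (β * c))
    {N : Type w₁} [AddCommGroup N] [Module k N] [Module A N] [Module C N] [IsScalarTower C A N]
    {𝒩 : ℕ → Submodule k N} {c : ℤ⟦X⟧} (h : IsLin 𝒜 𝒩 (n + 1) c) :
    IsLin 𝒞 𝒩 (n + 1) (β * c) := by
  obtain ⟨r, c, p, rfl, hp, hc⟩ := isLin_succ_iff.mp h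
  have : β * ((r : ℤ⟦X⟧) + X * c) = (r : ℤ⟦X⟧) * β + X * (β * c) := by ring
  rw [this]
  refine GradedExact.isLin_right (f := (LinearMap.ker p).subtype.restrictScalars C)
    (g := p.restrictScalars C) (ℳ := piGrading 𝒜 r) ⟨Subtype.val_injective, fun v => ?_,
    fun j m => Iff.rfl, fun j hj m hm hm' => ?_, hp.map_mem, hp.exists_lift⟩
    (hβ.pi hCA r) (ih _ _ _ hc)
  · exact ⟨fun hv => ⟨⟨v, hv⟩, rfl⟩, by rintro ⟨x, rfl⟩; exact x.2⟩
  · obtain rfl : j = 0 := by omega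
    exact hp.eq_zero m hm hm'

theorem IsLin.restrictScalars (hCA : SMulMem 𝒞 𝒜) {N : Type w₁} [AddCommGroup N] [Module k N]
    [Module A N] [Module C N] [IsScalarTower C A N] {𝒩 : ℕ → Submodule k N} {n : ℕ} {c β : ℤ⟦X⟧}
    (h : IsLin 𝒜 𝒩 n c) (hβ : IsLin 𝒞 𝒜 n β) : IsLin 𝒞 𝒩 n (β * c) := by
  have key : ∀ (n : ℕ), IsLin 𝒞 𝒜 n β → ∀ (r : ℕ) (K : Submodule A (Fin r → A)) (c : ℤ⟦X⟧),
      IsLin 𝒜 (syzygyGrading 𝒜 K) n c → IsLin 𝒞 (syzygyGrading 𝒜 K) n (β * c) := by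
    intro n
    induction n with
    | zero => intros; trivial
    | succ n ih =>
      intro hβ r K c h
      exact isLin_restrictScalars_succ hCA hβ (ih hβ.of_succ) h
  cases n with
  | zero => trivial
  | succ n => exact isLin_restrictScalars_succ hCA hβ (key n hβ.of_succ) h

end Restrict

/-! ### Tensor products of graded vector spaces -/

section TensorSpace

universe w₁ w₂ w₃ w₄

variable {k : Type u} [Field k] {M : Type w₁} [AddCommGroup M] [Module k M]
  {N : Type w₂} [AddCommGroup N] [Module k N]

/-- The total grading on `M ⊗ₖ N`. -/
def tensorModuleGrading (ℳ : ℕ → Submodule k M) (𝒩 : ℕ → Submodule k N) :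
    ℕ → Submodule k (M ⊗[k] N) :=
  fun n => ⨆ p ∈ Finset.HasAntidiagonal.antidiagonal n,
    Submodule.map₂ (TensorProduct.mk k M N) (ℳ p.1) (𝒩 p.2)

variable {ℳ : ℕ → Submodule k M} {𝒩 : ℕ → Submodule k N}

theorem tmul_mem_tensorModuleGrading {i j : ℕ} {m : M} {n : N} (hm : m ∈ ℳ i) (hn : n ∈ 𝒩 j) :
    m ⊗ₜ[k] n ∈ tensorModuleGrading ℳ 𝒩 (i + j) :=
  Submodule.mem_iSup_of_mem (i, j) <| Submodule.mem_iSup_of_mem (by simp) <|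
    Submodule.apply_mem_map₂ _ hm hn

theorem tensorModuleGrading_le {n : ℕ} {P : Submodule k (M ⊗[k] N)}
    (h : ∀ i j, i + j = n → ∀ a ∈ ℳ i, ∀ b ∈ 𝒩 j, a ⊗ₜ[k] b ∈ P) :
    tensorModuleGrading ℳ 𝒩 n ≤ P := by
  refine iSup₂_le fun p hp => Submodule.map₂_le.mpr fun a ha b hb => ?_
  exact h p.1 p.2 (by simpa using hp) a ha b hb

theorem HasProjections.tensor (hM : HasProjections ℳ) (hN : HasProjections 𝒩) :
    HasProjections (tensorModuleGrading ℳ 𝒩) := by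
  refine ⟨fun x => ?_, fun n => ∑ p ∈ Finset.HasAntidiagonal.antidiagonal n,
    TensorProduct.map (hM.proj p.1) (hN.proj p.2), fun i j x hx => ?_⟩
  · induction x using TensorProduct.induction_on with
    | zero => exact Submodule.zero_mem _
    | add x y hx hy => exact Submodule.add_mem _ hx hy
    | tmul m n =>
      refine hM.induction (P := (⨆ j, tensorModuleGrading ℳ 𝒩 j).comap
        ((TensorProduct.mk k M N).flip n)) (fun i m hm => ?_) m
      refine hN.induction (P := (⨆ j, tensorModuleGrading ℳ 𝒩 j).comap
        (TensorProduct.mk k M N m)) (fun j n hn => ?_) n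
      exact Submodule.mem_iSup_of_mem (i + j) (tmul_mem_tensorModuleGrading hm hn)
  · have : tensorModuleGrading ℳ 𝒩 i ≤ LinearMap.eqLocus
        (∑ p ∈ Finset.HasAntidiagonal.antidiagonal j,
          TensorProduct.map (hM.proj p.1) (hN.proj p.2))
        (if i = j then LinearMap.id else 0) := by
      refine tensorModuleGrading_le fun i' j' hij m hm n hn => ?_
      have h1 : ∀ p : ℕ × ℕ, TensorProduct.map (hM.proj p.1) (hN.proj p.2) (m ⊗ₜ n) =
          if p = (i', j') then m ⊗ₜ[k] n else 0 := by
        rintro ⟨p1, p2⟩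
        rw [TensorProduct.map_tmul, hM.proj_apply _ hm, hN.proj_apply _ hn]
        by_cases h1 : i' = p1
        · by_cases h2 : j' = p2
          · simp [h1, h2]
          · simp [h1, h2, Ne.symm h2]
        · simp [h1, Ne.symm h1]
      rw [LinearMap.mem_eqLocus, LinearMap.sum_apply]
      simp only [h1, Finset.sum_ite_eq', Finset.HasAntidiagonal.mem_antidiagonal, hij]
      split_ifs <;> rfl
    rw [LinearMap.mem_eqLocus.mp (this hx)]
    split_ifs <;> rfl

theorem map_mem_tensorModuleGrading {M' : Type w₃} [AddCommGroup M'] [Module k M']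
    {N' : Type w₄} [AddCommGroup N'] [Module k N'] {ℳ' : ℕ → Submodule k M'}
    {𝒩' : ℕ → Submodule k N'} {f : M →ₗ[k] M'} {g : N →ₗ[k] N'} {s t : ℕ}
    (hf : ∀ j, ∀ m ∈ ℳ j, f m ∈ ℳ' (j + s)) (hg : ∀ j, ∀ n ∈ 𝒩 j, g n ∈ 𝒩' (j + t))
    (j : ℕ) (x : M ⊗[k] N) (hx : x ∈ tensorModuleGrading ℳ 𝒩 j) :
    TensorProduct.map f g x ∈ tensorModuleGrading ℳ' 𝒩' (j + (s + t)) := by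
  have : tensorModuleGrading ℳ 𝒩 j ≤
      (tensorModuleGrading ℳ' 𝒩' (j + (s + t))).comap (TensorProduct.map f g) := by
    refine tensorModuleGrading_le fun i l hil m hm n hn => ?_
    have := tmul_mem_tensorModuleGrading (hf i m hm) (hg l n hn)
    rwa [show i + s + (l + t) = j + (s + t) by omega] at this
  exact this hx

end TensorSpace

section GradedExact

universe w₁ w₂ w₃ w₄

variable {k : Type u} [Field k] {A : Type v} [CommRing A]
  {M' : Type w₁} [AddCommGroup M'] [Module k M'] [Module A M']
  {M : Type w₂} [AddCommGroup M] [Module k M] [Module A M]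
  {M'' : Type w₃} [AddCommGroup M''] [Module k M''] [Module A M'']
  {ℳ' : ℕ → Submodule k M'} {ℳ : ℕ → Submodule k M} {ℳ'' : ℕ → Submodule k M''}

/-- An injective homogeneous map commutes with projections, so it reflects degrees and its image has
nothing below degree `s`. Hence only homogeneity and graded lifts need checking, which suits tensor
products, where membership in a graded piece is hard to analyse directly. -/
theorem GradedExact.of_hasProjections {s : ℕ} (h' : HasProjections ℳ') (h : HasProjections ℳ)
    {f : M' →ₗ[k] M} {g : M →ₗ[k] M''} (hf : Function.Injective f) (hfg : Function.Exact f g)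
    (hf_mem : ∀ j, ∀ m ∈ ℳ' j, f m ∈ ℳ (j + s)) (hg_mem : ∀ j, ∀ m ∈ ℳ j, g m ∈ ℳ'' j)
    (hlift : ∀ j, ∀ m ∈ ℳ'' j, ∃ x ∈ ℳ j, g x = m) :
    GradedExact (A := k) s ℳ' ℳ ℳ'' f g := by
  refine ⟨hf, hfg, fun j m => ⟨fun hm => ?_, hf_mem j m⟩, fun j hj m hm hm' => ?_, hg_mem, hlift⟩
  · have h1 := h'.proj_map h f hf_mem j m
    rw [h.proj_same hm] at h1
    rw [hf h1]
    exact h'.proj_mem j m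
  · obtain ⟨y, rfl⟩ := (hfg m).mp hm'
    have h1 := h'.proj_map_of_lt h f hf_mem hj y
    rwa [h.proj_same hm] at h1

theorem GradedExact.lTensor {L : Type w₄} [AddCommGroup L] [Module k L] {ℒ : ℕ → Submodule k L}
    (hL : HasProjections ℒ) (h' : HasProjections ℳ') (h : HasProjections ℳ) {s : ℕ}
    {f : M' →ₗ[k] M} {g : M →ₗ[k] M''} (H : GradedExact (A := k) s ℳ' ℳ ℳ'' f g) :
    GradedExact (A := k) s (tensorModuleGrading ℒ ℳ') (tensorModuleGrading ℒ ℳ)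
      (tensorModuleGrading ℒ ℳ'') (TensorProduct.map LinearMap.id f)
      (TensorProduct.map LinearMap.id g) := by
  refine GradedExact.of_hasProjections (hL.tensor h') (hL.tensor h)
    (Module.Flat.lTensor_preserves_injective_linearMap f H.injective)
    (Module.Flat.lTensor_exact L H.exact) (fun j x hx => ?_) (fun j x hx => ?_) fun j x hx => ?_
  · have := map_mem_tensorModuleGrading (ℳ' := ℒ) (f := LinearMap.id) (s := 0)
      (fun j m hm => hm) (fun j m hm => (H.mem_iff j m).mpr hm) j x hx
    rwa [zero_add] at this
  · exact map_mem_tensorModuleGrading (ℳ' := ℒ) (f := LinearMap.id) (s := 0) (t := 0)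
      (fun j m hm => hm) H.map_mem j x hx
  · have : tensorModuleGrading ℒ ℳ'' j ≤
        (tensorModuleGrading ℒ ℳ j).map (TensorProduct.map LinearMap.id g) := by
      refine tensorModuleGrading_le fun i l hil a ha b hb => ?_
      obtain ⟨b, hb', rfl⟩ := H.exists_lift l b hb
      exact ⟨a ⊗ₜ b, hil ▸ tmul_mem_tensorModuleGrading ha hb', rfl⟩
    exact this hx

theorem GradedExact.rTensor {L : Type w₄} [AddCommGroup L] [Module k L] {ℒ : ℕ → Submodule k L}
    (hL : HasProjections ℒ) (h' : HasProjections ℳ') (h : HasProjections ℳ) {s : ℕ}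
    {f : M' →ₗ[k] M} {g : M →ₗ[k] M''} (H : GradedExact (A := k) s ℳ' ℳ ℳ'' f g) :
    GradedExact (A := k) s (tensorModuleGrading ℳ' ℒ) (tensorModuleGrading ℳ ℒ)
      (tensorModuleGrading ℳ'' ℒ) (TensorProduct.map f LinearMap.id)
      (TensorProduct.map g LinearMap.id) := by
  refine GradedExact.of_hasProjections (h'.tensor hL) (h.tensor hL)
    (Module.Flat.rTensor_preserves_injective_linearMap f H.injective)
    (Module.Flat.rTensor_exact L H.exact) (fun j x hx => ?_) (fun j x hx => ?_) fun j x hx => ?_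
  · exact map_mem_tensorModuleGrading (𝒩' := ℒ) (g := LinearMap.id) (t := 0)
      (fun j m hm => (H.mem_iff j m).mpr hm) (fun j m hm => hm) j x hx
  · exact map_mem_tensorModuleGrading (𝒩' := ℒ) (g := LinearMap.id) (s := 0) (t := 0)
      H.map_mem (fun j m hm => hm) j x hx
  · have : tensorModuleGrading ℳ'' ℒ j ≤
        (tensorModuleGrading ℳ ℒ j).map (TensorProduct.map g LinearMap.id) := by
      refine tensorModuleGrading_le fun i l hil a ha b hb => ?_
      obtain ⟨a, ha', rfl⟩ := H.exists_lift i a ha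
      exact ⟨a ⊗ₜ b, hil ▸ tmul_mem_tensorModuleGrading ha' hb, rfl⟩
    exact this hx

theorem GradedExact.congr {s : ℕ} {f : M' →ₗ[k] M} {g : M →ₗ[k] M''}
    (H : GradedExact (A := k) s ℳ' ℳ ℳ'' f g) {f' : M' →ₗ[A] M} {g' : M →ₗ[A] M''}
    (hf : ∀ x, f' x = f x) (hg : ∀ x, g' x = g x) : GradedExact s ℳ' ℳ ℳ'' f' g' := by
  have hf : ⇑f' = ⇑f := funext hf
  have hg : ⇑g' = ⇑g := funext hg
  obtain ⟨h1, h2, h3, h4, h5, h6⟩ := H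
  rw [← hf] at h1 h2
  rw [← hg] at h2
  refine ⟨h1, h2, fun j m => ?_, fun j hj m hm hm' => ?_, fun j m hm => ?_, fun j m hm => ?_⟩
  · rw [hf]; exact h3 j m
  · rw [hg] at hm'; exact h4 j hj m hm hm'
  · rw [hg]; exact h5 j m hm
  · rw [hg]; exact h6 j m hm

/-- The exact sequence given by a cover and its kernel. -/
theorem IsCover.gradedExact [Algebra k A] [IsScalarTower k A M] {𝒜 : ℕ → Submodule k A} {r : ℕ} {p : (Fin r → A) →ₗ[A] M}
    (hp : IsCover 𝒜 ℳ p) :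
    GradedExact (A := k) 1 (syzygyGrading 𝒜 (LinearMap.ker p)) (freeGrading 𝒜 r) ℳ
      ((LinearMap.ker p).subtype.restrictScalars k) (p.restrictScalars k) := by
  refine ⟨Subtype.val_injective, fun v => ?_, fun j m => Iff.rfl, fun j hj m hm hm' => ?_,
    hp.map_mem, hp.exists_lift⟩
  · exact ⟨fun hv => ⟨⟨v, hv⟩, rfl⟩, by rintro ⟨x, rfl⟩; exact x.2⟩
  · obtain rfl : j = 0 := by omega
    exact hp.eq_zero m hm hm'

end GradedExact

/-! ### Tensor products of modules with linear resolutions -/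

section TensorModule

universe w₁ w₂ w₃ w₄

variable {k : Type u} [Field k] {A : Type v} [CommRing A] [Algebra k A]
  {B : Type w} [CommRing B] [Algebra k B]

section

variable (A B) (M : Type w₁) [AddCommGroup M] [Module k M] [Module A M]
  (N : Type w₂) [AddCommGroup N] [Module k N] [Module B N]

/-- The action of `A ⊗ₖ B` on `M ⊗ₖ N` is the natural one. -/
class TensorSMul [Module (A ⊗[k] B) (M ⊗[k] N)] : Prop where
  tmul_smul_tmul : ∀ (a : A) (b : B) (m : M) (n : N),
    (a ⊗ₜ[k] b) • (m ⊗ₜ[k] n) = (a • m) ⊗ₜ[k] (b • n)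

/-- The class is a property of whichever action is present, so it covers both `A ⊗ B` acting on
itself and the action `tensorModule`, with no need to compare instances. -/
instance : TensorSMul (k := k) A B A B :=
  ⟨fun a b m n => Algebra.TensorProduct.tmul_mul_tmul a m b n⟩

variable [IsScalarTower k A M] [IsScalarTower k B N]

/-- The natural action of `A ⊗ₖ B` on `M ⊗ₖ N`. -/
noncomputable abbrev tensorModule : Module (A ⊗[k] B) (M ⊗[k] N) :=
  Module.compHom _ ((Module.endTensorEndAlgHom (R := k) (S := k) (A := k) (M := M) (N := N)).comp
    (Algebra.TensorProduct.map (Algebra.lsmul k k M) (Algebra.lsmul k k N))).toRingHom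

theorem tensorSMul : @TensorSMul k _ A _ _ B _ _ M _ _ _ N _ _ _ (tensorModule A B M N) :=
  letI := tensorModule (k := k) A B M N
  ⟨fun _ _ _ _ => rfl⟩

end

variable {M : Type w₁} [AddCommGroup M] [Module k M] [Module A M]
  {N : Type w₂} [AddCommGroup N] [Module k N] [Module B N]
  [Module (A ⊗[k] B) (M ⊗[k] N)] [TensorSMul (k := k) A B M N]

theorem map_smul_of_tmul {X : Type*} [AddCommGroup X] [Module k X] [Module (A ⊗[k] B) X]
    (F : M ⊗[k] N →ₗ[k] X)
    (hF : ∀ (a : A) (b : B) (m : M) (n : N),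
      F ((a • m) ⊗ₜ (b • n)) = (a ⊗ₜ[k] b) • F (m ⊗ₜ n)) (c : A ⊗[k] B) (x : M ⊗[k] N) :
    F (c • x) = c • F x := by
  induction c using TensorProduct.induction_on with
  | zero => simp
  | add c d hc hd => rw [add_smul, map_add, hc, hd, add_smul]
  | tmul a b =>
    induction x using TensorProduct.induction_on with
    | zero => simp
    | add x y hx hy => rw [smul_add, map_add, hx, hy, map_add, smul_add]
    | tmul m n => rw [TensorSMul.tmul_smul_tmul, hF]

theorem smul_assoc_of_tensorSMul [IsScalarTower k A M] (t : k) (c : A ⊗[k] B) (x : M ⊗[k] N) :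
    (t • c) • x = t • c • x := by
  induction c using TensorProduct.induction_on with
  | zero => simp
  | add c d hc hd => rw [smul_add, add_smul, hc, hd, add_smul, smul_add]
  | tmul a b =>
    induction x using TensorProduct.induction_on with
    | zero => simp
    | add x y hx hy => rw [smul_add, hx, hy, smul_add, smul_add]
    | tmul m n =>
      rw [TensorProduct.smul_tmul', TensorSMul.tmul_smul_tmul, TensorSMul.tmul_smul_tmul,
        TensorProduct.smul_tmul', smul_assoc]

theorem smulMem_tensorModuleGrading [IsScalarTower k A M] [IsScalarTower k B N]
    {𝒜 : ℕ → Submodule k A} {ℬ : ℕ → Submodule k B}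
    {ℳ : ℕ → Submodule k M} {𝒩 : ℕ → Submodule k N}
    (hM : SMulMem 𝒜 ℳ) (hN : SMulMem ℬ 𝒩) :
    SMulMem (tensorGrading 𝒜 ℬ) (tensorModuleGrading ℳ 𝒩) := by
  intro i j c hc x hx
  let P : Submodule k (A ⊗[k] B) :=
    { carrier := {c | c • x ∈ tensorModuleGrading ℳ 𝒩 (i + j)}
      add_mem' := fun {c d} hc hd => by
        rw [Set.mem_ofPred_eq, add_smul]; exact Submodule.add_mem _ hc hd
      zero_mem' := by rw [Set.mem_ofPred_eq, zero_smul]; exact Submodule.zero_mem _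
      smul_mem' := fun t c hc => by
        rw [Set.mem_ofPred_eq, smul_assoc_of_tensorSMul]; exact Submodule.smul_mem _ t hc }
  have : tensorGrading 𝒜 ℬ i ≤ P := by
    refine tensorGrading_le _ _ fun i₁ i₂ hi a ha b hb => ?_
    have h1 : ∀ y : M ⊗[k] N, (a ⊗ₜ[k] b) • y =
        TensorProduct.map (Algebra.lsmul k k M a) (Algebra.lsmul k k N b) y := fun y => by
      induction y using TensorProduct.induction_on with
      | zero => simp
      | add x y hx hy => rw [smul_add, map_add, hx, hy]
      | tmul m n => rw [TensorSMul.tmul_smul_tmul]; rfl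
    change (a ⊗ₜ[k] b) • x ∈ tensorModuleGrading ℳ 𝒩 (i + j)
    rw [h1, add_comm i j, ← hi]
    refine map_mem_tensorModuleGrading (s := i₁) (t := i₂) (fun l m hm => ?_) (fun l n hn => ?_) j x hx
    · rw [add_comm]; exact hM i₁ l a ha m hm
    · rw [add_comm]; exact hN i₂ l b hb n hn
  exact this hc

variable [IsScalarTower k A M] [IsScalarTower k B N]

/-- The tensor product of an `A`-linear and a `B`-linear map is `A ⊗ₖ B`-linear. -/
noncomputable def tensorMap {M' : Type w₃} [AddCommGroup M'] [Module k M'] [Module A M']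
    [IsScalarTower k A M'] {N' : Type w₄} [AddCommGroup N'] [Module k N'] [Module B N']
    [IsScalarTower k B N'] [Module (A ⊗[k] B) (M' ⊗[k] N')] [TensorSMul (k := k) A B M' N']
    (f : M →ₗ[A] M') (g : N →ₗ[B] N') : M ⊗[k] N →ₗ[A ⊗[k] B] M' ⊗[k] N' :=
  { TensorProduct.map (f.restrictScalars k) (g.restrictScalars k) with
    map_smul' := map_smul_of_tmul _ fun a b m n => by
      simp [TensorSMul.tmul_smul_tmul] }

theorem tensorMap_apply {M' : Type w₃} [AddCommGroup M'] [Module k M'] [Module A M']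
    [IsScalarTower k A M'] {N' : Type w₄} [AddCommGroup N'] [Module k N'] [Module B N']
    [IsScalarTower k B N'] [Module (A ⊗[k] B) (M' ⊗[k] N')] [TensorSMul (k := k) A B M' N']
    (f : M →ₗ[A] M') (g : N →ₗ[B] N') (x : M ⊗[k] N) :
    tensorMap f g x = TensorProduct.map (f.restrictScalars k) (g.restrictScalars k) x := rfl

end TensorModule

/-- A module which is a direct sum of copies of `Y`, in terms of inclusions and projections. -/
theorem IsLin.of_splitting {k : Type u} [Field k] {A : Type v} [CommRing A] [Algebra k A]
    {𝒜 : ℕ → Submodule k A} [SetLike.GradedMonoid 𝒜] {X Y : Type*} [AddCommGroup X] [Module k X]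
    [Module A X] [AddCommGroup Y] [Module k Y] [Module A Y] {𝒳 : ℕ → Submodule k X}
    {𝒴 : ℕ → Submodule k Y} (hY : SMulMem 𝒜 𝒴) {r : ℕ} (inc : Fin r → Y →ₗ[A] X)
    (pr : Fin r → X →ₗ[A] Y) (h1 : ∀ i j y, pr i (inc j y) = (Pi.single j y : Fin r → Y) i)
    (h2 : ∀ x, ∑ i, inc i (pr i x) = x) (h3 : ∀ i j, ∀ y ∈ 𝒴 j, inc i y ∈ 𝒳 j)
    (h4 : ∀ i j, ∀ x ∈ 𝒳 j, pr i x ∈ 𝒴 j) {n : ℕ} {b : ℤ⟦X⟧} (h : IsLin 𝒜 𝒴 n b) :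
    IsLin 𝒜 𝒳 n ((r : ℤ⟦X⟧) * b) := by
  let e : (Fin r → Y) ≃ₗ[A] X := LinearEquiv.ofLinearMap (∑ i, inc i ∘ₗ LinearMap.proj i)
    (LinearMap.pi pr) (LinearMap.ext fun x => by simp [h2]) (by
      refine LinearMap.ext fun y => funext fun i => ?_
      simp [h1, Finset.sum_apply, Pi.single_apply])
  have he : ∀ y, e y = ∑ i, inc i (y i) := fun y => by
    change (∑ i, inc i ∘ₗ LinearMap.proj i) y = _
    simp
  have he' : ∀ y i, pr i (e y) = y i := fun y i =>
    congrFun (e.symm_apply_apply y) i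
  refine (h.pi hY r).of_equiv e fun j y => ?_
  rw [mem_piGrading]
  refine ⟨fun hy i => he' y i ▸ h4 i j _ hy, fun hy => ?_⟩
  rw [he]
  exact Submodule.sum_mem _ fun i _ => h3 i j _ (hy i)

end BackelinRoos

/-! ### Linear resolutions of tensor products -/

namespace BackelinRoos

open PowerSeries

section TensorLin

universe w₁ w₂

variable {k : Type u} [Field k] {A : Type v} [CommRing A] [Algebra k A]
  {B : Type w} [CommRing B] [Algebra k B] {𝒜 : ℕ → Submodule k A} {ℬ : ℕ → Submodule k B}
  [GradedAlgebra 𝒜] [GradedAlgebra ℬ]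

section Right

variable {M : Type w₁} [AddCommGroup M] [Module k M] [Module A M] [IsScalarTower k A M]
  {ℳ : ℕ → Submodule k M} [Module (A ⊗[k] B) (M ⊗[k] B)] [TensorSMul (k := k) A B M B]

theorem isLin_tensor_pi_right (hM : SMulMem 𝒜 ℳ) {r : ℕ}
    [Module (A ⊗[k] B) (M ⊗[k] (Fin r → B))] [TensorSMul (k := k) A B M (Fin r → B)]
    {n : ℕ} {β : ℤ⟦X⟧} (h : IsLin (tensorGrading 𝒜 ℬ) (tensorModuleGrading ℳ ℬ) n β) :
    IsLin (tensorGrading 𝒜 ℬ) (tensorModuleGrading ℳ (freeGrading ℬ r)) n ((r : ℤ⟦X⟧) * β) := by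
  refine IsLin.of_splitting (smulMem_tensorModuleGrading hM
    fun i j a ha b hb => SetLike.GradedMul.mul_mem ha hb)
    (fun i => tensorMap LinearMap.id (LinearMap.single B (fun _ : Fin r => B) i))
    (fun i => tensorMap LinearMap.id (LinearMap.proj i)) (fun i j y => ?_) (fun x => ?_)
    (fun i j y hy => ?_) (fun i j y hy => ?_) h
  · rw [tensorMap_apply, tensorMap_apply]
    by_cases hij : i = j
    · subst hij
      rw [Pi.single_eq_same]
      induction y using TensorProduct.induction_on with
      | zero => simp
      | add x y hx hy => rw [map_add, map_add, hx, hy]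
      | tmul m b => simp
    · rw [Pi.single_eq_of_ne hij]
      induction y using TensorProduct.induction_on with
      | zero => simp
      | add x y hx hy => rw [map_add, map_add, hx, hy, add_zero]
      | tmul m b => simp [hij]
  · simp only [tensorMap_apply]
    induction x using TensorProduct.induction_on with
    | zero => simp
    | add x y hx hy => simp only [map_add, Finset.sum_add_distrib, hx, hy]
    | tmul m v =>
      simp only [TensorProduct.map_tmul, LinearMap.coe_restrictScalars, LinearMap.id_apply,
        LinearMap.proj_apply, LinearMap.coe_single, ← TensorProduct.tmul_sum,
        Finset.univ_sum_single]
  · refine map_mem_tensorModuleGrading (s := 0) (t := 0) (fun j m hm => hm) (fun j b hb => ?_) j y hy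
    refine mem_freeGrading.mpr fun t => ?_
    by_cases hti : t = i
    · subst hti; simpa using hb
    · simp [hti]
  · exact map_mem_tensorModuleGrading (s := 0) (t := 0) (fun j m hm => hm)
      (fun j b hb => mem_freeGrading.mp hb i) j y hy

/-- The pattern is that of change of rings: tensoring `0 → ker p → Bʳ → N → 0` with `M` over the
field `k` stays exact, the middle term is a sum of copies of `M ⊗ B`, and the kernel is handled by
`ih`. -/
theorem isLin_tensor_right_succ (hM : SMulMem 𝒜 ℳ) (hM' : HasProjections ℳ) {n : ℕ} {β : ℤ⟦X⟧}
    (hβ : IsLin (tensorGrading 𝒜 ℬ) (tensorModuleGrading ℳ ℬ) (n + 1) β)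
    (ih : ∀ (r : ℕ) (K : Submodule B (Fin r → B)) (c : ℤ⟦X⟧)
      [Module (A ⊗[k] B) (M ⊗[k] K)] [TensorSMul (k := k) A B M K],
      HasProjections (syzygyGrading ℬ K) → IsLin ℬ (syzygyGrading ℬ K) n c →
      IsLin (tensorGrading 𝒜 ℬ) (tensorModuleGrading ℳ (syzygyGrading ℬ K)) n (β * c))
    {N : Type w₂} [AddCommGroup N] [Module k N] [Module B N] [IsScalarTower k B N]
    [Module (A ⊗[k] B) (M ⊗[k] N)] [TensorSMul (k := k) A B M N]
    {𝒩 : ℕ → Submodule k N} (hN : HasProjections 𝒩) {c : ℤ⟦X⟧} (h : IsLin ℬ 𝒩 (n + 1) c) :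
    IsLin (tensorGrading 𝒜 ℬ) (tensorModuleGrading ℳ 𝒩) (n + 1) (β * c) := by
  obtain ⟨r, c, p, rfl, hp, hc⟩ := isLin_succ_iff.mp h
  have : β * ((r : ℤ⟦X⟧) + X * c) = (r : ℤ⟦X⟧) * β + X * (β * c) := by ring
  rw [this]
  let _ := tensorModule (k := k) A B M (Fin r → B)
  let _ := tensorModule (k := k) A B M (LinearMap.ker p)
  have := tensorSMul (k := k) A B M (Fin r → B)
  have := tensorSMul (k := k) A B M (LinearMap.ker p)
  have hB := hasProjections_of_gradedAlgebra ℬ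
  have hK := hasProjections_syzygyGrading hB hN hp
  exact ((hp.gradedExact.lTensor hM' hK (hasProjections_freeGrading hB r)).congr
    (f' := tensorMap (A := A) (B := B) LinearMap.id (LinearMap.ker p).subtype)
    (g' := tensorMap (A := A) (B := B) LinearMap.id p) (fun x => rfl) (fun x => rfl)).isLin_right
    (isLin_tensor_pi_right hM hβ) (ih r _ c hK hc)

/-- If `M ⊗ₖ B` has a linear resolution over `A ⊗ₖ B` and `N` has one over `B`, then so does
`M ⊗ₖ N`. -/
theorem IsLin.tensor_right (hM : SMulMem 𝒜 ℳ) (hM' : HasProjections ℳ) {n : ℕ} {β : ℤ⟦X⟧}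
    (hβ : IsLin (tensorGrading 𝒜 ℬ) (tensorModuleGrading ℳ ℬ) n β)
    {N : Type w₂} [AddCommGroup N] [Module k N] [Module B N] [IsScalarTower k B N]
    [Module (A ⊗[k] B) (M ⊗[k] N)] [TensorSMul (k := k) A B M N]
    {𝒩 : ℕ → Submodule k N} (hN : HasProjections 𝒩) {c : ℤ⟦X⟧} (h : IsLin ℬ 𝒩 n c) :
    IsLin (tensorGrading 𝒜 ℬ) (tensorModuleGrading ℳ 𝒩) n (β * c) := by
  have key : ∀ n, IsLin (tensorGrading 𝒜 ℬ) (tensorModuleGrading ℳ ℬ) n β →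
      ∀ (r : ℕ) (K : Submodule B (Fin r → B)) (c : ℤ⟦X⟧)
      [Module (A ⊗[k] B) (M ⊗[k] K)] [TensorSMul (k := k) A B M K],
      HasProjections (syzygyGrading ℬ K) → IsLin ℬ (syzygyGrading ℬ K) n c →
      IsLin (tensorGrading 𝒜 ℬ) (tensorModuleGrading ℳ (syzygyGrading ℬ K)) n (β * c) := by
    intro n
    induction n with
    | zero => intros; trivial
    | succ n ih =>
      intro hβ r K c _ _ hK h
      exact isLin_tensor_right_succ hM hM' hβ (fun r K c _ _ => ih hβ.of_succ r K c) hK h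
  cases n with
  | zero => trivial
  | succ n =>
    exact isLin_tensor_right_succ hM hM' hβ (fun r K c _ _ => key n hβ.of_succ r K c) hN h

end Right

section Left

variable {N : Type w₁} [AddCommGroup N] [Module k N] [Module B N] [IsScalarTower k B N]
  {𝒩 : ℕ → Submodule k N} [Module (A ⊗[k] B) (A ⊗[k] N)] [TensorSMul (k := k) A B A N]

theorem isLin_tensor_pi_left (hN : SMulMem ℬ 𝒩) {r : ℕ}
    [Module (A ⊗[k] B) ((Fin r → A) ⊗[k] N)] [TensorSMul (k := k) A B (Fin r → A) N]
    {n : ℕ} {β : ℤ⟦X⟧} (h : IsLin (tensorGrading 𝒜 ℬ) (tensorModuleGrading 𝒜 𝒩) n β) :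
    IsLin (tensorGrading 𝒜 ℬ) (tensorModuleGrading (freeGrading 𝒜 r) 𝒩) n ((r : ℤ⟦X⟧) * β) := by
  refine IsLin.of_splitting (smulMem_tensorModuleGrading
    (fun i j a ha b hb => SetLike.GradedMul.mul_mem ha hb) hN)
    (fun i => tensorMap (LinearMap.single A (fun _ : Fin r => A) i) LinearMap.id)
    (fun i => tensorMap (LinearMap.proj i) LinearMap.id) (fun i j y => ?_) (fun x => ?_)
    (fun i j y hy => ?_) (fun i j y hy => ?_) h
  · rw [tensorMap_apply, tensorMap_apply]
    by_cases hij : i = j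
    · subst hij
      rw [Pi.single_eq_same]
      induction y using TensorProduct.induction_on with
      | zero => simp
      | add x y hx hy => rw [map_add, map_add, hx, hy]
      | tmul m b => simp
    · rw [Pi.single_eq_of_ne hij]
      induction y using TensorProduct.induction_on with
      | zero => simp
      | add x y hx hy => rw [map_add, map_add, hx, hy, add_zero]
      | tmul m b => simp [hij]
  · simp only [tensorMap_apply]
    induction x using TensorProduct.induction_on with
    | zero => simp
    | add x y hx hy => simp only [map_add, Finset.sum_add_distrib, hx, hy]
    | tmul v m =>
      simp only [TensorProduct.map_tmul, LinearMap.coe_restrictScalars, LinearMap.id_apply,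
        LinearMap.proj_apply, LinearMap.coe_single, ← TensorProduct.sum_tmul,
        Finset.univ_sum_single]
  · refine map_mem_tensorModuleGrading (s := 0) (t := 0) (fun j b hb => ?_) (fun j m hm => hm) j y hy
    refine mem_freeGrading.mpr fun t => ?_
    by_cases hti : t = i
    · subst hti; simpa using hb
    · simp [hti]
  · exact map_mem_tensorModuleGrading (s := 0) (t := 0)
      (fun j b hb => mem_freeGrading.mp hb i) (fun j m hm => hm) j y hy

theorem isLin_tensor_left_succ (hN : SMulMem ℬ 𝒩) (hN' : HasProjections 𝒩) {n : ℕ} {β : ℤ⟦X⟧}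
    (hβ : IsLin (tensorGrading 𝒜 ℬ) (tensorModuleGrading 𝒜 𝒩) (n + 1) β)
    (ih : ∀ (r : ℕ) (K : Submodule A (Fin r → A)) (c : ℤ⟦X⟧)
      [Module (A ⊗[k] B) (K ⊗[k] N)] [TensorSMul (k := k) A B K N],
      HasProjections (syzygyGrading 𝒜 K) → IsLin 𝒜 (syzygyGrading 𝒜 K) n c →
      IsLin (tensorGrading 𝒜 ℬ) (tensorModuleGrading (syzygyGrading 𝒜 K) 𝒩) n (β * c))
    {M : Type w₂} [AddCommGroup M] [Module k M] [Module A M] [IsScalarTower k A M]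
    [Module (A ⊗[k] B) (M ⊗[k] N)] [TensorSMul (k := k) A B M N]
    {ℳ : ℕ → Submodule k M} (hM : HasProjections ℳ) {c : ℤ⟦X⟧} (h : IsLin 𝒜 ℳ (n + 1) c) :
    IsLin (tensorGrading 𝒜 ℬ) (tensorModuleGrading ℳ 𝒩) (n + 1) (β * c) := by
  obtain ⟨r, c, p, rfl, hp, hc⟩ := isLin_succ_iff.mp h
  have : β * ((r : ℤ⟦X⟧) + X * c) = (r : ℤ⟦X⟧) * β + X * (β * c) := by ring
  rw [this]
  let _ := tensorModule (k := k) A B (Fin r → A) N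
  let _ := tensorModule (k := k) A B (LinearMap.ker p) N
  have := tensorSMul (k := k) A B (Fin r → A) N
  have := tensorSMul (k := k) A B (LinearMap.ker p) N
  have hA := hasProjections_of_gradedAlgebra 𝒜
  have hK := hasProjections_syzygyGrading hA hM hp
  exact ((hp.gradedExact.rTensor hN' hK (hasProjections_freeGrading hA r)).congr
    (f' := tensorMap (A := A) (B := B) (LinearMap.ker p).subtype LinearMap.id)
    (g' := tensorMap (A := A) (B := B) p LinearMap.id) (fun x => rfl) (fun x => rfl)).isLin_right
    (isLin_tensor_pi_left hN hβ) (ih r _ c hK hc)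

/-- If `A ⊗ₖ N` has a linear resolution over `A ⊗ₖ B` and `M` has one over `A`, then so does
`M ⊗ₖ N`. -/
theorem IsLin.tensor_left (hN : SMulMem ℬ 𝒩) (hN' : HasProjections 𝒩) {n : ℕ} {β : ℤ⟦X⟧}
    (hβ : IsLin (tensorGrading 𝒜 ℬ) (tensorModuleGrading 𝒜 𝒩) n β)
    {M : Type w₂} [AddCommGroup M] [Module k M] [Module A M] [IsScalarTower k A M]
    [Module (A ⊗[k] B) (M ⊗[k] N)] [TensorSMul (k := k) A B M N]
    {ℳ : ℕ → Submodule k M} (hM : HasProjections ℳ) {c : ℤ⟦X⟧} (h : IsLin 𝒜 ℳ n c) :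
    IsLin (tensorGrading 𝒜 ℬ) (tensorModuleGrading ℳ 𝒩) n (β * c) := by
  have key : ∀ n, IsLin (tensorGrading 𝒜 ℬ) (tensorModuleGrading 𝒜 𝒩) n β →
      ∀ (r : ℕ) (K : Submodule A (Fin r → A)) (c : ℤ⟦X⟧)
      [Module (A ⊗[k] B) (K ⊗[k] N)] [TensorSMul (k := k) A B K N],
      HasProjections (syzygyGrading 𝒜 K) → IsLin 𝒜 (syzygyGrading 𝒜 K) n c →
      IsLin (tensorGrading 𝒜 ℬ) (tensorModuleGrading (syzygyGrading 𝒜 K) 𝒩) n (β * c) := by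
    intro n
    induction n with
    | zero => intros; trivial
    | succ n ih =>
      intro hβ r K c _ _ hK h
      exact isLin_tensor_left_succ hN hN' hβ (fun r K c _ _ => ih hβ.of_succ r K c) hK h
  cases n with
  | zero => trivial
  | succ n =>
    exact isLin_tensor_left_succ hN hN' hβ (fun r K c _ _ => key n hβ.of_succ r K c) hM h

end Left

/-- The tensor product of modules with linear resolutions has a linear resolution. -/
theorem IsLin.tensor {M : Type w₁} [AddCommGroup M] [Module k M] [Module A M] [IsScalarTower k A M]
    {ℳ : ℕ → Submodule k M} (hM : HasProjections ℳ)
    {N : Type w₂} [AddCommGroup N] [Module k N] [Module B N] [IsScalarTower k B N]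
    {𝒩 : ℕ → Submodule k N} (hN : SMulMem ℬ 𝒩) (hN' : HasProjections 𝒩)
    [Module (A ⊗[k] B) (M ⊗[k] N)] [TensorSMul (k := k) A B M N] {n : ℕ} {b c : ℤ⟦X⟧}
    (hb : IsLin 𝒜 ℳ n b) (hc : IsLin ℬ 𝒩 n c) :
    IsLin (tensorGrading 𝒜 ℬ) (tensorModuleGrading ℳ 𝒩) n (b * c) := by
  let _ := tensorModule (k := k) A B A N
  have := tensorSMul (k := k) A B A N
  -- The factors are replaced one at a time: from `A ⊗ B`, free of rank one over itself, to `A ⊗ N`,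
  -- then to `M ⊗ N`.
  have h1 : IsLin (tensorGrading 𝒜 ℬ) (tensorModuleGrading 𝒜 ℬ) n 1 :=
    isLin_self (𝒜 := tensorGrading 𝒜 ℬ) n
  have h2 : IsLin (tensorGrading 𝒜 ℬ) (tensorModuleGrading 𝒜 𝒩) n (1 * c) :=
    h1.tensor_right (fun i j a ha b hb => SetLike.GradedMul.mul_mem ha hb)
      (hasProjections_of_gradedAlgebra 𝒜) hN' hc
  rw [one_mul] at h2
  rw [mul_comm]
  exact h2.tensor_left hN hN' hM hb

end TensorLin

end BackelinRoos

/-! ### The residue field and the augmentation ideal -/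

namespace BackelinRoos

open PowerSeries

section IdealGrading

variable {k : Type u} [Field k] {A : Type v} [CommRing A] [Algebra k A] (𝒜 : ℕ → Submodule k A)

/-- The grading of an ideal, shifted so that degree `s` becomes degree zero. -/
def idealGrading (I : Ideal A) (s : ℕ) : ℕ → Submodule k I :=
  fun j => (𝒜 (j + s)).comap (I.subtype.restrictScalars k)

variable {𝒜}

theorem mem_idealGrading {I : Ideal A} {s j : ℕ} {x : I} :
    x ∈ idealGrading 𝒜 I s j ↔ x.1 ∈ 𝒜 (j + s) := Iff.rfl

theorem smulMem_self [SetLike.GradedMul 𝒜] : SMulMem 𝒜 𝒜 :=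
  fun _ _ _ ha _ hm => SetLike.GradedMul.mul_mem ha hm

theorem smulMem_idealGrading [SetLike.GradedMul 𝒜] (I : Ideal A) (s : ℕ) :
    SMulMem 𝒜 (idealGrading 𝒜 I s) := by
  intro i j a ha m hm
  rw [mem_idealGrading] at *
  rw [add_assoc]
  exact SetLike.GradedMul.mul_mem ha hm

theorem algebraMap_mem_zero [SetLike.GradedOne 𝒜] (c : k) : algebraMap k A c ∈ 𝒜 0 := by
  rw [Algebra.algebraMap_eq_smul_one]
  exact Submodule.smul_mem _ _ SetLike.GradedOne.one_mem

end IdealGrading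

section Residue

variable {k : Type u} [Field k]

theorem hasProjections_fieldGrading : HasProjections (fieldGrading k) := by
  refine ⟨fun m => Submodule.mem_iSup_of_mem 0 (by simp [fieldGrading]),
    fun j => if j = 0 then LinearMap.id else 0, fun i j m hm => ?_⟩
  by_cases hi : i = 0
  · subst hi
    by_cases hj : j = 0
    · simp [hj]
    · simp [hj, Ne.symm hj]
  · have : m = 0 := by simpa [fieldGrading, hi] using hm
    subst this
    simp

theorem mem_fieldGrading_zero (x : k) : x ∈ fieldGrading k 0 := by simp [fieldGrading]

theorem eq_zero_of_mem_fieldGrading {j : ℕ} (hj : j ≠ 0) {x : k} (hx : x ∈ fieldGrading k j) :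
    x = 0 := by simpa [fieldGrading, hj] using hx

variable {A : Type v} [CommRing A] [Algebra k A] (𝒜 : ℕ → Submodule k A) [GradedAlgebra 𝒜]
  [IsStandardGraded 𝒜]

/-- The field `k` as an `A`-module via the augmentation. -/
noncomputable abbrev residueModule : Module A k :=
  Module.compHom k (augmentation 𝒜).toRingHom

theorem isScalarTower_residueModule :
    letI := residueModule 𝒜
    IsScalarTower k A k := by
  let _ := residueModule 𝒜
  refine ⟨fun x a y => ?_⟩
  change augmentation 𝒜 (x • a) * y = x * (augmentation 𝒜 a * y)
  rw [map_smul, smul_eq_mul, mul_assoc]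

theorem augmentation_mem_fieldGrading {j : ℕ} {a : A} (ha : a ∈ 𝒜 j) :
    augmentation 𝒜 a ∈ fieldGrading k j := by
  by_cases hj : j = 0
  · subst hj; exact mem_fieldGrading_zero _
  · rw [augmentation_of_mem 𝒜 hj ha]; exact Submodule.zero_mem _

theorem smulMem_fieldGrading :
    letI := residueModule 𝒜
    SMulMem 𝒜 (fieldGrading k) := by
  let _ := residueModule 𝒜
  intro i j a ha m hm
  change augmentation 𝒜 a * m ∈ _
  by_cases hi : i = 0
  · subst hi
    rw [zero_add]
    exact Submodule.smul_mem _ _ hm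
  · rw [augmentation_of_mem 𝒜 hi ha, zero_mul]; exact Submodule.zero_mem _

/-- The residue field `k` has a linear resolution over `A` up to step `n`. -/
def IsLinResidue (n : ℕ) (b : ℤ⟦X⟧) : Prop :=
  letI := residueModule 𝒜
  IsLin 𝒜 (fieldGrading k) n b

/-- The irrelevant ideal as the kernel of the augmentation. -/
noncomputable def augIdeal : Ideal A := RingHom.ker (augmentation 𝒜)

variable {𝒜}

theorem mem_augIdeal {a : A} : a ∈ augIdeal 𝒜 ↔ augmentation 𝒜 a = 0 := Iff.rfl

theorem mem_augIdeal_of_mem {j : ℕ} {a : A} (ha : a ∈ 𝒜 (j + 1)) : a ∈ augIdeal 𝒜 :=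
  augmentation_of_mem 𝒜 j.succ_ne_zero ha

theorem eq_algebraMap_augmentation {a : A} (ha : a ∈ 𝒜 0) :
    a = algebraMap k A (augmentation 𝒜 a) := by
  rw [algebraMap_augmentation, GradedRing.proj_apply, DirectSum.decompose_of_mem_same 𝒜 ha]

theorem gradedExact_augIdeal :
    GradedExact (A := k) 1 (idealGrading 𝒜 (augIdeal 𝒜) 1) 𝒜 (fieldGrading k)
      ((augIdeal 𝒜).subtype.restrictScalars k) (augmentation 𝒜).toLinearMap := by
  refine ⟨Subtype.val_injective, fun v => ⟨fun hv => ⟨⟨v, hv⟩, rfl⟩, ?_⟩, fun j m => Iff.rfl,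
    fun j hj m hm hm' => ?_, fun j m hm => augmentation_mem_fieldGrading 𝒜 hm, fun j m hm => ?_⟩
  · rintro ⟨x, rfl⟩; exact x.2
  · obtain rfl : j = 0 := by omega
    exact eq_zero_of_augmentation_eq_zero hm hm'
  · by_cases hj : j = 0
    · subst hj
      exact ⟨algebraMap k A m, algebraMap_mem_zero m, (augmentation 𝒜).commutes m⟩
    · rw [eq_zero_of_mem_fieldGrading hj hm]
      exact ⟨0, Submodule.zero_mem _, map_zero _⟩

theorem hasProjections_augIdeal : HasProjections (idealGrading 𝒜 (augIdeal 𝒜) 1) :=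
  (hasProjections_of_gradedAlgebra 𝒜).of_exact hasProjections_fieldGrading
    gradedExact_augIdeal.injective gradedExact_augIdeal.exact gradedExact_augIdeal.map_mem
    gradedExact_augIdeal.eq_zero fun _ _ => Iff.rfl

/-- The first syzygy of the residue field is the irrelevant ideal. -/
theorem IsLinResidue.exists_isLin_augIdeal {b : ℤ⟦X⟧} (h : ∀ n, IsLinResidue 𝒜 n b) :
    ∃ a : ℤ⟦X⟧, b = 1 + X * a ∧ ∀ n, IsLin 𝒜 (idealGrading 𝒜 (augIdeal 𝒜) 1) n a := by
  have : Nontrivial A := IsStandardGraded.nontrivial (𝒜 := 𝒜)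
  let _ := residueModule 𝒜
  have := isScalarTower_residueModule 𝒜
  let ε : A →ₗ[A] k :=
    { toFun := augmentation 𝒜
      map_add' := map_add _
      map_smul' := fun a x => map_mul (augmentation 𝒜) a x }
  let p : (Fin 1 → A) →ₗ[A] k := ε ∘ₗ LinearMap.proj 0
  have hp : IsCover 𝒜 (fieldGrading k) p := by
    refine ⟨fun j v hv => augmentation_mem_fieldGrading 𝒜 (mem_freeGrading.mp hv 0),
      fun j m hm => ?_, fun v hv hv' => funext fun i => ?_⟩
    · obtain ⟨a, ha, ha'⟩ := gradedExact_augIdeal (𝒜 := 𝒜).exists_lift j m hm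
      exact ⟨fun _ => a, mem_freeGrading.mpr fun _ => ha, ha'⟩
    · rw [Subsingleton.elim i 0]
      exact eq_zero_of_augmentation_eq_zero (mem_freeGrading.mp hv 0) hv'
  let e : LinearMap.ker p ≃ₗ[A] augIdeal 𝒜 :=
    { toFun := fun v => ⟨v.1 0, v.2⟩
      map_add' := fun _ _ => rfl
      map_smul' := fun _ _ => rfl
      invFun := fun x => ⟨fun _ => x.1, x.2⟩
      left_inv := fun v => Subtype.ext (funext fun i => by rw [Subsingleton.elim i 0])
      right_inv := fun x => rfl }
  choose c hc hc' using fun n => IsLin.of_isCover (h (n + 1)) hp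
  refine ⟨c 0, by simpa using hc 0, fun n => ?_⟩
  have : X * c n = X * c 0 := add_left_cancel ((hc n).symm.trans (hc 0))
  rw [← mul_left_cancel₀ X_ne_zero this]
  refine (hc' n).of_equiv e fun j v => ?_
  rw [mem_idealGrading, mem_syzygyGrading]
  exact ⟨fun hv i => by rwa [Subsingleton.elim i 0], fun hv => hv 0⟩

theorem IsLinResidue.restrictScalars {C : Type w} [CommRing C] [Algebra k C]
    {𝒞 : ℕ → Submodule k C} [GradedAlgebra 𝒞] [IsStandardGraded 𝒞] [Algebra C A]
    (hCA : SMulMem 𝒞 𝒜)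
    (haug : ∀ c, augmentation 𝒜 (algebraMap C A c) = augmentation 𝒞 c) {n : ℕ} {b β : ℤ⟦X⟧}
    (h : IsLinResidue 𝒜 n b) (hβ : IsLin 𝒞 𝒜 n β) : IsLinResidue 𝒞 n (β * b) := by
  let _ := residueModule 𝒜
  let _ := residueModule 𝒞
  have : IsScalarTower C A k := by
    refine ⟨fun c a x => ?_⟩
    change augmentation 𝒜 (c • a) * x = augmentation 𝒞 c * (augmentation 𝒜 a * x)
    rw [Algebra.smul_def, map_mul, haug, mul_assoc]
  exact IsLin.restrictScalars hCA h hβ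

end Residue

section Prod

universe w₁ w₂

variable {k : Type u} [Field k] {A : Type v} [CommRing A] [Algebra k A] {𝒜 : ℕ → Submodule k A}
  [SetLike.GradedMonoid 𝒜] {M : Type w₁} [AddCommGroup M] [Module k M] [Module A M]
  {N : Type w₂} [AddCommGroup N] [Module k N] [Module A N]
  {ℳ : ℕ → Submodule k M} {𝒩 : ℕ → Submodule k N}

theorem IsLin.prod (hM : SMulMem 𝒜 ℳ) (hN : SMulMem 𝒜 𝒩) {n : ℕ} {b c : ℤ⟦X⟧}
    (hb : IsLin 𝒜 ℳ n b) (hc : IsLin 𝒜 𝒩 n c) :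
    IsLin 𝒜 (fun j => (ℳ j).prod (𝒩 j)) n (b + c) := by
  refine GradedExact.isLin_middle (ℳ := fun j => (ℳ j).prod (𝒩 j)) (ℳ' := ℳ) (ℳ'' := 𝒩)
    (f := LinearMap.inl A M N) (g := LinearMap.snd A M N)
    ⟨LinearMap.inl_injective, Function.Exact.inl_snd, fun j m => ?_,
      fun j hj => absurd hj (Nat.not_lt_zero j), fun j m hm => hm.2,
      fun j m hm => ⟨(0, m), ⟨Submodule.zero_mem _, hm⟩, rfl⟩⟩ ?_ hb hc
  · exact ⟨fun h => h.1, fun h => ⟨h, Submodule.zero_mem _⟩⟩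
  · exact fun i j a ha m hm => ⟨hM i j a ha _ hm.1, hN i j a ha _ hm.2⟩

end Prod

end BackelinRoos

/-! ### The algebra `A ⊗ₖ B`, its two augmentations, and kernels of maps to fibre products -/

namespace BackelinRoos

open PowerSeries

section TensorAug

variable {k : Type u} [Field k] {A : Type v} [CommRing A] [Algebra k A]

/-- Since `A₀ = k`, an algebra map to `k` is determined by vanishing in positive degrees. This makes
the augmentations compatible with every graded morphism used below. -/
theorem eq_augmentation (𝒜 : ℕ → Submodule k A) [GradedAlgebra 𝒜] [IsStandardGraded 𝒜]
    (f : A →ₐ[k] k) (hf : ∀ n ≠ 0, ∀ a ∈ 𝒜 n, f a = 0) (a : A) : f a = augmentation 𝒜 a := by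
  refine (hasProjections_of_gradedAlgebra 𝒜).induction
    (P := LinearMap.eqLocus f.toLinearMap (augmentation 𝒜).toLinearMap) (fun j a ha => ?_) a
  rw [LinearMap.mem_eqLocus, AlgHom.toLinearMap_apply, AlgHom.toLinearMap_apply]
  by_cases hj : j = 0
  · subst hj
    conv_lhs => rw [eq_algebraMap_augmentation ha, AlgHom.commutes]
    rfl
  · rw [hf j hj a ha, augmentation_of_mem 𝒜 hj ha]

variable {B : Type w} [CommRing B] [Algebra k B]
  (𝒜 : ℕ → Submodule k A) [GradedAlgebra 𝒜] [IsStandardGraded 𝒜]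
  (ℬ : ℕ → Submodule k B) [GradedAlgebra ℬ] [IsStandardGraded ℬ]

variable (A) in
/-- The morphism `A ⊗ₖ B → A` induced by the augmentation of `B`. -/
noncomputable def augRight : A ⊗[k] B →ₐ[k] A :=
  Algebra.TensorProduct.lift (AlgHom.id k A) ((Algebra.ofId k A).comp (augmentation ℬ))
    fun _ _ => Commute.all _ _

variable (B) in
/-- The morphism `A ⊗ₖ B → B` induced by the augmentation of `A`. -/
noncomputable def augLeft : A ⊗[k] B →ₐ[k] B :=
  Algebra.TensorProduct.lift ((Algebra.ofId k B).comp (augmentation 𝒜)) (AlgHom.id k B)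
    fun _ _ => Commute.all _ _

theorem augRight_tmul (a : A) (b : B) :
    augRight A ℬ (a ⊗ₜ b) = a * algebraMap k A (augmentation ℬ b) := rfl

theorem augLeft_tmul (a : A) (b : B) :
    augLeft B 𝒜 (a ⊗ₜ b) = algebraMap k B (augmentation 𝒜 a) * b := rfl

variable {𝒜 ℬ}

theorem augRight_mem {j : ℕ} {x : A ⊗[k] B} (hx : x ∈ tensorGrading 𝒜 ℬ j) :
    augRight A ℬ x ∈ 𝒜 j := by
  have : tensorGrading 𝒜 ℬ j ≤ (𝒜 j).comap (augRight A ℬ).toLinearMap := by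
    refine tensorGrading_le _ _ fun i l hil a ha b hb => ?_
    rw [Submodule.mem_comap, AlgHom.toLinearMap_apply, augRight_tmul]
    by_cases hl : l = 0
    · rw [mul_comm, ← Algebra.smul_def, ← hil, hl]
      exact Submodule.smul_mem _ _ ha
    · rw [augmentation_of_mem ℬ hl hb, map_zero, mul_zero]
      exact Submodule.zero_mem _
  exact this hx

theorem augLeft_mem {j : ℕ} {x : A ⊗[k] B} (hx : x ∈ tensorGrading 𝒜 ℬ j) :
    augLeft B 𝒜 x ∈ ℬ j := by
  have : tensorGrading 𝒜 ℬ j ≤ (ℬ j).comap (augLeft B 𝒜).toLinearMap := by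
    refine tensorGrading_le _ _ fun i l hil a ha b hb => ?_
    rw [Submodule.mem_comap, AlgHom.toLinearMap_apply, augLeft_tmul]
    by_cases hi : i = 0
    · rw [← Algebra.smul_def, ← hil, hi, zero_add]
      exact Submodule.smul_mem _ _ hb
    · rw [augmentation_of_mem 𝒜 hi ha, map_zero, zero_mul]
      exact Submodule.zero_mem _
  exact this hx

theorem augmentation_augRight (x : A ⊗[k] B) :
    augmentation 𝒜 (augRight A ℬ x) = augmentation (tensorGrading 𝒜 ℬ) x :=
  eq_augmentation (tensorGrading 𝒜 ℬ) ((augmentation 𝒜).comp (augRight A ℬ))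
    (fun _ hn _ hx => augmentation_of_mem 𝒜 hn (augRight_mem hx)) x

theorem augmentation_augLeft (x : A ⊗[k] B) :
    augmentation ℬ (augLeft B 𝒜 x) = augmentation (tensorGrading 𝒜 ℬ) x :=
  eq_augmentation (tensorGrading 𝒜 ℬ) ((augmentation ℬ).comp (augLeft B 𝒜))
    (fun _ hn _ hx => augmentation_of_mem ℬ hn (augLeft_mem hx)) x

theorem smulMem_augRight :
    letI := (augRight A ℬ).toAlgebra
    SMulMem (tensorGrading 𝒜 ℬ) 𝒜 := by
  let _ := (augRight A ℬ).toAlgebra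
  intro i j c hc a ha
  rw [Algebra.smul_def]
  exact SetLike.GradedMul.mul_mem (augRight_mem hc) ha

theorem smulMem_augLeft :
    letI := (augLeft B 𝒜).toAlgebra
    SMulMem (tensorGrading 𝒜 ℬ) ℬ := by
  let _ := (augLeft B 𝒜).toAlgebra
  intro i j c hc a ha
  rw [Algebra.smul_def]
  exact SetLike.GradedMul.mul_mem (augLeft_mem hc) ha

/-- As an `A ⊗ B`-module through `augRight`, `A` is `A ⊗ₖ k`, so its series is `1` times the series
of `k` over `B`. -/
theorem isLin_augRight {n : ℕ} {b : ℤ⟦X⟧} (h : IsLinResidue ℬ n b) :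
    letI := (augRight A ℬ).toAlgebra
    IsLin (tensorGrading 𝒜 ℬ) 𝒜 n b := by
  let _ := (augRight A ℬ).toAlgebra
  let _ := residueModule ℬ
  have := isScalarTower_residueModule ℬ
  let _ := tensorModule (k := k) A B A k
  have := tensorSMul (k := k) A B A k
  have h1 : IsLin (tensorGrading 𝒜 ℬ) (tensorModuleGrading 𝒜 (fieldGrading k)) n (1 * b) :=
    (isLin_self n).tensor (hasProjections_of_gradedAlgebra 𝒜) (smulMem_fieldGrading ℬ)
      hasProjections_fieldGrading h
  rw [one_mul] at h1
  have hsmul := map_smul_of_tmul (A := A) (B := B) (TensorProduct.rid k A).toLinearMap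
    fun a b m x => by
      change (augmentation ℬ b * x) • (a * m) = augRight A ℬ (a ⊗ₜ b) * (x • m)
      rw [augRight_tmul, Algebra.smul_def, Algebra.smul_def, map_mul]
      ring
  let e : A ⊗[k] k ≃ₗ[A ⊗[k] B] A := { TensorProduct.rid k A with map_smul' := hsmul }
  refine h1.of_equiv e fun j x => ?_
  constructor
  · intro hx
    have h2 : x = (e x) ⊗ₜ[k] (1 : k) := ((TensorProduct.rid k A).symm_apply_apply x).symm
    rw [h2]
    exact tmul_mem_tensorModuleGrading (j := 0) hx (mem_fieldGrading_zero 1)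
  · intro hx
    have : tensorModuleGrading 𝒜 (fieldGrading k) j ≤
        (𝒜 j).comap (TensorProduct.rid k A).toLinearMap := by
      refine tensorModuleGrading_le fun i l hil a ha x hx => ?_
      rw [Submodule.mem_comap]
      change x • a ∈ 𝒜 j
      by_cases hl : l = 0
      · rw [← hil, hl]; exact Submodule.smul_mem _ _ ha
      · rw [eq_zero_of_mem_fieldGrading hl hx, zero_smul]; exact Submodule.zero_mem _
    exact this hx

theorem isLin_augLeft {n : ℕ} {b : ℤ⟦X⟧} (h : IsLinResidue 𝒜 n b) :
    letI := (augLeft B 𝒜).toAlgebra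
    IsLin (tensorGrading 𝒜 ℬ) ℬ n b := by
  let _ := (augLeft B 𝒜).toAlgebra
  let _ := residueModule 𝒜
  have := isScalarTower_residueModule 𝒜
  let _ := tensorModule (k := k) A B k B
  have := tensorSMul (k := k) A B k B
  have h1 : IsLin (tensorGrading 𝒜 ℬ) (tensorModuleGrading (fieldGrading k) ℬ) n (b * 1) :=
    IsLin.tensor hasProjections_fieldGrading smulMem_self (hasProjections_of_gradedAlgebra ℬ) h
      (isLin_self n)
  rw [mul_one] at h1
  have hsmul := map_smul_of_tmul (A := A) (B := B) (TensorProduct.lid k B).toLinearMap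
    fun a b x m => by
      change (augmentation 𝒜 a * x) • (b * m) = augLeft B 𝒜 (a ⊗ₜ b) * (x • m)
      rw [augLeft_tmul, Algebra.smul_def, Algebra.smul_def, map_mul]
      ring
  let e : k ⊗[k] B ≃ₗ[A ⊗[k] B] B := { TensorProduct.lid k B with map_smul' := hsmul }
  refine h1.of_equiv e fun j x => ?_
  constructor
  · intro hx
    have h2 : x = (1 : k) ⊗ₜ[k] (e x) := ((TensorProduct.lid k B).symm_apply_apply x).symm
    rw [h2, ← zero_add j]
    exact tmul_mem_tensorModuleGrading (mem_fieldGrading_zero 1) hx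
  · intro hx
    have : tensorModuleGrading (fieldGrading k) ℬ j ≤
        (ℬ j).comap (TensorProduct.lid k B).toLinearMap := by
      refine tensorModuleGrading_le fun i l hil x hx a ha => ?_
      rw [Submodule.mem_comap]
      change x • a ∈ ℬ j
      by_cases hi : i = 0
      · rw [← hil, hi, zero_add]; exact Submodule.smul_mem _ _ ha
      · rw [eq_zero_of_mem_fieldGrading hi hx, zero_smul]; exact Submodule.zero_mem _
    exact this hx

theorem IsLinResidue.tensor {n : ℕ} {b c : ℤ⟦X⟧} (hb : IsLinResidue 𝒜 n b)
    (hc : IsLinResidue ℬ n c) : IsLinResidue (tensorGrading 𝒜 ℬ) n (b * c) := by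
  let _ := (augRight A ℬ).toAlgebra
  rw [mul_comm]
  exact hb.restrictScalars smulMem_augRight augmentation_augRight (isLin_augRight hc)

variable (𝒜) in
/-- The projection onto the irrelevant ideal. -/
noncomputable def toAugIdeal : A →ₗ[k] augIdeal 𝒜 :=
  (LinearMap.id - (Algebra.linearMap k A) ∘ₗ (augmentation 𝒜).toLinearMap).codRestrict
    ((augIdeal 𝒜).restrictScalars k) fun a => by
      change augmentation 𝒜 (a - algebraMap k A (augmentation 𝒜 a)) = 0
      rw [map_sub, AlgHom.commutes]
      exact sub_self _

theorem coe_toAugIdeal (a : A) :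
    (toAugIdeal 𝒜 a : A) = a - algebraMap k A (augmentation 𝒜 a) := rfl

theorem toAugIdeal_coe (a : augIdeal 𝒜) : toAugIdeal 𝒜 a = a := by
  refine Subtype.ext ?_
  rw [coe_toAugIdeal, mem_augIdeal.mp a.2, map_zero, sub_zero]

theorem toAugIdeal_of_mem_zero {a : A} (ha : a ∈ 𝒜 0) : toAugIdeal 𝒜 a = 0 := by
  refine Subtype.ext ?_
  rw [coe_toAugIdeal, ← eq_algebraMap_augmentation ha, sub_self]; rfl

theorem toAugIdeal_mem {j : ℕ} {a : A} (ha : a ∈ 𝒜 (j + 1)) :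
    toAugIdeal 𝒜 a ∈ idealGrading 𝒜 (augIdeal 𝒜) 1 j := by
  have h := toAugIdeal_coe (⟨a, mem_augIdeal_of_mem ha⟩ : augIdeal 𝒜)
  rw [h]
  exact ha

/-- On pure tensors this expands `(a - ε(a)) ⊗ (b - ε(b))`. It shows that an element killed by both
augmentations lies in `A₊ ⊗ B₊`. -/
theorem map_toAugIdeal (x : A ⊗[k] B) :
    TensorProduct.map ((augIdeal 𝒜).subtype.restrictScalars k)
      ((augIdeal ℬ).subtype.restrictScalars k)
        (TensorProduct.map (toAugIdeal 𝒜) (toAugIdeal ℬ) x) =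
      x - augRight A ℬ x ⊗ₜ 1 - 1 ⊗ₜ augLeft B 𝒜 x +
        algebraMap k _ (augmentation 𝒜 (augRight A ℬ x)) := by
  induction x using TensorProduct.induction_on with
  | zero => simp
  | add x y hx hy =>
    simp only [map_add, hx, hy, TensorProduct.add_tmul, TensorProduct.tmul_add]
    ring
  | tmul x y =>
    rw [TensorProduct.map_tmul, TensorProduct.map_tmul, LinearMap.coe_restrictScalars,
      LinearMap.coe_restrictScalars, Submodule.subtype_apply, Submodule.subtype_apply, coe_toAugIdeal, coe_toAugIdeal, augRight_tmul, augLeft_tmul,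
      map_mul, AlgHom.commutes, Algebra.algebraMap_eq_smul_one (A := A),
      Algebra.algebraMap_eq_smul_one (A := B), Algebra.algebraMap_eq_smul_one (A := A),
      Algebra.algebraMap_eq_smul_one (A := B), Algebra.algebraMap_eq_smul_one (A := A ⊗[k] B),
      TensorProduct.tmul_sub, TensorProduct.sub_tmul, TensorProduct.sub_tmul,
      TensorProduct.smul_tmul_smul, TensorProduct.tmul_smul, smul_mul_assoc, one_mul,
      TensorProduct.tmul_smul, mul_smul_comm, mul_one, TensorProduct.smul_tmul']
    rw [Algebra.TensorProduct.one_def, Algebra.algebraMap_self_apply, ← TensorProduct.smul_tmul']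
    abel

/-- The kernel of the morphism from `A ⊗ₖ B` to the fibre product of quotients of `A` and `B`. -/
theorem isLin_fibreIdeal {I : Ideal A} {J : Ideal B} {L : Ideal (A ⊗[k] B)}
    (hL : ∀ x, x ∈ L ↔ augRight A ℬ x ∈ I ∧ augLeft B 𝒜 x ∈ J) {n : ℕ} {a b G G' h h' : ℤ⟦X⟧}
    (ha : IsLin 𝒜 (idealGrading 𝒜 (augIdeal 𝒜) 1) n a)
    (hb : IsLin ℬ (idealGrading ℬ (augIdeal ℬ) 1) n b)
    (hG : IsLinResidue 𝒜 n G) (hG' : IsLinResidue ℬ n G')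
    (hI : IsLin 𝒜 (idealGrading 𝒜 I 2) n h) (hJ : IsLin ℬ (idealGrading ℬ J 2) n h') :
    IsLin (tensorGrading 𝒜 ℬ) (idealGrading (tensorGrading 𝒜 ℬ) L 2) n
      (a * b + (G' * h + G * h')) := by
  let _ := (augRight A ℬ).toAlgebra
  let _ := (augLeft B 𝒜).toAlgebra
  let _ := tensorModule (k := k) A B (augIdeal 𝒜) (augIdeal ℬ)
  have := tensorSMul (k := k) A B (augIdeal 𝒜) (augIdeal ℬ)
  have h1 := ha.tensor (hasProjections_augIdeal (𝒜 := 𝒜)) (smulMem_idealGrading (𝒜 := ℬ) _ _)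
    hasProjections_augIdeal hb
  -- `I` is an `A ⊗ B`-module through `augRight`, and `A` has series `G'` over `A ⊗ B`, so change of
  -- rings multiplies `h` by `G'`; `J` is symmetric.
  have hI' : IsLin (tensorGrading 𝒜 ℬ) (idealGrading 𝒜 I 2) n (G' * h) :=
    hI.restrictScalars smulMem_augRight (isLin_augRight hG')
  have hJ' : IsLin (tensorGrading 𝒜 ℬ) (idealGrading ℬ J 2) n (G * h') :=
    hJ.restrictScalars smulMem_augLeft (isLin_augLeft hG)
  have hIJ := hI'.prod (fun i j c hc x hx => ?_) (fun i j c hc x hx => ?_) hJ'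
  rotate_left
  · have := smulMem_augRight (𝒜 := 𝒜) (ℬ := ℬ) i (j + 2) c hc x.1 hx
    rwa [← add_assoc] at this
  · have := smulMem_augLeft (𝒜 := 𝒜) (ℬ := ℬ) i (j + 2) c hc x.1 hx
    rwa [← add_assoc] at this
  let ι : augIdeal 𝒜 ⊗[k] augIdeal ℬ →ₗ[A ⊗[k] B] A ⊗[k] B :=
    tensorMap (augIdeal 𝒜).subtype (augIdeal ℬ).subtype
  have hι : ∀ x y, ι (x ⊗ₜ y) = x.1 ⊗ₜ[k] y.1 := fun x y => rfl
  have hι_right : ∀ y, augRight A ℬ (ι y) = 0 := fun y => by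
    induction y using TensorProduct.induction_on with
    | zero => simp
    | add x y hx hy => rw [map_add, map_add, hx, hy, add_zero]
    | tmul x y => rw [hι, augRight_tmul, mem_augIdeal.mp y.2, map_zero, mul_zero]
  have hι_left : ∀ y, augLeft B 𝒜 (ι y) = 0 := fun y => by
    induction y using TensorProduct.induction_on with
    | zero => simp
    | add x y hx hy => rw [map_add, map_add, hx, hy, add_zero]
    | tmul x y => rw [hι, augLeft_tmul, mem_augIdeal.mp x.2, map_zero, zero_mul]
  let r : A ⊗[k] B →ₗ[k] augIdeal 𝒜 ⊗[k] augIdeal ℬ :=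
    TensorProduct.map (toAugIdeal 𝒜) (toAugIdeal ℬ)
  have hr : ∀ y, r (ι y) = y := fun y => by
    induction y using TensorProduct.induction_on with
    | zero => simp
    | add x y hx hy => rw [map_add, map_add, hx, hy]
    | tmul x y => rw [hι, TensorProduct.map_tmul, toAugIdeal_coe, toAugIdeal_coe]
  have hιr : ∀ x, ι (r x) = x - augRight A ℬ x ⊗ₜ 1 - 1 ⊗ₜ augLeft B 𝒜 x +
      algebraMap k _ (augmentation 𝒜 (augRight A ℬ x)) := map_toAugIdeal
  -- The retraction kills all bidegrees with a zero entry; the others start at `(1, 1)`, which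
  -- matches the shift by two on `L` with the shifts by one on the two augmentation ideals.
  have hr_mem : ∀ j, ∀ x ∈ tensorGrading 𝒜 ℬ (j + 2), r x ∈ tensorModuleGrading
      (idealGrading 𝒜 (augIdeal 𝒜) 1) (idealGrading ℬ (augIdeal ℬ) 1) j := by
    intro j
    refine tensorGrading_le _ _ (P := (tensorModuleGrading _ _ j).comap r) fun i l hil x hx y hy => ?_
    rw [Submodule.mem_comap, TensorProduct.map_tmul]
    rcases i with _ | i
    · rw [toAugIdeal_of_mem_zero hx, TensorProduct.zero_tmul]; exact Submodule.zero_mem _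
    rcases l with _ | l
    · rw [toAugIdeal_of_mem_zero hy, TensorProduct.tmul_zero]; exact Submodule.zero_mem _
    obtain rfl : i + l = j := by omega
    exact tmul_mem_tensorModuleGrading (toAugIdeal_mem hx) (toAugIdeal_mem hy)
  let f : augIdeal 𝒜 ⊗[k] augIdeal ℬ →ₗ[A ⊗[k] B] L := ι.codRestrict L fun y => by
    rw [hL, hι_left, hι_right]; exact ⟨I.zero_mem, J.zero_mem⟩
  let g : L →ₗ[A ⊗[k] B] I × J :=
    { toFun := fun x => (⟨augRight A ℬ x.1, ((hL _).mp x.2).1⟩, ⟨augLeft B 𝒜 x.1, ((hL _).mp x.2).2⟩)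
      map_add' := fun x y => Prod.ext (Subtype.ext (map_add (augRight A ℬ) x.1 y.1))
        (Subtype.ext (map_add (augLeft B 𝒜) x.1 y.1))
      map_smul' := fun c x => Prod.ext (Subtype.ext (map_mul (augRight A ℬ) c x.1))
        (Subtype.ext (map_mul (augLeft B 𝒜) c x.1)) }
  refine GradedExact.isLin_middle
    (ℳ'' := fun j => (idealGrading 𝒜 I 2 j).prod (idealGrading ℬ J 2 j)) (f := f) (g := g) ⟨fun x y hxy => ?_, fun x => ?_, fun j y => ?_,
    fun j hj => absurd hj (Nat.not_lt_zero j), fun j x hx => ⟨augRight_mem hx, augLeft_mem hx⟩,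
    fun j x hx => ?_⟩ (smulMem_idealGrading _ _) h1 hIJ
  · rw [← hr x, ← hr y]
    exact congrArg (fun z => r z.1) hxy
  · constructor
    · intro hx
      have hx1 : augRight A ℬ x.1 = 0 := congrArg (fun z => z.1.1) hx
      have hx2 : augLeft B 𝒜 x.1 = 0 := congrArg (fun z => z.2.1) hx
      refine ⟨r x.1, Subtype.ext ((hιr x.1).trans ?_)⟩
      rw [hx1, hx2]
      simp
    · rintro ⟨y, rfl⟩
      exact Prod.ext (Subtype.ext (hι_right y)) (Subtype.ext (hι_left y))
  · constructor
    · intro hy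
      rw [← hr y]
      exact hr_mem j _ hy
    · intro hy
      exact map_mem_tensorModuleGrading (s := 1) (t := 1) (f := (augIdeal 𝒜).subtype.restrictScalars k)
        (g := (augIdeal ℬ).subtype.restrictScalars k) (fun _ _ hm => hm) (fun _ _ hm => hm) j y hy
  · obtain ⟨hx, hy⟩ : x.1.1 ∈ 𝒜 (j + 2) ∧ x.2.1 ∈ ℬ (j + 2) := hx
    obtain ⟨⟨x, hxI⟩, ⟨y, hyJ⟩⟩ := x
    dsimp only at hx hy
    -- `x ⊗ 1 + 1 ⊗ y` lifts `(x, y)`: both elements have positive degree, so each augmentation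
    -- kills the other summand.
    have h1 : augRight A ℬ (x ⊗ₜ 1 + 1 ⊗ₜ y) = x := by
      rw [map_add, augRight_tmul, augRight_tmul, augmentation_of_mem ℬ (by omega) hy]
      simp
    have h2 : augLeft B 𝒜 (x ⊗ₜ 1 + 1 ⊗ₜ y) = y := by
      rw [map_add, augLeft_tmul, augLeft_tmul, augmentation_of_mem 𝒜 (by omega) hx]
      simp
    refine ⟨⟨x ⊗ₜ 1 + 1 ⊗ₜ y, (hL _).mpr ⟨h1.symm ▸ hxI, h2.symm ▸ hyJ⟩⟩, ?_,
      Prod.ext (Subtype.ext h1) (Subtype.ext h2)⟩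
    rw [mem_idealGrading]
    refine Submodule.add_mem _ ?_ ?_
    · exact tmul_mem_tensorGrading 𝒜 ℬ (j := 0) hx SetLike.GradedOne.one_mem
    · have := tmul_mem_tensorGrading 𝒜 ℬ (i := 0) (SetLike.GradedOne.one_mem (A := 𝒜)) hy
      rwa [zero_add] at this

/-- By `map_toAugIdeal`, an element of `L` is the sum of its part in `A₊ ⊗ B₊`, a sum of products
`(a ⊗ 1)(1 ⊗ b)`, and of images of elements of `I` and `J`, which are in the squares by assumption.
-/
theorem fibreIdeal_le_sq {I : Ideal A} {J : Ideal B} {L : Ideal (A ⊗[k] B)}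
    (hL : ∀ x, x ∈ L ↔ augRight A ℬ x ∈ I ∧ augLeft B 𝒜 x ∈ J)
    (hI : I ≤ augIdeal 𝒜 ^ 2) (hJ : J ≤ augIdeal ℬ ^ 2) :
    L ≤ augIdeal (tensorGrading 𝒜 ℬ) ^ 2 := by
  intro x hx
  obtain ⟨hxI, hxJ⟩ := (hL x).mp hx
  have h𝒜 : ∀ a ∈ augIdeal 𝒜, a ⊗ₜ[k] (1 : B) ∈ augIdeal (tensorGrading 𝒜 ℬ) := fun a ha => by
    rw [mem_augIdeal, ← augmentation_augRight, augRight_tmul, map_mul, mem_augIdeal.mp ha, zero_mul]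
  have hℬ : ∀ b ∈ augIdeal ℬ, (1 : A) ⊗ₜ[k] b ∈ augIdeal (tensorGrading 𝒜 ℬ) := fun b hb => by
    rw [mem_augIdeal, ← augmentation_augLeft, augLeft_tmul, map_mul, mem_augIdeal.mp hb, mul_zero]
  have h1 : augRight A ℬ x ⊗ₜ[k] (1 : B) ∈ augIdeal (tensorGrading 𝒜 ℬ) ^ 2 := by
    have : augIdeal 𝒜 ≤ (augIdeal (tensorGrading 𝒜 ℬ)).comap
        (Algebra.TensorProduct.includeLeft : A →ₐ[k] A ⊗[k] B) := h𝒜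
    exact (Ideal.pow_right_mono this 2).trans (Ideal.le_comap_pow _ 2) (hI hxI)
  have h2 : (1 : A) ⊗ₜ[k] augLeft B 𝒜 x ∈ augIdeal (tensorGrading 𝒜 ℬ) ^ 2 := by
    have : augIdeal ℬ ≤ (augIdeal (tensorGrading 𝒜 ℬ)).comap
        (Algebra.TensorProduct.includeRight : B →ₐ[k] A ⊗[k] B) := hℬ
    exact (Ideal.pow_right_mono this 2).trans (Ideal.le_comap_pow _ 2) (hJ hxJ)
  have h3 : ∀ y : augIdeal 𝒜 ⊗[k] augIdeal ℬ,
      TensorProduct.map ((augIdeal 𝒜).subtype.restrictScalars k)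
        ((augIdeal ℬ).subtype.restrictScalars k) y ∈ augIdeal (tensorGrading 𝒜 ℬ) ^ 2 := fun y => by
    induction y using TensorProduct.induction_on with
    | zero => rw [map_zero]; exact Ideal.zero_mem _
    | add y z hy hz => rw [map_add]; exact Ideal.add_mem _ hy hz
    | tmul a b =>
      have h4 := Ideal.mul_mem_mul (h𝒜 a.1 a.2) (hℬ b.1 b.2)
      rwa [Algebra.TensorProduct.tmul_mul_tmul, mul_one, one_mul, ← pow_two] at h4
  have h4 := map_toAugIdeal (𝒜 := 𝒜) (ℬ := ℬ) x
  have h5 : augmentation 𝒜 (augRight A ℬ x) = 0 :=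
    (hI.trans (Ideal.pow_le_self two_ne_zero)) hxI
  rw [h5, map_zero, add_zero, sub_sub, eq_sub_iff_add_eq] at h4
  rw [← h4]
  exact Ideal.add_mem _ (h3 _) (Ideal.add_mem _ h1 h2)

theorem eq_of_mem_tensorGrading_one {x : A ⊗[k] B} (hx : x ∈ tensorGrading 𝒜 ℬ 1) :
    x = augRight A ℬ x ⊗ₜ 1 + 1 ⊗ₜ augLeft B 𝒜 x := by
  have : tensorGrading 𝒜 ℬ 1 ≤ LinearMap.eqLocus LinearMap.id
      ((TensorProduct.mk k A B).flip 1 ∘ₗ (augRight A ℬ).toLinearMap +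
        TensorProduct.mk k A B 1 ∘ₗ (augLeft B 𝒜).toLinearMap) := by
    refine tensorGrading_le _ _ fun i l hil a ha b hb => ?_
    rw [LinearMap.mem_eqLocus]
    change a ⊗ₜ b = (a * algebraMap k A (augmentation ℬ b)) ⊗ₜ[k] (1 : B) +
      (1 : A) ⊗ₜ[k] (algebraMap k B (augmentation 𝒜 a) * b)
    rcases i with _ | i
    · rw [augmentation_of_mem ℬ (by omega) hb, map_zero, mul_zero, TensorProduct.zero_tmul,
        zero_add, ← Algebra.smul_def, ← TensorProduct.smul_tmul, ← Algebra.algebraMap_eq_smul_one,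
        ← eq_algebraMap_augmentation ha]
    · obtain rfl : l = 0 := by omega
      rw [augmentation_of_mem 𝒜 (by omega) ha, map_zero, zero_mul, TensorProduct.tmul_zero,
        add_zero, mul_comm, ← Algebra.smul_def, TensorProduct.smul_tmul,
        ← Algebra.algebraMap_eq_smul_one, ← eq_algebraMap_augmentation hb]
  exact this hx

theorem fibreIdeal_eq_zero {I : Ideal A} {J : Ideal B} {L : Ideal (A ⊗[k] B)}
    (hL : ∀ x, x ∈ L ↔ augRight A ℬ x ∈ I ∧ augLeft B 𝒜 x ∈ J)
    (hI : ∀ j < 2, ∀ a ∈ 𝒜 j, a ∈ I → a = 0) (hJ : ∀ j < 2, ∀ b ∈ ℬ j, b ∈ J → b = 0)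
    {j : ℕ} (hj : j < 2) {x : A ⊗[k] B} (hx : x ∈ tensorGrading 𝒜 ℬ j) (hxL : x ∈ L) : x = 0 := by
  obtain ⟨hxI, hxJ⟩ := (hL x).mp hxL
  have h1 := hI j hj _ (augRight_mem hx) hxI
  have h2 := hJ j hj _ (augLeft_mem hx) hxJ
  obtain rfl | rfl : j = 0 ∨ j = 1 := by omega
  · refine eq_zero_of_augmentation_eq_zero hx ?_
    rw [← augmentation_augRight, h1, map_zero]
  · rw [eq_of_mem_tensorGrading_one hx, h1, h2, TensorProduct.zero_tmul, TensorProduct.tmul_zero,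
      add_zero]

end TensorAug

end BackelinRoos

/-! ### The residue field of a fibre product -/

namespace BackelinRoos

open PowerSeries

section Fibre

variable {k : Type u} [Field k] {S : Type v} [CommRing S] [Algebra k S]
  {T : Type w} [CommRing T] [Algebra k T]
  (𝒮 : ℕ → Submodule k S) [GradedAlgebra 𝒮] [IsStandardGraded 𝒮]
  (𝒯 : ℕ → Submodule k T) [GradedAlgebra 𝒯] [IsStandardGraded 𝒯]

/-- The projection of the fibre product onto its first factor. -/
noncomputable def fibreFst : fibreProduct 𝒮 𝒯 →ₐ[k] S :=
  (AlgHom.fst k S T).comp (fibreProduct 𝒮 𝒯).val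

/-- The projection of the fibre product onto its second factor. -/
noncomputable def fibreSnd : fibreProduct 𝒮 𝒯 →ₐ[k] T :=
  (AlgHom.snd k S T).comp (fibreProduct 𝒮 𝒯).val

theorem augmentation_fibreFst (x : fibreProduct 𝒮 𝒯) :
    augmentation 𝒮 (fibreFst 𝒮 𝒯 x) = augmentation (fibreGrading 𝒮 𝒯) x :=
  eq_augmentation (fibreGrading 𝒮 𝒯) ((augmentation 𝒮).comp (fibreFst 𝒮 𝒯))
    (fun _ hn _ hx => augmentation_of_mem 𝒮 hn hx.1) x

theorem smulMem_fibreFst :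
    letI := (fibreFst 𝒮 𝒯).toAlgebra
    SMulMem (fibreGrading 𝒮 𝒯) 𝒮 := by
  let _ := (fibreFst 𝒮 𝒯).toAlgebra
  intro i j c hc a ha
  rw [Algebra.smul_def]
  exact SetLike.GradedMul.mul_mem (A := 𝒮) hc.1 ha

theorem smulMem_fibreSnd :
    letI := (fibreSnd 𝒮 𝒯).toAlgebra
    SMulMem (fibreGrading 𝒮 𝒯) 𝒯 := by
  let _ := (fibreSnd 𝒮 𝒯).toAlgebra
  intro i j c hc a ha
  rw [Algebra.smul_def]
  exact SetLike.GradedMul.mul_mem (A := 𝒯) hc.2 ha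

/-- `S` is the quotient of the fibre product by the ideal `0 × T₊`, which is generated in degree
one, so `isLin_right` applies and gains a step. -/
theorem isLin_fibreFst {n : ℕ} {b : ℤ⟦X⟧}
    (h : letI := (fibreSnd 𝒮 𝒯).toAlgebra
      IsLin (fibreGrading 𝒮 𝒯) (idealGrading 𝒯 (augIdeal 𝒯) 1) n b) :
    letI := (fibreFst 𝒮 𝒯).toAlgebra
    IsLin (fibreGrading 𝒮 𝒯) 𝒮 (n + 1) (1 + X * b) := by
  let _ := (fibreFst 𝒮 𝒯).toAlgebra
  let _ := (fibreSnd 𝒮 𝒯).toAlgebra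
  let f : augIdeal 𝒯 →ₗ[fibreProduct 𝒮 𝒯] fibreProduct 𝒮 𝒯 :=
    { toFun := fun t => ⟨(0, t.1), by
        rw [mem_fibreProduct, map_zero]; exact t.2.symm⟩
      map_add' := fun x y => Subtype.ext (Prod.ext (add_zero _).symm rfl)
      map_smul' := fun c x => Subtype.ext (Prod.ext (mul_zero _).symm rfl) }
  refine GradedExact.isLin_right (f := f)
    (g := Algebra.linearMap (fibreProduct 𝒮 𝒯) S) (ℳ' := idealGrading 𝒯 (augIdeal 𝒯) 1)
    (ℳ'' := 𝒮) (ℳ := fibreGrading 𝒮 𝒯)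
    ⟨fun x y hxy => ?_, fun x => ?_, fun j y => ?_, fun j hj x hx hx' => ?_, fun j x hx => hx.1,
    fun j x hx => ?_⟩ (isLin_self _) h
  · exact Subtype.ext (congrArg (fun z => z.1.2) hxy)
  · constructor
    · intro hx
      have hx' : x.1.1 = 0 := hx
      have h2 : augmentation 𝒮 x.1.1 = augmentation 𝒯 x.1.2 := x.2
      rw [hx', map_zero] at h2
      exact ⟨⟨x.1.2, h2.symm⟩, Subtype.ext (Prod.ext hx'.symm rfl)⟩
    · rintro ⟨y, rfl⟩; rfl
  · exact ⟨fun h => h.2, fun h => ⟨Submodule.zero_mem _, h⟩⟩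
  · obtain rfl : j = 0 := by omega
    have hx' : x.1.1 = 0 := hx'
    have h2 : augmentation 𝒮 x.1.1 = augmentation 𝒯 x.1.2 := x.2
    rw [hx', map_zero] at h2
    exact Subtype.ext (Prod.ext hx' (eq_zero_of_augmentation_eq_zero hx.2 h2.symm))
  · refine ⟨⟨(x, algebraMap k T (augmentation 𝒮 x)), ?_⟩, ⟨hx, ?_⟩, rfl⟩
    · rw [mem_fibreProduct]
      exact ((augmentation 𝒯).commutes _).symm
    · change algebraMap k T (augmentation 𝒮 x) ∈ 𝒯 j
      by_cases hj : j = 0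
      · subst hj; exact algebraMap_mem_zero _
      · rw [augmentation_of_mem 𝒮 hj hx, map_zero]; exact Submodule.zero_mem _

theorem isLin_fibreSnd {n : ℕ} {b : ℤ⟦X⟧}
    (h : letI := (fibreFst 𝒮 𝒯).toAlgebra
      IsLin (fibreGrading 𝒮 𝒯) (idealGrading 𝒮 (augIdeal 𝒮) 1) n b) :
    letI := (fibreSnd 𝒮 𝒯).toAlgebra
    IsLin (fibreGrading 𝒮 𝒯) 𝒯 (n + 1) (1 + X * b) := by
  let _ := (fibreFst 𝒮 𝒯).toAlgebra
  let _ := (fibreSnd 𝒮 𝒯).toAlgebra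
  let f : augIdeal 𝒮 →ₗ[fibreProduct 𝒮 𝒯] fibreProduct 𝒮 𝒯 :=
    { toFun := fun t => ⟨(t.1, 0), by
        rw [mem_fibreProduct, map_zero]; exact t.2⟩
      map_add' := fun x y => Subtype.ext (Prod.ext rfl (add_zero _).symm)
      map_smul' := fun c x => Subtype.ext (Prod.ext rfl (mul_zero _).symm) }
  refine GradedExact.isLin_right (f := f)
    (g := Algebra.linearMap (fibreProduct 𝒮 𝒯) T) (ℳ' := idealGrading 𝒮 (augIdeal 𝒮) 1)
    (ℳ'' := 𝒯) (ℳ := fibreGrading 𝒮 𝒯)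
    ⟨fun x y hxy => ?_, fun x => ?_, fun j y => ?_, fun j hj x hx hx' => ?_, fun j x hx => hx.2,
    fun j x hx => ?_⟩ (isLin_self _) h
  · exact Subtype.ext (congrArg (fun z => z.1.1) hxy)
  · constructor
    · intro hx
      have hx' : x.1.2 = 0 := hx
      have h2 : augmentation 𝒮 x.1.1 = augmentation 𝒯 x.1.2 := x.2
      rw [hx', map_zero] at h2
      exact ⟨⟨x.1.1, h2⟩, Subtype.ext (Prod.ext rfl hx'.symm)⟩
    · rintro ⟨y, rfl⟩; rfl
  · exact ⟨fun h => h.1, fun h => ⟨h, Submodule.zero_mem _⟩⟩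
  · obtain rfl : j = 0 := by omega
    have hx' : x.1.2 = 0 := hx'
    have h2 : augmentation 𝒮 x.1.1 = augmentation 𝒯 x.1.2 := x.2
    rw [hx', map_zero] at h2
    exact Subtype.ext (Prod.ext (eq_zero_of_augmentation_eq_zero hx.1 h2) hx')
  · refine ⟨⟨(algebraMap k S (augmentation 𝒯 x), x), ?_⟩, ⟨?_, hx⟩, rfl⟩
    · rw [mem_fibreProduct]
      exact (augmentation 𝒮).commutes _
    · change algebraMap k S (augmentation 𝒯 x) ∈ 𝒮 j
      by_cases hj : j = 0
      · subst hj; exact algebraMap_mem_zero _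
      · rw [augmentation_of_mem 𝒯 hj hx, map_zero]; exact Submodule.zero_mem _

variable {𝒮 𝒯} in
/-- The residue field of a fibre product of Koszul algebras has a linear resolution, with
Poincaré series given by the formula of Dress and Krämer. -/
theorem IsLinResidue.fibre {P P' : ℤ⟦X⟧} (hP : ∀ n, IsLinResidue 𝒮 n P)
    (hP' : ∀ n, IsLinResidue 𝒯 n P') :
    ∃ E : ℤ⟦X⟧, E * (P + P' - P * P') = P * P' ∧
      ∀ n, IsLinResidue (fibreGrading 𝒮 𝒯) n E := by
  obtain ⟨s, rfl, hs⟩ := IsLinResidue.exists_isLin_augIdeal hP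
  obtain ⟨t, rfl, ht⟩ := IsLinResidue.exists_isLin_augIdeal hP'
  let _ := (fibreFst 𝒮 𝒯).toAlgebra
  let _ := (fibreSnd 𝒮 𝒯).toAlgebra
  -- With `P = 1 + Xs` and `P' = 1 + Xt` one has `P + P' - PP' = 1 - X²st`, the Dress–Krämer
  -- denominator.
  obtain ⟨e, he⟩ : ∃ e : ℤ⟦X⟧, (1 - X * X * s * t) * e = 1 :=
    ⟨_, PowerSeries.mul_invOfUnit (1 - X * X * s * t) 1 (by simp)⟩
  -- Over the fibre product, the series `σ` of `S₊` and `τ` of `T₊` must satisfy `σ = (1 + Xτ)s` and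
  -- `τ = (1 + Xσ)t`; the stated series solve this system. Each step for one ideal supplies the next
  -- step for the other.
  have key : ∀ n,
      IsLin (fibreGrading 𝒮 𝒯) (idealGrading 𝒮 (augIdeal 𝒮) 1) n (s * (1 + X * t) * e) ∧
      IsLin (fibreGrading 𝒮 𝒯) (idealGrading 𝒯 (augIdeal 𝒯) 1) n (t * (1 + X * s) * e) := by
    intro n
    induction n with
    | zero => exact ⟨trivial, trivial⟩
    | succ n ih =>
      have h1 := isLin_fibreFst 𝒮 𝒯 ih.2
      have h2 := isLin_fibreSnd 𝒮 𝒯 ih.1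
      have h3 := (hs (n + 1)).restrictScalars (smulMem_fibreFst 𝒮 𝒯) h1
      have h4 := (ht (n + 1)).restrictScalars (smulMem_fibreSnd 𝒮 𝒯) h2
      have e3 : (1 + X * (t * (1 + X * s) * e)) * s = s * (1 + X * t) * e := by
        linear_combination (-s) * he
      have e4 : (1 + X * (s * (1 + X * t) * e)) * t = t * (1 + X * s) * e := by
        linear_combination (-t) * he
      rw [e3] at h3
      rw [e4] at h4
      exact ⟨h3, h4⟩
  refine ⟨(1 + X * (t * (1 + X * s) * e)) * (1 + X * s), ?_, fun n => ?_⟩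
  · linear_combination (1 + X * s) * (X * t * (1 + X * s)) * he
  · cases n with
    | zero => trivial
    | succ n =>
      exact (hP (n + 1)).restrictScalars (smulMem_fibreFst 𝒮 𝒯) (augmentation_fibreFst 𝒮 𝒯)
        (isLin_fibreFst 𝒮 𝒯 (key n).2)

end Fibre

end BackelinRoos

namespace BackelinRoos

open PowerSeries

/-! ### Bigraded series of linear resolutions -/

section Series

/-- The substitution `z ↦ s z`. -/
noncomputable def diagonal : ℤ⟦X⟧ →+* PowerSeries ℤ[X] :=
  (PowerSeries.rescale (Polynomial.X : ℤ[X])).comp (PowerSeries.map Polynomial.C)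

theorem coeff_diagonal (b : ℤ⟦X⟧) (i : ℕ) :
    coeff i (diagonal b) = Polynomial.X ^ i * Polynomial.C (coeff i b) := by
  simp [diagonal, PowerSeries.coeff_rescale]

theorem diagonal_injective : Function.Injective diagonal := by
  intro b c h
  ext i
  have h1 := congrArg (coeff i) h
  rw [coeff_diagonal, coeff_diagonal] at h1
  exact Polynomial.C_injective (mul_left_cancel₀ (pow_ne_zero i Polynomial.X_ne_zero) h1)

/-- Coefficientwise nonnegativity. -/
def Nonnegative (f : PowerSeries ℤ[X]) : Prop := ∀ i j, 0 ≤ (coeff i f).coeff j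

theorem Nonnegative.mul {f g : PowerSeries ℤ[X]} (hf : Nonnegative f) (hg : Nonnegative g) :
    Nonnegative (f * g) := by
  intro i j
  rw [coeff_mul, Polynomial.finsetSum_coeff]
  refine Finset.sum_nonneg fun p _ => ?_
  rw [Polynomial.coeff_mul]
  exact Finset.sum_nonneg fun q _ => mul_nonneg (hf _ _) (hg _ _)

/-- The equation reads `F = G + X F (H - 1)`. All terms are nonnegative and `F ≥ 1`, so `F`
dominates both `G` and `X (H - 1)`. Thus the support of `F` bounds the supports of the other two. -/
theorem coeff_le_of_eq {F G H : PowerSeries ℤ[X]} (hF : Nonnegative F)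
    (hF0 : 1 ≤ (coeff 0 F).coeff 0) (hG : Nonnegative G) (hH : Nonnegative (H - 1))
    (h : F * (1 - X * (H - 1)) = G) (i j : ℕ) :
    (coeff i G).coeff j ≤ (coeff i F).coeff j ∧
      (coeff i (H - 1)).coeff j ≤ (coeff (i + 1) F).coeff j := by
  have hF' : Nonnegative (F - 1) := by
    intro i j
    rw [map_sub, Polynomial.coeff_sub, coeff_one]
    by_cases hi : i = 0
    · subst hi
      by_cases hj : j = 0
      · subst hj; simpa using hF0
      · simpa [Polynomial.coeff_one, hj] using hF 0 j
    · simpa [hi] using hF i j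
  have h1 : F = G + X * ((H - 1) + (F - 1) * (H - 1)) := by rw [← h]; ring
  have hX : ∀ f : PowerSeries ℤ[X], Nonnegative f → Nonnegative (X * f) := by
    intro f hf i j
    cases i with
    | zero => simp
    | succ i => rw [coeff_succ_X_mul]; exact hf i j
  have hm := hF'.mul hH
  have hs : Nonnegative ((H - 1) + (F - 1) * (H - 1)) := fun i j => by
    rw [map_add, Polynomial.coeff_add]; exact add_nonneg (hH i j) (hm i j)
  constructor
  · have h2 : (coeff i F).coeff j = _ := congrArg (fun f => (coeff i f).coeff j) h1
    rw [map_add, Polynomial.coeff_add] at h2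
    have h3 := hX _ hs i j
    linarith
  · have h2 : (coeff (i + 1) F).coeff j = _ := congrArg (fun f => (coeff (i + 1) f).coeff j) h1
    rw [map_add, coeff_succ_X_mul, map_add, Polynomial.coeff_add, Polynomial.coeff_add] at h2
    have h3 := hG (i + 1) j
    have h4 := hm i j
    linarith

end Series

section Convert

universe w₁

variable {k : Type u} [Field k] {A : Type v} [CommRing A] [Algebra k A] {𝒜 : ℕ → Submodule k A}
  {M : Type w₁} [AddCommGroup M] [Module k M] [Module A M] {ℳ : ℕ → Submodule k M}

namespace GradedFreeResolution

theorem coeff_series (F : GradedFreeResolution 𝒜 ℳ) (i j : ℕ) :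
    (coeff i F.series).coeff j = ∑ r : Fin (F.rank i), if j = F.deg i r then 1 else 0 := by
  simp [series, Polynomial.coeff_X_pow]

theorem nonnegative_series (F : GradedFreeResolution 𝒜 ℳ) : Nonnegative F.series := by
  intro i j
  rw [coeff_series]
  exact Finset.sum_nonneg fun r _ => by split_ifs <;> simp

theorem one_le_coeff_series (F : GradedFreeResolution 𝒜 ℳ) (i : ℕ) (r : Fin (F.rank i)) :
    1 ≤ (coeff i F.series).coeff (F.deg i r) := by
  rw [coeff_series]
  have := Finset.single_le_sum (f := fun t => if F.deg i r = F.deg i t then (1 : ℤ) else 0)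
    (fun t _ => by split_ifs <;> simp) (Finset.mem_univ r)
  simpa using this

theorem coeff_series_of_deg (F : GradedFreeResolution 𝒜 ℳ) {i e : ℕ} (h : ∀ r, F.deg i r = e) :
    coeff i F.series = Polynomial.X ^ e * Polynomial.C (F.rank i : ℤ) := by
  simp [series, h, mul_comm]

theorem exists_rank_zero (F : GradedFreeResolution 𝒜 ℳ) [Nontrivial M] : Nonempty (Fin (F.rank 0)) := by
  by_contra h
  rw [not_nonempty_iff] at h
  obtain ⟨m, hm⟩ := exists_ne (0 : M)
  obtain ⟨v, rfl⟩ := F.aug_surjective m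
  exact hm (by rw [Subsingleton.elim v 0, map_zero])

/-- A linear graded free resolution. -/
def toLinearResolution (F : GradedFreeResolution 𝒜 ℳ) (h : F.IsLinear) : LinearResolution 𝒜 ℳ where
  rank := F.rank
  d := F.d
  aug := F.aug
  d_mem i c := mem_freeGrading.mpr fun r => by
    rcases F.d_homogeneous i c r with ⟨_, h2⟩ | h1
    · rwa [h, h, Nat.add_sub_cancel_left] at h2
    · rw [h1]; exact Submodule.zero_mem _
  aug_mem r := by
    have := F.aug_homogeneous r
    rwa [h] at this
  aug_surjective := F.aug_surjective
  exact_zero := F.exact_zero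
  exact_succ := F.exact_succ

theorem series_eq_diagonal (F : GradedFreeResolution 𝒜 ℳ) (h : F.IsLinear) :
    F.series = diagonal (F.toLinearResolution h).series := by
  ext1 i
  rw [F.coeff_series_of_deg (h i), coeff_diagonal, LinearResolution.series, coeff_mk]
  rfl

end GradedFreeResolution

namespace LinearResolution

/-- A linear resolution as a graded free resolution. -/
def toGraded (F : LinearResolution 𝒜 ℳ) : GradedFreeResolution 𝒜 ℳ where
  rank := F.rank
  deg i _ := i
  d := F.d
  aug := F.aug
  d_homogeneous i c r := Or.inl ⟨i.le_succ, by
    rw [Nat.add_sub_cancel_left]; exact mem_freeGrading.mp (F.d_mem i c) r⟩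
  aug_homogeneous := F.aug_mem
  aug_surjective := F.aug_surjective
  exact_zero := F.exact_zero
  exact_succ := F.exact_succ

theorem isLinear_toGraded (F : LinearResolution 𝒜 ℳ) : F.toGraded.IsLinear := fun _ _ => rfl

theorem series_toGraded (F : LinearResolution 𝒜 ℳ) : F.toGraded.series = diagonal F.series :=
  F.toGraded.series_eq_diagonal F.isLinear_toGraded

theorem isMinimal_toGraded [GradedAlgebra 𝒜] [IsStandardGraded 𝒜] (F : LinearResolution 𝒜 ℳ) :
    F.toGraded.IsMinimal := fun i _ r =>
  mem_irrelevant_iff.mpr (F.augmentation_d i _ r)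

end LinearResolution

end Convert

section Residue

variable {k : Type u} [Field k] {A : Type v} [CommRing A] [Algebra k A] (𝒜 : ℕ → Submodule k A)
  [GradedAlgebra 𝒜] [IsStandardGraded 𝒜]

variable {𝒜} in
theorem exists_residueResolution {b : ℤ⟦X⟧} (h : ∀ n, IsLinResidue 𝒜 n b) :
    ∃ F : ResidueFieldResolution 𝒜,
      letI : Module A k := Module.compHom k (augmentation 𝒜).toRingHom
      F.IsLinear ∧ F.IsMinimal ∧ F.series = diagonal b := by
  let _ := residueModule 𝒜
  have := isScalarTower_residueModule 𝒜
  have : Nontrivial A := IsStandardGraded.nontrivial (𝒜 := 𝒜)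
  obtain ⟨F, hF⟩ := exists_linearResolution (hasProjections_of_gradedAlgebra 𝒜)
    (hasProjections_fieldGrading (k := k)) h
  exact ⟨F.toGraded, F.isLinear_toGraded, F.isMinimal_toGraded, hF ▸ F.series_toGraded⟩

theorem isKoszul_iff : IsKoszul 𝒜 ↔ ∃ b, ∀ n, IsLinResidue 𝒜 n b := by
  constructor
  · rintro ⟨F, hF⟩
    let _ := residueModule 𝒜
    have := isScalarTower_residueModule 𝒜
    exact ⟨_, (F.toLinearResolution hF).isLin (smulMem_fieldGrading 𝒜) hasProjections_fieldGrading⟩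
  · rintro ⟨b, h⟩
    obtain ⟨F, hF, -⟩ := exists_residueResolution h
    exact ⟨F, hF⟩

variable {𝒜}

theorem isLin_of_isLinear {F : ResidueFieldResolution 𝒜}
    (hF : letI : Module A k := Module.compHom k (augmentation 𝒜).toRingHom
      F.IsLinear) :
    ∃ b, (∀ n, IsLinResidue 𝒜 n b) ∧
      letI : Module A k := Module.compHom k (augmentation 𝒜).toRingHom
      F.series = diagonal b := by
  let _ := residueModule 𝒜
  have := isScalarTower_residueModule 𝒜
  exact ⟨_, (F.toLinearResolution hF).isLin (smulMem_fieldGrading 𝒜) hasProjections_fieldGrading,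
    F.series_eq_diagonal hF⟩

theorem isLinear_of_isMinimal_residue {b : ℤ⟦X⟧} (h : ∀ n, IsLinResidue 𝒜 n b)
    {F : ResidueFieldResolution 𝒜}
    (hF : letI : Module A k := Module.compHom k (augmentation 𝒜).toRingHom
      F.IsMinimal) :
    letI : Module A k := Module.compHom k (augmentation 𝒜).toRingHom
    F.IsLinear := by
  let _ := residueModule 𝒜
  have := isScalarTower_residueModule 𝒜
  exact GradedFreeResolution.isLinear_of_isMinimal (smulMem_fieldGrading 𝒜)
    hasProjections_fieldGrading h hF

end Residue

end BackelinRoos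

/-! ### Golod morphisms onto Koszul algebras -/

namespace BackelinRoos

open PowerSeries

section Golod

variable {k : Type u} [Field k] {Q : Type v} [CommRing Q] [Algebra k Q]
  {R : Type w} [CommRing R] [Algebra k R]
  {𝒬 : ℕ → Submodule k Q} [GradedAlgebra 𝒬] [IsStandardGraded 𝒬]
  {ℛ : ℕ → Submodule k R} [GradedAlgebra ℛ] [IsStandardGraded ℛ]

theorem hasProjections_ker {φ : Q →ₐ[k] R} (hφ : ∀ n, ∀ q ∈ 𝒬 n, φ q ∈ ℛ n)
    (hlow : ∀ j < 2, ∀ q ∈ 𝒬 j, φ q = 0 → q = 0) :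
    HasProjections (idealGrading 𝒬 (RingHom.ker φ) 2) :=
  (hasProjections_of_gradedAlgebra 𝒬).of_exact (hasProjections_of_gradedAlgebra ℛ)
    (ι := (RingHom.ker φ).subtype.restrictScalars k) (f := φ.toLinearMap) Subtype.val_injective
    (fun v => ⟨fun hv => ⟨⟨v, hv⟩, rfl⟩, by rintro ⟨x, rfl⟩; exact x.2⟩) hφ hlow fun _ _ => Iff.rfl

/-- If the residue fields and the kernel of `Q → R` have linear resolutions, then the Golod property
can be checked on their Poincaré series. -/
theorem golodEquality_of_isLin {φ : Q →ₐ[k] R} (hφ : ∀ n, ∀ q ∈ 𝒬 n, φ q ∈ ℛ n)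
    (hsurj : Function.Surjective φ) (hlow : ∀ j < 2, ∀ q ∈ 𝒬 j, φ q = 0 → q = 0) {P G h : ℤ⟦X⟧}
    (hP : ∀ n, IsLinResidue ℛ n P) (hG : ∀ n, IsLinResidue 𝒬 n G)
    (hh : ∀ n, IsLin 𝒬 (idealGrading 𝒬 (RingHom.ker φ) 2) n h) (heq : P * (1 - X ^ 2 * h) = G) :
    GolodEquality 𝒬 ℛ φ := by
  have : Nontrivial Q := IsStandardGraded.nontrivial (𝒜 := 𝒬)
  obtain ⟨F, -, hF, hF'⟩ := exists_residueResolution hP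
  obtain ⟨E, -, hE, hE'⟩ := exists_residueResolution hG
  let _ : Module Q R := Module.compHom R φ.toRingHom
  obtain ⟨L, hL⟩ := exists_linearResolution (hasProjections_of_gradedAlgebra 𝒬)
    (hasProjections_ker hφ hlow) hh
  let φ' : Q →ₗ[Q] R :=
    { toFun := φ
      map_add' := map_add φ
      map_smul' := fun a x => map_mul φ a x }
  let incl : RingHom.ker φ →ₗ[Q] (Fin 1 → Q) := LinearMap.pi fun _ => (RingHom.ker φ).subtype
  -- The minimal resolution of `R` over `Q` is `Q` followed by the resolution of the kernel, whose
  -- generators start in degree two.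
  let H : GradedFreeResolution 𝒬 ℛ :=
    { rank := fun | 0 => 1 | i + 1 => L.rank i
      deg := fun | 0 => fun _ => 0 | i + 1 => fun _ => i + 2
      d := fun | 0 => incl ∘ₗ L.aug | i + 1 => L.d i
      aug := φ' ∘ₗ LinearMap.proj 0
      d_homogeneous := fun
        | 0 => fun c r => Or.inl ⟨Nat.zero_le _, L.aug_mem c⟩
        | i + 1 => fun c r => Or.inl ⟨Nat.le_succ _, by
            change L.d i (Pi.single c 1) r ∈ 𝒬 (i + 1 + 2 - (i + 2))
            rw [show i + 1 + 2 - (i + 2) = 1 by omega]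
            exact mem_freeGrading.mp (L.d_mem i c) r⟩
      aug_homogeneous := fun r => by
        rw [Subsingleton.elim r 0]
        change φ ((Pi.single 0 1 : Fin 1 → Q) 0) ∈ ℛ 0
        rw [Pi.single_eq_same, map_one]
        exact SetLike.GradedOne.one_mem
      aug_surjective := fun y => let ⟨x, hx⟩ := hsurj y; ⟨fun _ => x, hx⟩
      exact_zero := fun v => by
        constructor
        · intro hv
          obtain ⟨w, hw⟩ := L.aug_surjective ⟨v 0, hv⟩
          refine ⟨w, funext fun i => ?_⟩
          rw [Subsingleton.elim i 0]
          exact congrArg Subtype.val hw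
        · rintro ⟨w, rfl⟩
          exact (L.aug w).2
      exact_succ := fun
        | 0 => fun v => by
            rw [← L.exact_zero v]
            exact ⟨fun hv => Subtype.ext (congrFun hv 0), fun hv => funext fun i =>
              congrArg Subtype.val hv⟩
        | i + 1 => L.exact_succ i }
  refine ⟨F, E, H, hF, hE, fun i c r => ?_, ?_⟩
  · cases i with
    | zero =>
      exact mem_irrelevant_iff.mpr (augmentation_of_mem 𝒬 two_ne_zero (L.aug_mem c))
    | succ i => exact mem_irrelevant_iff.mpr (L.augmentation_d i _ r)
  -- The `i`-th module resolving the kernel has internal degree `i + 2` and homological degree `i +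
  -- 1` in `H`; the extra factor `X` makes these equal, so the term lies on the diagonal.
  · have hH : X * (H.series - 1) = diagonal (X ^ 2 * h) := by
      ext1 i
      rw [coeff_diagonal]
      rcases i with _ | _ | i
      · simp
      · rw [coeff_succ_X_mul, map_sub, H.coeff_series_of_deg (e := 0) fun _ => rfl]
        simp [H, coeff_X_pow_mul']
      · rw [coeff_succ_X_mul, map_sub, H.coeff_series_of_deg (e := i + 2) fun _ => rfl, coeff_one,
          if_neg i.succ_ne_zero, sub_zero, show i + 1 + 1 = i + 2 from rfl, coeff_X_pow_mul, ← hL, LinearResolution.series, coeff_mk]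
    rw [hH, hF', hE', ← heq]
    simp only [map_mul, map_sub, map_one]

/-- The structure of Golod morphisms onto Koszul algebras. -/
theorem IsGolod.exists_series {φ : Q →ₐ[k] R} (hφ : IsGolod 𝒬 ℛ φ) {P : ℤ⟦X⟧}
    (hP : ∀ n, IsLinResidue ℛ n P) :
    ∃ G h : ℤ⟦X⟧, (∀ n, IsLinResidue 𝒬 n G) ∧
      (∀ n, IsLin 𝒬 (idealGrading 𝒬 (RingHom.ker φ) 2) n h) ∧
      (∀ j < 2, ∀ q ∈ 𝒬 j, φ q = 0 → q = 0) ∧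
      ∃ P' : ℤ⟦X⟧, (∀ n, IsLinResidue ℛ n P') ∧ P' * (1 - X ^ 2 * h) = G := by
  have : Nontrivial R := IsStandardGraded.nontrivial (𝒜 := ℛ)
  have : Nontrivial Q := IsStandardGraded.nontrivial (𝒜 := 𝒬)
  have hQ := hasProjections_of_gradedAlgebra 𝒬
  have hR := hasProjections_of_gradedAlgebra ℛ
  obtain ⟨F, G, H, hF, hG, hH, heq⟩ := hφ.golod_equality
  have hFlin := isLinear_of_isMinimal_residue hP hF
  obtain ⟨P', hP', hFP'⟩ := isLin_of_isLinear hFlin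
  let _ : Module Q R := Module.compHom R φ.toRingHom
  let φ' : Q →ₗ[Q] R :=
    { toFun := φ
      map_add' := map_add φ
      map_smul' := fun a x => map_mul φ a x }
  -- `R` is generated by `1` over `Q`, so the minimal generators have degree zero.
  have hH0 : ∀ r, H.deg 0 r = 0 := by
    refine degree_eq_zero (𝒜 := 𝒬) (ℳ := ℛ) (q := H.aug) (δ := H.deg 0) (p := φ' ∘ₗ (LinearMap.proj 0 : (Fin 1 → Q) →ₗ[Q] Q)) (fun j y hy => ?_)
      H.aug_homogeneous H.aug_surjective fun v hv i => ?_
    · obtain ⟨x, rfl⟩ := hφ.surjective y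
      refine ⟨fun _ => hQ.proj j x, mem_freeGrading.mpr fun _ => hQ.proj_mem j x, ?_⟩
      have := hQ.proj_map hR φ.toLinearMap (s := 0) hφ.graded j x
      exact this.symm.trans (hR.proj_same hy)
    · obtain ⟨w, rfl⟩ := (H.exact_zero v).mp hv
      exact GradedFreeResolution.augmentation_d hH 0 w i
  obtain ⟨r₀⟩ := H.exists_rank_zero
  have hHnn : Nonnegative (H.series - 1) := by
    intro i j
    rw [map_sub, Polynomial.coeff_sub, coeff_one]
    by_cases hi : i = 0
    · subst hi
      by_cases hj : j = 0
      · subst hj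
        have := H.one_le_coeff_series 0 r₀
        rw [hH0] at this
        simpa using this
      · simpa [Polynomial.coeff_one, hj] using H.nonnegative_series 0 j
    · simpa [hi] using H.nonnegative_series i j
  have hle := coeff_le_of_eq (by
      let _ := residueModule ℛ
      exact F.nonnegative_series) (by
      let _ := residueModule ℛ
      obtain ⟨r⟩ := F.exists_rank_zero
      have := F.one_le_coeff_series 0 r
      rwa [hFlin] at this) (by
      let _ := residueModule 𝒬
      exact G.nonnegative_series) hHnn heq
  have hF0 : ∀ i j, i ≠ j → (coeff i (diagonal P')).coeff j = 0 := by
    intro i j hij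
    rw [coeff_diagonal, mul_comm, Polynomial.coeff_C_mul, Polynomial.coeff_X_pow,
      if_neg (Ne.symm hij), mul_zero]
  rw [hFP'] at hle heq
  -- `F` is supported on the diagonal and dominates `G`, so `Q` is Koszul. The same domination,
  -- shifted by one, next bounds the rank in step zero of `H` and fixes its later degrees.
  have hGlin : letI := residueModule 𝒬; G.IsLinear := by
    let _ := residueModule 𝒬
    intro i r
    by_contra hne
    have h1 := (hle i (G.deg i r)).1
    rw [hF0 _ _ (Ne.symm hne)] at h1
    have h2 := G.one_le_coeff_series i r
    exact absurd (h2.trans h1) (by norm_num)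
  obtain ⟨G', hG', hGG'⟩ := isLin_of_isLinear hGlin
  -- The coefficient of `F` in homological degree one and internal degree zero is off the diagonal,
  -- so there is no room for a second generator.
  have hrank : H.rank 0 = 1 := by
    have h1 := (hle 0 0).2
    rw [hF0 _ _ (by norm_num), map_sub, H.coeff_series_of_deg hH0] at h1
    have h2 : (H.rank 0 : ℤ) ≤ 1 := by simpa using h1
    have h3 := r₀.pos
    omega
  have : Subsingleton (Fin (H.rank 0)) := by rw [hrank]; infer_instance
  have hHdeg : ∀ i r, H.deg (i + 1) r = i + 2 := by
    intro i r
    by_contra hne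
    have h1 := (hle (i + 1) (H.deg (i + 1) r)).2
    rw [hF0 _ _ (Ne.symm hne), map_sub, coeff_one, if_neg i.succ_ne_zero, sub_zero] at h1
    have h2 := H.one_le_coeff_series (i + 1) r
    exact absurd (h2.trans h1) (by norm_num)
  have hsingle : ∀ v : Fin (H.rank 0) → Q, v = v r₀ • Pi.single r₀ 1 := fun v => by
    funext i
    rw [Subsingleton.elim i r₀]
    simp
  -- The single generator maps to a scalar, so `H.aug` is `φ` up to a unit and the rest of `H`
  -- resolves `ker φ`.
  obtain ⟨c, hc⟩ : ∃ c : k, algebraMap k R c = H.aug (Pi.single r₀ 1) := by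
    have h1 := H.aug_homogeneous r₀
    rw [hH0] at h1
    exact ⟨_, (eq_algebraMap_augmentation h1).symm⟩
  have haug : ∀ v, H.aug v = φ (v r₀) * algebraMap k R c := fun v => by
    conv_lhs => rw [hsingle v, map_smul, ← hc]
    rfl
  have hc0 : c ≠ 0 := by
    rintro rfl
    obtain ⟨v, hv⟩ := H.aug_surjective 1
    rw [haug, map_zero, mul_zero] at hv
    exact zero_ne_one hv
  have haug0 : ∀ v, H.aug v = 0 ↔ φ (v r₀) = 0 := fun v => by
    rw [haug, mul_comm, ← Algebra.smul_def, smul_eq_zero, or_iff_right hc0]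
  have hd_mem : ∀ c, H.d 0 (Pi.single c 1) r₀ ∈ 𝒬 2 := fun c => by
    rcases H.d_homogeneous 0 c r₀ with ⟨_, h2⟩ | h1
    · rwa [hH0, hHdeg] at h2
    · rw [h1]; exact Submodule.zero_mem _
  let δ : (Fin (H.rank 1) → Q) →ₗ[Q] Q := LinearMap.proj r₀ ∘ₗ H.d 0
  have hδ : ∀ q, φ q = 0 ↔ ∃ w, δ w = q := by
    intro q
    have h1 : φ q = 0 ↔ H.aug (fun _ => q) = 0 := (haug0 fun _ => q).symm
    rw [h1, H.exact_zero]
    exact ⟨fun ⟨w, hw⟩ => ⟨w, congrFun hw r₀⟩, fun ⟨w, hw⟩ => ⟨w, funext fun i => by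
      rw [Subsingleton.elim i r₀]; exact hw⟩⟩
  have hδ_mem : ∀ j, ∀ w ∈ freeGrading 𝒬 (H.rank 1) j, δ w ∈ 𝒬 (j + 2) := by
    intro j w hw
    have h1 : δ = Fintype.linearCombination Q fun i => δ (Pi.single i 1) := by
      refine LinearMap.pi_ext' fun i => LinearMap.ext_ring ?_
      simp [Fintype.linearCombination_apply_single]
    rw [h1, Fintype.linearCombination_apply]
    exact Submodule.sum_mem _ fun i _ => SetLike.GradedMul.mul_mem (mem_freeGrading.mp hw i)
      (hd_mem i)
  have hlow : ∀ j < 2, ∀ q ∈ 𝒬 j, φ q = 0 → q = 0 := by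
    intro j hj q hq hq0
    obtain ⟨w, rfl⟩ := (hδ q).mp hq0
    have h1 := (hasProjections_freeGrading hQ (H.rank 1)).proj_map_of_lt hQ
      (δ.restrictScalars k) hδ_mem hj w
    rw [LinearMap.restrictScalars_apply, hQ.proj_same hq] at h1
    exact h1
  -- The generators of step `i + 1` of `H` have degree `i + 2`, so after removing step zero and
  -- shifting by two the resolution is linear.
  let L : LinearResolution 𝒬 (idealGrading 𝒬 (RingHom.ker φ) 2) :=
    { rank := fun i => H.rank (i + 1)
      d := fun i => H.d (i + 1)
      aug := δ.codRestrict (RingHom.ker φ) fun w => (hδ _).mpr ⟨w, rfl⟩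
      d_mem := fun i c => mem_freeGrading.mpr fun r => by
        rcases H.d_homogeneous (i + 1) c r with ⟨_, h2⟩ | h1
        · rwa [hHdeg, hHdeg, show i + 1 + 2 - (i + 2) = 1 by omega] at h2
        · rw [h1]; exact Submodule.zero_mem _
      aug_mem := fun r => hd_mem r
      aug_surjective := fun x => let ⟨w, hw⟩ := (hδ _).mp x.2; ⟨w, Subtype.ext hw⟩
      exact_zero := fun v => by
        rw [← H.exact_succ 0 v]
        exact ⟨fun hv => funext fun i => by
          rw [Subsingleton.elim i r₀]; exact congrArg Subtype.val hv,
          fun hv => Subtype.ext (congrFun hv r₀)⟩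
      exact_succ := fun i => H.exact_succ (i + 1) }
  refine ⟨G', L.series, hG', fun n => L.isLin (smulMem_idealGrading _ _)
    (hasProjections_ker hφ.graded hlow) n, hlow, P', hP', diagonal_injective ?_⟩
  have hHs : X * (H.series - 1) = diagonal (X ^ 2 * L.series) := by
    ext1 i
    rw [coeff_diagonal]
    rcases i with _ | _ | i
    · simp
    · rw [coeff_succ_X_mul, map_sub, H.coeff_series_of_deg hH0, hrank]
      simp [coeff_X_pow_mul']
    · rw [coeff_succ_X_mul, map_sub, H.coeff_series_of_deg (hHdeg i), coeff_one,
        if_neg i.succ_ne_zero, sub_zero, show i + 1 + 1 = i + 2 from rfl, coeff_X_pow_mul, LinearResolution.series, coeff_mk]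
  simp only [map_mul, map_sub, map_one] at hHs heq ⊢
  rw [← hHs, heq, hGG']

end Golod

end BackelinRoos

/-! ### Golod morphisms and fibre products -/

namespace BackelinRoos

open PowerSeries

section TensorMap

variable {k : Type u} [Field k] {S : Type v} [CommRing S] [Algebra k S]
  {T : Type w} [CommRing T] [Algebra k T] {𝒮 : ℕ → Submodule k S} {𝒯 : ℕ → Submodule k T}
  {A : Type v} [CommRing A] [Algebra k A] {𝒜 : ℕ → Submodule k A}
  {B : Type w} [CommRing B] [Algebra k B] {ℬ : ℕ → Submodule k B}

theorem tensorMap_graded {φ : A →ₐ[k] S} (hφ : ∀ n, ∀ a ∈ 𝒜 n, φ a ∈ 𝒮 n)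
    {ψ : B →ₐ[k] T} (hψ : ∀ n, ∀ b ∈ ℬ n, ψ b ∈ 𝒯 n) {n : ℕ} {x : A ⊗[k] B}
    (hx : x ∈ tensorGrading 𝒜 ℬ n) :
    Algebra.TensorProduct.map φ ψ x ∈ tensorGrading 𝒮 𝒯 n := by
  have : tensorGrading 𝒜 ℬ n ≤
      (tensorGrading 𝒮 𝒯 n).comap (Algebra.TensorProduct.map φ ψ).toLinearMap := by
    refine tensorGrading_le _ _ fun i j hij a ha b hb => ?_
    subst hij
    exact tmul_mem_tensorGrading _ _ (hφ i a ha) (hψ j b hb)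
  exact this hx

end TensorMap

section FibreGolod

variable {k : Type u} [Field k] {S : Type v} [CommRing S] [Algebra k S]
  {T : Type w} [CommRing T] [Algebra k T]
  {𝒮 : ℕ → Submodule k S} [GradedAlgebra 𝒮] [IsStandardGraded 𝒮]
  {𝒯 : ℕ → Submodule k T} [GradedAlgebra 𝒯] [IsStandardGraded 𝒯]
  {A : Type v} [CommRing A] [Algebra k A] {𝒜 : ℕ → Submodule k A} [GradedAlgebra 𝒜]
  [IsStandardGraded 𝒜]
  {B : Type w} [CommRing B] [Algebra k B] {ℬ : ℕ → Submodule k B} [GradedAlgebra ℬ]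
  [IsStandardGraded ℬ]

theorem augmentation_map_of_graded {φ : A →ₐ[k] S} (hφ : ∀ n, ∀ a ∈ 𝒜 n, φ a ∈ 𝒮 n) (a : A) :
    augmentation 𝒮 (φ a) = augmentation 𝒜 a :=
  eq_augmentation 𝒜 ((augmentation 𝒮).comp φ)
    (fun n hn a ha => augmentation_of_mem 𝒮 hn (hφ n a ha)) a

theorem tensorToFibre_map {φ : A →ₐ[k] S} (hφ : ∀ n, ∀ a ∈ 𝒜 n, φ a ∈ 𝒮 n)
    {ψ : B →ₐ[k] T} (hψ : ∀ n, ∀ b ∈ ℬ n, ψ b ∈ 𝒯 n) (x : A ⊗[k] B) :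
    (tensorToFibre 𝒮 𝒯 (Algebra.TensorProduct.map φ ψ x) : S × T) =
      (φ (augRight A ℬ x), ψ (augLeft B 𝒜 x)) := by
  induction x using TensorProduct.induction_on with
  | zero => simp only [map_zero]; rfl
  | add x y hx hy =>
    rw [map_add, map_add, Subalgebra.coe_add, hx, hy]
    simp only [map_add, Prod.mk_add_mk]
  | tmul a b =>
    rw [Algebra.TensorProduct.map_tmul, tensorToFibre_tmul, augmentation_map_of_graded hφ,
      augmentation_map_of_graded hψ, augRight_tmul, augLeft_tmul]
    simp only [map_mul, AlgHom.commutes]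

/-- This puts the kernel in the form required of `L` in `isLin_fibreIdeal` and its companions. -/
theorem mem_ker_tensorToFibre_map {φ : A →ₐ[k] S} (hφ : ∀ n, ∀ a ∈ 𝒜 n, φ a ∈ 𝒮 n)
    {ψ : B →ₐ[k] T} (hψ : ∀ n, ∀ b ∈ ℬ n, ψ b ∈ 𝒯 n) (x : A ⊗[k] B) :
    x ∈ RingHom.ker ((tensorToFibre 𝒮 𝒯).comp (Algebra.TensorProduct.map φ ψ)) ↔
      augRight A ℬ x ∈ RingHom.ker φ ∧ augLeft B 𝒜 x ∈ RingHom.ker ψ := by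
  rw [RingHom.mem_ker, AlgHom.comp_apply, ← Subtype.coe_inj, tensorToFibre_map hφ hψ]
  exact Prod.mk_inj

theorem irrelevant_eq_augIdeal : (HomogeneousIdeal.irrelevant 𝒜).toIdeal = augIdeal 𝒜 :=
  Ideal.ext fun _ => mem_irrelevant_iff

/-- Golod morphisms onto Koszul algebras are compatible with fibre products. -/
theorem IsGolod.fibre {φ : A →ₐ[k] S} {ψ : B →ₐ[k] T} (hφ : IsGolod 𝒜 𝒮 φ) (hψ : IsGolod ℬ 𝒯 ψ)
    (hS : IsKoszul 𝒮) (hT : IsKoszul 𝒯) :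
    IsGolod (tensorGrading 𝒜 ℬ) (fibreGrading 𝒮 𝒯)
      ((tensorToFibre 𝒮 𝒯).comp (Algebra.TensorProduct.map φ ψ)) := by
  obtain ⟨_, hP₀⟩ := (isKoszul_iff 𝒮).mp hS
  obtain ⟨_, hP₀'⟩ := (isKoszul_iff 𝒯).mp hT
  obtain ⟨G, h, hG, hh, hlow, P, hP, heq⟩ := hφ.exists_series hP₀
  obtain ⟨G', h', hG', hh', hlow', P', hP', heq'⟩ := hψ.exists_series hP₀'
  obtain ⟨E, hE, hE'⟩ := IsLinResidue.fibre hP hP'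
  obtain ⟨a, rfl, ha⟩ := IsLinResidue.exists_isLin_augIdeal hG
  obtain ⟨b, rfl, hb⟩ := IsLinResidue.exists_isLin_augIdeal hG'
  obtain ⟨s, rfl, -⟩ := IsLinResidue.exists_isLin_augIdeal hP
  obtain ⟨t, rfl, -⟩ := IsLinResidue.exists_isLin_augIdeal hP'
  have hker := mem_ker_tensorToFibre_map hφ.graded hψ.graded
  have hgr : ∀ n, ∀ x ∈ tensorGrading 𝒜 ℬ n,
      (tensorToFibre 𝒮 𝒯).comp (Algebra.TensorProduct.map φ ψ) x ∈ fibreGrading 𝒮 𝒯 n :=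
    fun n x hx => tensorToFibre_graded 𝒮 𝒯 n _ (tensorMap_graded hφ.graded hψ.graded hx)
  have hsurj : Function.Surjective
      ((tensorToFibre 𝒮 𝒯).comp (Algebra.TensorProduct.map φ ψ)) :=
    (tensorToFibre_surjective 𝒮 𝒯).comp
      (TensorProduct.map_surjective (g := φ.toLinearMap) (g' := ψ.toLinearMap)
        hφ.surjective hψ.surjective)
  refine ⟨hgr, hsurj, ?_, ?_⟩
  · rw [irrelevant_eq_augIdeal]
    refine fibreIdeal_le_sq hker ?_ ?_
    · rw [← irrelevant_eq_augIdeal]; exact hφ.ker_le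
    · rw [← irrelevant_eq_augIdeal]; exact hψ.ker_le
  · refine golodEquality_of_isLin hgr hsurj
      (fun j hj x hx h0 => fibreIdeal_eq_zero hker hlow hlow' hj hx h0) hE'
      (fun n => (hG n).tensor (hG' n))
      (fun n => isLin_fibreIdeal hker (ha n) (hb n) (hG n) (hG' n) (hh n) (hh' n)) ?_
    -- This is `P + P' - PP'`, with constant term one; multiplying by it clears the denominator of
    -- `E`.
    have hD : (1 + X * s + (1 + X * t) - (1 + X * s) * (1 + X * t) : ℤ⟦X⟧) ≠ 0 := fun h0 => by
      have := congrArg constantCoeff h0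
      simp at this
    refine mul_right_cancel₀ hD ?_
    -- As `X²ab = (G - 1)(G' - 1)`, the factor `1 - X²(ab + G'h + Gh')` equals `G(1 - X²h') + G'(1 -
    -- X²h) - GG'`, which is `GG'(1/P + 1/P' - 1) = GG'/E`.
    linear_combination (1 - X ^ 2 * (a * b + ((1 + X * b) * h + (1 + X * a) * h'))) * hE +
      (1 + X * t) * (1 + X * b) * heq + (1 + X * s) * (1 + X * a) * heq'

end FibreGolod

end BackelinRoos

/-! ### Tensor products of complete intersections -/

namespace BackelinRoos

section CompleteIntersection

open RingTheory.Sequence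

/-- A sequence `fs` followed by lifts of a weakly regular sequence modulo `fs`. -/
theorem isWeaklyRegular_append_of_ker {C : Type*} [CommRing C] {D : Type*} [CommRing D]
    {φ : C →+* D} (hφ : Function.Surjective φ) {fs gs : List C}
    (hker : RingHom.ker φ = Ideal.ofList fs) (hfs : IsWeaklyRegular C fs)
    (hgs : IsWeaklyRegular D (gs.map φ)) : IsWeaklyRegular C (fs ++ gs) := by
  rw [isWeaklyRegular_append_iff]
  refine ⟨hfs, ?_⟩
  let e : (C ⧸ (Ideal.ofList fs • ⊤ : Submodule C C)) ≃+ D :=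
    (Submodule.quotEquivOfEq (Ideal.ofList fs • ⊤ : Submodule C C) (RingHom.ker φ)
      (by rw [hker, smul_eq_mul, Ideal.mul_top])).toAddEquiv.trans
      (RingHom.quotientKerEquivOfSurjective hφ).toAddEquiv
  refine (AddEquiv.isWeaklyRegular_congr (e := e) ?_).mpr hgs
  refine List.forall₂_map_right_iff.mpr (List.forall₂_same.mpr fun r _ x => ?_)
  obtain ⟨c, rfl⟩ := Submodule.mkQ_surjective _ x
  exact map_mul φ r c

theorem isWeaklyRegular_map_ringEquiv {C D : Type*} [CommRing C] [CommRing D]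
    (e : C ≃+* D) {fs : List C} (h : IsWeaklyRegular C fs) : IsWeaklyRegular D (fs.map e) :=
  (AddEquiv.isWeaklyRegular_congr (e := e.toAddEquiv) (List.forall₂_map_right_iff.mpr
    (List.forall₂_same.mpr fun r _ x => map_mul e r x))).mp h

variable {k : Type*} [Field k] {A B P P' : Type*} [CommRing A] [Algebra k A] [CommRing B]
  [Algebra k B] [CommRing P] [Algebra k P] [CommRing P'] [Algebra k P']

/-- `P ⊗ B` is flat over `P` because `B` is flat over the field `k`, and flat base change preserves
weak regularity. -/
theorem isWeaklyRegular_map_includeLeft {f : List P} (hf : IsWeaklyRegular P f) :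
    IsWeaklyRegular (P ⊗[k] B) (f.map fun p => p ⊗ₜ[k] (1 : B)) :=
  hf.of_flat (S := P ⊗[k] B)

theorem isWeaklyRegular_map_includeRight {g : List P} (hg : IsWeaklyRegular P g) :
    IsWeaklyRegular (A ⊗[k] P) (g.map fun p => (1 : A) ⊗ₜ[k] p) := by
  have := isWeaklyRegular_map_ringEquiv (Algebra.TensorProduct.comm k P A).toRingEquiv
    (isWeaklyRegular_map_includeLeft (B := A) hg)
  rwa [List.map_map] at this

/-- The elements `f ⊗ 1` are weakly regular by flatness. Modulo them the ring becomes `A ⊗ P'`,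
where flatness applies again to `1 ⊗ g`. -/
theorem isWeaklyRegular_tensor {π : P →ₐ[k] A} (hπ : Function.Surjective π) {f : List P}
    (hf : IsWeaklyRegular P f) (hker : RingHom.ker π = Ideal.ofList f) {g : List P'}
    (hg : IsWeaklyRegular P' g) :
    IsWeaklyRegular (P ⊗[k] P')
      (f.map (fun p => p ⊗ₜ[k] (1 : P')) ++ g.map fun p => (1 : P) ⊗ₜ[k] p) := by
  refine isWeaklyRegular_append_of_ker
    (φ := (Algebra.TensorProduct.map π (AlgHom.id k P')).toRingHom)
    (TensorProduct.map_surjective (g := π.toLinearMap) hπ Function.surjective_id) ?_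
    (isWeaklyRegular_map_includeLeft hf) ?_
  · refine (Algebra.TensorProduct.rTensor_ker π hπ).trans ?_
    rw [hker]
    exact Ideal.map_ofList _ f
  · rw [List.map_map]
    have h1 : (Algebra.TensorProduct.map π (AlgHom.id k P')).toRingHom ∘
        (fun p => (1 : P) ⊗ₜ[k] p) = fun p => (1 : A) ⊗ₜ[k] p := funext fun p =>
      congrArg (· ⊗ₜ[k] p) (map_one π)
    rw [h1]
    exact isWeaklyRegular_map_includeRight hg

theorem ker_tensor {π : P →ₐ[k] A} (hπ : Function.Surjective π) {f : List P}
    (hf : RingHom.ker π = Ideal.ofList f) {π' : P' →ₐ[k] B} (hπ' : Function.Surjective π')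
    {g : List P'} (hg : RingHom.ker π' = Ideal.ofList g) :
    RingHom.ker (Algebra.TensorProduct.map π π') =
      Ideal.ofList (f.map (fun p => p ⊗ₜ[k] (1 : P')) ++ g.map fun p => (1 : P) ⊗ₜ[k] p) := by
  rw [Algebra.TensorProduct.map_ker π π' hπ hπ', hf, hg, Ideal.ofList_append]
  exact congrArg₂ _ (Ideal.map_ofList _ f) (Ideal.map_ofList _ g)

/-- The polynomial ring in the disjoint union of two sets of variables. -/
noncomputable def tensorEquivFin (k : Type*) [Field k] (n m : ℕ) :
    MvPolynomial (Fin n) k ⊗[k] MvPolynomial (Fin m) k ≃ₐ[k] MvPolynomial (Fin (n + m)) k :=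
  (MvPolynomial.tensorEquivSum k (Fin n) (Fin m) k).trans
    (MvPolynomial.renameEquiv k finSumFinEquiv)

theorem tensorEquivFin_tmul_one (n m : ℕ) (p : MvPolynomial (Fin n) k) :
    tensorEquivFin k n m (p ⊗ₜ 1) = MvPolynomial.rename (Fin.castAdd m) p := by
  have : (tensorEquivFin k n m).toAlgHom.comp Algebra.TensorProduct.includeLeft =
      MvPolynomial.rename (Fin.castAdd m) := by
    ext i
    simp [tensorEquivFin]
  exact AlgHom.congr_fun this p

theorem tensorEquivFin_one_tmul (n m : ℕ) (p : MvPolynomial (Fin m) k) :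
    tensorEquivFin k n m (1 ⊗ₜ p) = MvPolynomial.rename (Fin.natAdd n) p := by
  have : (tensorEquivFin k n m).toAlgHom.comp Algebra.TensorProduct.includeRight =
      MvPolynomial.rename (Fin.natAdd n) := by
    ext i
    simp [tensorEquivFin]
  exact AlgHom.congr_fun this p

theorem IsCompleteIntersection.tensor {𝒜 : ℕ → Submodule k A} [GradedAlgebra 𝒜]
    [IsStandardGraded 𝒜] {ℬ : ℕ → Submodule k B} [GradedAlgebra ℬ] [IsStandardGraded ℬ]
    (hA : IsCompleteIntersection 𝒜) (hB : IsCompleteIntersection ℬ) :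
    IsCompleteIntersection (tensorGrading 𝒜 ℬ) := by
  obtain ⟨n, f, π, hf, hfr, hX, hπ, hker⟩ := hA
  obtain ⟨m, g, π', hg, hgr, hX', hπ', hker'⟩ := hB
  have : Nontrivial (A ⊗[k] B) := IsStandardGraded.nontrivial (𝒜 := tensorGrading 𝒜 ℬ)
  let e := tensorEquivFin k n m
  let F := f.map (fun p => p ⊗ₜ[k] (1 : MvPolynomial (Fin m) k)) ++
    g.map fun p => (1 : MvPolynomial (Fin n) k) ⊗ₜ[k] p
  have hkerF : RingHom.ker ((Algebra.TensorProduct.map π π').comp e.symm.toAlgHom) =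
      Ideal.ofList (F.map e) := by
    have h1 := congrArg (Ideal.map e.toRingEquiv.toRingHom) (ker_tensor hπ hker hπ' hker')
    rw [Ideal.map_ofList] at h1
    refine Eq.trans ?_ h1
    ext x
    rw [Ideal.mem_map_iff_of_surjective e.toRingEquiv.toRingHom e.surjective]
    constructor
    · exact fun hx => ⟨e.symm x, hx, e.apply_symm_apply x⟩
    · rintro ⟨y, hy, rfl⟩
      rw [RingHom.mem_ker] at hy ⊢
      refine Eq.trans ?_ hy
      exact congrArg _ (e.symm_apply_apply y)
  refine ⟨n + m, F.map e, (Algebra.TensorProduct.map π π').comp e.symm.toAlgHom, ?_,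
    ⟨isWeaklyRegular_map_ringEquiv e.toRingEquiv (isWeaklyRegular_tensor hπ hfr.1 hker hgr.1), ?_⟩,
    fun i => ?_, ?_, hkerF⟩
  · intro p hp
    obtain ⟨q, hq, rfl⟩ := List.mem_map.mp hp
    rcases List.mem_append.mp hq with hq | hq
    · obtain ⟨r, hr, rfl⟩ := List.mem_map.mp hq
      obtain ⟨d, hd⟩ := hf r hr
      exact ⟨d, by rw [tensorEquivFin_tmul_one]; exact hd.rename_isHomogeneous⟩
    · obtain ⟨r, hr, rfl⟩ := List.mem_map.mp hq
      obtain ⟨d, hd⟩ := hg r hr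
      exact ⟨d, by rw [tensorEquivFin_one_tmul]; exact hd.rename_isHomogeneous⟩
  -- Regularity beyond weak regularity means that the ideal is proper; it is the kernel of a ring
  -- map to the nonzero ring `A ⊗ B`.
  · rw [smul_eq_mul, Ideal.mul_top, ← hkerF]
    exact (RingHom.ker_ne_top _).symm
  · rw [AlgHom.comp_apply]
    induction i using Fin.addCases with
    | left i =>
      have h1 : e.symm (MvPolynomial.X (Fin.castAdd m i)) = MvPolynomial.X i ⊗ₜ 1 := by
        rw [AlgEquiv.symm_apply_eq, tensorEquivFin_tmul_one, MvPolynomial.rename_X]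
      change Algebra.TensorProduct.map π π' (e.symm _) ∈ _
      rw [h1, Algebra.TensorProduct.map_tmul, map_one]
      exact tmul_mem_tensorGrading 𝒜 ℬ (i := 1) (j := 0) (hX i) SetLike.GradedOne.one_mem
    | right i =>
      have h1 : e.symm (MvPolynomial.X (Fin.natAdd n i)) = 1 ⊗ₜ MvPolynomial.X i := by
        rw [AlgEquiv.symm_apply_eq, tensorEquivFin_one_tmul, MvPolynomial.rename_X]
      change Algebra.TensorProduct.map π π' (e.symm _) ∈ _
      rw [h1, Algebra.TensorProduct.map_tmul, map_one]
      exact tmul_mem_tensorGrading 𝒜 ℬ (i := 0) (j := 1) SetLike.GradedOne.one_mem (hX' i)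
  · exact (TensorProduct.map_surjective (g := π.toLinearMap) (g' := π'.toLinearMap) hπ hπ').comp
      e.symm.surjective

end CompleteIntersection

end BackelinRoos

theorem mainTheorem6 {k : Type u} [Field k]
    {S : Type v} [CommRing S] [Algebra k S] (𝒮 : ℕ → Submodule k S) [GradedAlgebra 𝒮]
    [BackelinRoos.IsStandardGraded 𝒮]
    {T : Type w} [CommRing T] [Algebra k T] (𝒯 : ℕ → Submodule k T) [GradedAlgebra 𝒯]
    [BackelinRoos.IsStandardGraded 𝒯]
    (hS : BackelinRoos.IsKoszul 𝒮) (hT : BackelinRoos.IsKoszul 𝒯)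
    (hSBR : BackelinRoos.HasBackelinRoos 𝒮) (hTBR : BackelinRoos.HasBackelinRoos 𝒯) :
    BackelinRoos.IsKoszul (BackelinRoos.fibreGrading 𝒮 𝒯) ∧
    BackelinRoos.HasBackelinRoos (BackelinRoos.fibreGrading 𝒮 𝒯) ∧
    ∀ (S₁ : Type v) [CommRing S₁] [Algebra k S₁] (𝒮₁ : ℕ → Submodule k S₁) [GradedAlgebra 𝒮₁]
      [BackelinRoos.IsStandardGraded 𝒮₁] (φ : S₁ →ₐ[k] S)
      (T₁ : Type w) [CommRing T₁] [Algebra k T₁] (𝒯₁ : ℕ → Submodule k T₁) [GradedAlgebra 𝒯₁]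
      [BackelinRoos.IsStandardGraded 𝒯₁] (ψ : T₁ →ₐ[k] T),
      BackelinRoos.IsCompleteIntersection 𝒮₁ → BackelinRoos.IsGolod 𝒮₁ 𝒮 φ →
      BackelinRoos.IsCompleteIntersection 𝒯₁ → BackelinRoos.IsGolod 𝒯₁ 𝒯 ψ →
        BackelinRoos.IsCompleteIntersection (BackelinRoos.tensorGrading 𝒮₁ 𝒯₁) ∧
        BackelinRoos.IsGolod (BackelinRoos.tensorGrading 𝒮₁ 𝒯₁) (BackelinRoos.fibreGrading 𝒮 𝒯)
          ((BackelinRoos.tensorToFibre 𝒮 𝒯).comp (Algebra.TensorProduct.map φ ψ)) := by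
  refine ⟨?_, ?_, ?_⟩
  · obtain ⟨_, hP⟩ := (BackelinRoos.isKoszul_iff 𝒮).mp hS
    obtain ⟨_, hP'⟩ := (BackelinRoos.isKoszul_iff 𝒯).mp hT
    obtain ⟨E, -, hE⟩ := BackelinRoos.IsLinResidue.fibre hP hP'
    exact (BackelinRoos.isKoszul_iff _).mpr ⟨E, hE⟩
  · obtain ⟨S₁, _, _, 𝒮₁, _, _, φ, hS₁, hφ⟩ := hSBR
    obtain ⟨T₁, _, _, 𝒯₁, _, _, ψ, hT₁, hψ⟩ := hTBR
    exact ⟨S₁ ⊗[k] T₁, inferInstance, inferInstance, BackelinRoos.tensorGrading 𝒮₁ 𝒯₁,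
      inferInstance, inferInstance, _, hS₁.tensor hT₁, hφ.fibre hψ hS hT⟩
  · intro S₁ _ _ 𝒮₁ _ _ φ T₁ _ _ 𝒯₁ _ _ ψ hS₁ hφ hT₁ hψ
    exact ⟨hS₁.tensor hT₁, hφ.fibre hψ hS hT⟩
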